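/- **Setting.** For $p\in\mathbb N$ let $y^{(p)},\lambda^{(p)}\in\mathbb R^p$ with $0\le\lambda^{(p)}_1\le\dots\le\lambda^{(p)}_p$, and let $$\mathrm{Prox}_{\lambda}(y)=\arg\min_{x\in\mathbb R^p}\ \tfrac12\|y-x\|^2+\sum_{i=1}^p\lambda_i|x|_{(i)},$$ where $|x|_{(1)}\le\dots\le|x|_{(p)}$ are the ordered absolute values of the coordinates. A sequence $x^{(p)}\in\mathbb R^p$ is called converging with limiting law $\mu$ if $\frac1p\sum_i\delta_{x_i^{(p)}}\to\mu$ weakly, $\int t^2\,d\mu<\infty$ and $\frac1p\|x^{(p)}\|^2\to\int t^2\,d\mu(t)$. Let $Y\sim F_y$ and $\lambda\sim F_\lambda$ be real random variables with finite second moments and $\lambda\ge0$ almost surely. Let $F_{|y|}$ be the distribution function of $|Y|$, and $F_\lambda^{-1}(u)=\inf\{x:F_\lambda(x)\ge u\}$ for $0<u\le 1$, $F_\lambda^{-1}(0)=\inf\{x:F_\lambda(x)>0\}$. Let $S=\{y\ge0:\mathbb P(|Y|\ge y)>0\}$. **Construction (continuum pool-adjacent-violators).** Put $G_0(y)=y-\lambda(y)$,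 where $\lambda(y)=F_\lambda^{-1}(F_{|y|}(y))$ if $\mathbb P(|Y|=y)=0$, and $\lambda(y)=\frac{1}{F_{|y|}(y)-F_{|y|}(y^-)}\int_{F_{|y|}(y^-)}^{F_{|y|}(y)}F_\lambda^{-1}(u)\,du$ otherwise. For $t=0,1,\dots$, as long as $G_t$ is not non-decreasing on $S$: * Let $I_2=[b_1,b_2]$ be the first maximal decreasing interval of $G_t$ in $S$: $G_t$ is non-decreasing on $I_1=[0,b_1)$ but on no neighbourhood of $b_1$ in $S$, is strictly decreasing on $I_2$ (which may be one point, where $G_t$ jumps down), and either is non-decreasing on a right neighbourhood $(b_2,b_2+\varepsilon)\cap S$ with $\mathbb P(|Y|>b_2)>0$, or $I_2=S\cap[b_1,\infty)$. For $v\le w\le\infty$ let $\mathcal T(v,w)=\mathbb E\big[G_t(|Y|)\,\big|\,v\le|Y|\le w\big]$. * If $I_2=S\cap[b_1,\infty)$, let $T=\sup_{0\le v\le b_1}\mathcal T(v,\infty)$ and $I_3=\emptyset$. Otherwise let $I_3$ be the maximal relatively open interval of $S$ with left end $b_2$ (excluded) on which $G_t$ is non-decreasing, and let $T=\inf_{w\in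 I_3}\sup_{0\le v\le b_1}\mathcal T(v,w)$. * $G_{t+1}$ equals $T$ on $\{v\in I_1:G_t(v)>T\}\cup I_2\cup\{w\in I_3:G_t(w)<T\}$, and equals $G_t$ elsewhere. If for some $t$ the function $G_t$ is non-decreasing on $S$, the procedure stops with $G=G_t$ on $S$ and $G(y)=y-\sup_{z\in S}(z-G_t(z))$ for $y\ge 0$, $y\notin S$, and its output is the function $y\mapsto\mathrm{sign}(y)\max\{0,G(|y|)\}$. **Proposition 1.** For all $F_y,F_\lambda$ as above there is a function $\eta=\eta(\cdot\,;F_y,F_\lambda):\mathbb R\to\mathbb R$ such that 1. $\eta$ is odd, non-decreasing and $1$-Lipschitz; 2. whenever the procedure stops, its output is $\eta$; and it does stop if $S$ is, up to finitely many points, a finite union of intervals on each of which $G_0$ is non-decreasing or strictly decreasing; 3. for all converging sequences $y^{(p)}$ and $\lambda^{(p)}$ (with $0\le\lambda_1^{(p)}\le\dots\le\lambda_p^{(p)}$) whose limiting laws have distribution functions $F_y$ and $F_\lambda$, $$\lim_{p\to\infty}\frac1p\,\big\|\mathrm{Prox}_{\lambda^{(p)}}(y^{(p)})-\eta(y^{(p)};F_y,F_\lambda)\big\|^2=0,$$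 with $\eta$ applied coordinate-wise. -/

import Mathlib

open MeasureTheory Set Filter Topology ProbabilityTheory

/-! ### Converging sequences and the proximal operator -/

/-- A converging sequence of vectors `x p ∈ ℝᵖ` with limiting measure `μ`: the empirical measures
`(1/p) ∑ i, δ_{x p i}` converge weakly to `μ` (tested against bounded continuous functions), and
their second moments converge to the finite second moment of `μ`. -/
structure IsConvergingSequence (x : (p : ℕ) → Fin p → ℝ) (μ : Measure ℝ) : Prop where
  weak : ∀ f : BoundedContinuousFunction ℝ ℝ,
    Tendsto (fun p : ℕ => (∑ i, f (x p i)) / (p : ℝ)) atTop (𝓝 (∫ t, f t ∂μ))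
  integrable_sq : Integrable (fun t : ℝ => t ^ 2) μ
  secondMoment :
    Tendsto (fun p : ℕ => (∑ i, (x p i) ^ 2) / (p : ℝ)) atTop (𝓝 (∫ t, t ^ 2 ∂μ))

/-- `orderStat a` is the non-decreasing rearrangement `a_(1) ≤ ⋯ ≤ a_(p)` of `a`. -/
noncomputable def orderStat {p : ℕ} (a : Fin p → ℝ) (i : Fin p) : ℝ :=
  a (Tuple.sort a i)

/-- The objective `½‖y - x‖² + ∑ i, lam i * |x|_(i)`. -/
noncomputable def slopeObjective {p : ℕ} (lam y x : Fin p → ℝ) : ℝ :=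
  (1 / 2) * ∑ i, (y i - x i) ^ 2 + ∑ i, lam i * orderStat (fun j => |x j|) i

/-- `Prox_lam(y)`: the minimizer of the objective, which exists and is unique when
`0 ≤ lam 1 ≤ ⋯ ≤ lam p`. -/
noncomputable def slopeProx {p : ℕ} (lam y : Fin p → ℝ) : Fin p → ℝ :=
  Classical.epsilon fun x => ∀ z, slopeObjective lam y x ≤ slopeObjective lam y z

/-! ### The initial function `G₀(y) = y - λ(y)` -/

/-- The law of `|Y|` when `Y` has law `μ`. -/
noncomputable def absLaw (μ : Measure ℝ) : Measure ℝ := μ.map fun y => |y|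

/-- The quantile function `F⁻¹(u) = inf {x | u ≤ F x}` of `μ` for `0 < u`.  At `u = 0`, where this
infimum is `-∞`, it is continued by its right limit `inf {x | 0 < F x}`, the left end of the
support. -/
noncomputable def quantile (μ : Measure ℝ) (u : ℝ) : ℝ :=
  if 0 < u then sInf {x | u ≤ cdf μ x} else sInf {x | 0 < cdf μ x}

open Classical in
/-- The function `λ(y)`; `ν` is the law of `|Y|` and `μl` the limiting law of the
regularization sequence. -/
noncomputable def lamFun (ν μl : Measure ℝ) (y : ℝ) : ℝ :=
  if ν {y} = 0 then quantile μl (cdf ν y)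
  else (∫ u in (Function.leftLim (cdf ν) y)..(cdf ν y), quantile μl u) /
    (cdf ν y - Function.leftLim (cdf ν) y)

/-- `G₀(y) = y - λ(y)`. -/
noncomputable def initialG (ν μl : Measure ℝ) (y : ℝ) : ℝ := y - lamFun ν μl y

/-! ### Pooling

All functions `G` are looked at on the interval `massRange ν` of those `y ≥ 0` for which `|Y|` still has
mass in `[y, ∞)`: it is `[0, ∞)` if `|Y|` is unbounded, and otherwise it ends at `ess sup |Y|`
(included if and only if it is an atom). -/

/-- The interval `{y ≥ 0 | ℙ(|Y| ≥ y) > 0}`. -/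
def massRange (ν : Measure ℝ) : Set ℝ := {y | 0 ≤ y ∧ 0 < ν (Ici y)}

/-- `b₁` is the left end point of the first place where `G` decreases: `G` is non-decreasing on
`[0, b₁)`, but on no neighbourhood of `b₁`. -/
structure StartsFirstDescent (ν : Measure ℝ) (G : ℝ → ℝ) (b₁ : ℝ) : Prop where
  mem : b₁ ∈ massRange ν
  mono_left : MonotoneOn G (Ico 0 b₁)
  descent : ∀ ε > 0, ¬ MonotoneOn G (massRange ν ∩ Ioo (b₁ - ε) (b₁ + ε))

/-- `[b₁, b₂]` is the first maximal decreasing interval (MDI) of `G` and `ℙ(|Y| > b₂) > 0`.  The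
interval may consist of one point, at which `G` then jumps down. -/
structure IsFirstMDI (ν : Measure ℝ) (G : ℝ → ℝ) (b₁ b₂ : ℝ) : Prop
    extends StartsFirstDescent ν G b₁ where
  le : b₁ ≤ b₂
  mass_right : 0 < ν (Ioi b₂)
  anti : StrictAntiOn G (Icc b₁ b₂)
  mono_right : ∃ ε > 0, MonotoneOn G (massRange ν ∩ Ioo b₂ (b₂ + ε))

/-- The first maximal decreasing interval of `G` starts at `b₁` and has no mass of `|Y|` to its
right: it is all of the mass range from `b₁` on (its right end may be infinite). -/
structure IsFirstMDIToEnd (ν : Measure ℝ) (G : ℝ → ℝ) (b₁ : ℝ) : Prop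
    extends StartsFirstDescent ν G b₁ where
  anti : StrictAntiOn G (massRange ν ∩ Ici b₁)

/-- The right neighbouring maximal non-decreasing interval `I₃ = (b₂, b₃)` of an MDI ending at
`b₂`. -/
def rightMNDI (ν : Measure ℝ) (G : ℝ → ℝ) (b₂ : ℝ) : Set ℝ :=
  {w ∈ massRange ν | b₂ < w ∧ ∃ ε > 0, MonotoneOn G (massRange ν ∩ Ioo b₂ (w + ε))}

/-- `𝒯(v, w; G) = 𝔼[G(|Y|) | |Y| ∈ [v, w]]`. -/
noncomputable def condMean (ν : Measure ℝ) (G : ℝ → ℝ) (v w : ℝ) : ℝ :=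
  ⨍ y in Icc v w, G y ∂ν

/-- `𝒯(v, ∞; G) = 𝔼[G(|Y|) | |Y| ≥ v]`. -/
noncomputable def condMeanToEnd (ν : Measure ℝ) (G : ℝ → ℝ) (v : ℝ) : ℝ :=
  ⨍ y in Ici v, G y ∂ν

/-- The optimal value `min_{w ∈ I₃} max_{v ≤ b₁} 𝒯(v, w; G)`. -/
noncomputable def minMaxValue (ν : Measure ℝ) (G : ℝ → ℝ) (b₁ b₂ : ℝ) : ℝ :=
  ⨅ w : rightMNDI ν G b₂, ⨆ v : Icc (0 : ℝ) b₁, condMean ν G v w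

/-- The optimal value `max_{v ≤ b₁} 𝒯(v, ∞; G)`. -/
noncomputable def maxValueToEnd (ν : Measure ℝ) (G : ℝ → ℝ) (b₁ : ℝ) : ℝ :=
  ⨆ v : Icc (0 : ℝ) b₁, condMeanToEnd ν G v

/-- The pooled interval `[b_L, b_R]` for an MDI `[b₁, b₂]` and the optimal value `t`: the points of
the left neighbouring MNDI with `t < G`, the MDI itself, and the points of the right neighbouring
MNDI with `G < t`.  Its infimum is the left balance point `b_L = v*` and its supremum (possibly `∞`)
the right balance point `b_R = w*`.  End points of `[b_L, b_R]` in the two neighbouring intervals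
that are left out here satisfy `G = t` already, by continuity of `G` there. -/
def pooledInterval (ν : Measure ℝ) (G : ℝ → ℝ) (b₁ b₂ t : ℝ) : Set ℝ :=
  {v ∈ Ico 0 b₁ | t < G v} ∪ Icc b₁ b₂ ∪ {w ∈ rightMNDI ν G b₂ | G w < t}

/-- The pooled interval for an MDI that extends from `b₁` to the end of the mass range. -/
def pooledIntervalToEnd (ν : Measure ℝ) (G : ℝ → ℝ) (b₁ t : ℝ) : Set ℝ :=
  {v ∈ Ico 0 b₁ | t < G v} ∪ (massRange ν ∩ Ici b₁)

open Classical in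
/-- One pass through the loop: on the pooled interval of the first MDI, `G` is replaced by the
optimal value. -/
inductive PoolStep (ν : Measure ℝ) (G : ℝ → ℝ) : (ℝ → ℝ) → Prop
  | inner (b₁ b₂ : ℝ) (h : IsFirstMDI ν G b₁ b₂) :
      PoolStep ν G fun y =>
        if y ∈ pooledInterval ν G b₁ b₂ (minMaxValue ν G b₁ b₂)
        then minMaxValue ν G b₁ b₂ else G y
  | toEnd (b₁ : ℝ) (h : IsFirstMDIToEnd ν G b₁) :
      PoolStep ν G fun y =>
        if y ∈ pooledIntervalToEnd ν G b₁ (maxValueToEnd ν G b₁)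
        then maxValueToEnd ν G b₁ else G y

open Classical in
/-- The scalar function `y ↦ sign(y) max{0, G(|y|)}`.  Beyond the mass range, `G` is continued with
slope one. -/
noncomputable def scalarOfG (ν : Measure ℝ) (G : ℝ → ℝ) (y : ℝ) : ℝ :=
  Real.sign y * max 0
    (if |y| ∈ massRange ν then G |y| else |y| - ⨆ z : massRange ν, ((z : ℝ) - G z))

/-- `η` is the output of the procedure on the limiting laws `μy`, `μl`: finitely many passes through
the loop lead from `G₀` to a `G` without decreasing parts, and `η` is its scalar function. -/
def IsPoolOutput (μy μl : Measure ℝ) (η : ℝ → ℝ) : Prop :=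
  ∃ G : ℝ → ℝ,
    Relation.ReflTransGen (PoolStep (absLaw μy)) (initialG (absLaw μy) μl) G ∧
    MonotoneOn G (massRange (absLaw μy)) ∧
    η = scalarOfG (absLaw μy) G

/-- `G` has finitely many monotonicity intervals (hence finitely many MDIs) on the mass range:
after removal of finitely many points it is, on each remaining interval, either non-decreasing or
strictly decreasing. -/
def HasFinitelyManyMDIs (ν : Measure ℝ) (G : ℝ → ℝ) : Prop :=
  ∃ A : Finset ℝ, ∀ C : Set ℝ, C ⊆ massRange ν → C.OrdConnected → Disjoint C (A : Set ℝ) →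
    MonotoneOn G C ∨ StrictAntiOn G C

/-!
Let `q` and `ℓ` be the quantile functions of the law `ν` of `|Y|` and of `μl`.  The function `η` is
characterized by optimality: `η ∘ q` is the projection in `L²(0, 1)` of `q - ℓ` onto the cone of
nonnegative non-decreasing functions.  Each pooling step keeps `G` the candidate for the projection
of `G₀`, in the sense that `G₀ - G` has nonpositive tail integrals and is orthogonal to the
functions of `G`; once `G` is non-decreasing, truncation at zero yields the optimal `η`.  A pooling
step is determined by `G`, so the output is unique, and it moves the first decreasing interval
to the right, so the procedure stops if there are finitely many of them.  If it does not stop, round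
`ν` down to finite grids, where it does, and pass to a limit of the `1`-Lipschitz outputs.

For finite `p`, the variational inequality of the proximal point and the rearrangement inequality
bound the squared distance to `η(y)` by `⟨q - η ∘ q - ℓ, x - η ∘ q⟩`, with the empirical quantile
functions `q`, `ℓ` and the sorted absolute values `x` of the proximal point.  In the limit
optimality makes this nonpositive, because empirical quantile functions converge in `L²`.
-/

/-! ### The mass range -/

section MassRange

variable {ν : Measure ℝ}

theorem massRange_of_le {x y : ℝ} (hy : y ∈ massRange ν) (hx : 0 ≤ x) (hxy : x ≤ y) :
    x ∈ massRange ν :=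
  ⟨hx, hy.2.trans_le (measure_mono (Ici_subset_Ici.2 hxy))⟩

theorem ordConnected_massRange : (massRange ν).OrdConnected :=
  ⟨fun _ hx _ hy _ hz => massRange_of_le hy (hx.1.trans hz.1) hz.2⟩

theorem measurableSet_massRange : MeasurableSet (massRange ν) :=
  ordConnected_massRange.measurableSet

theorem zero_mem_massRange [NeZero ν] (hν : ν (Iio 0) = 0) : 0 ∈ massRange ν := by
  refine ⟨le_rfl, pos_iff_ne_zero.2 fun h => NeZero.ne ν ?_⟩
  rw [← Measure.measure_univ_eq_zero, ← Iio_union_Ici (a := (0 : ℝ))]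
  exact measure_union_null hν h

theorem measure_compl_massRange (hν : ν (Iio 0) = 0) : ν (massRange ν)ᶜ = 0 := by
  have hIci : ∀ y ∉ massRange ν, 0 ≤ y → ν (Ici y) = 0 := fun y hy h0 =>
    not_not.1 fun hne => hy ⟨h0, pos_iff_ne_zero.2 hne⟩
  refine measure_null_of_locally_null _ fun x hx => ?_
  by_cases hleft : ∃ y ∉ massRange ν, 0 ≤ y ∧ y < x
  · obtain ⟨y, hy, h0, hyx⟩ := hleft
    exact ⟨Ici y, mem_nhdsWithin_of_mem_nhds (Ici_mem_nhds hyx), hIci y hy h0⟩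
  · push Not at hleft
    rcases lt_or_ge x 0 with hx0 | hx0
    · exact ⟨Iio 0, mem_nhdsWithin_of_mem_nhds (Iio_mem_nhds hx0), hν⟩
    · refine ⟨Iio 0 ∪ Ici x, mem_of_superset self_mem_nhdsWithin fun y hy => ?_,
        measure_union_null hν (hIci x hx hx0)⟩
      exact (lt_or_ge y 0).imp id fun h0 => hleft y hy h0

theorem ae_mem_massRange (hν : ν (Iio 0) = 0) : ∀ᵐ y ∂ν, y ∈ massRange ν :=
  measure_compl_massRange hν

theorem exists_mem_massRange_gt (hν : ν (Iio 0) = 0) {b : ℝ} (h : 0 < ν (Ioi b)) :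
    ∃ y ∈ massRange ν, b < y := by
  by_contra! hall
  refine h.ne' (measure_mono_null (fun y hy => ?_) (measure_compl_massRange hν))
  exact fun hyS => absurd (hall y hyS) (not_le.2 hy)

end MassRange

/-! ### Averages and integrals over intervals -/

section Averages

variable {α : Type*} [MeasurableSpace α] {μ : Measure α} {f : α → ℝ} {s t : Set α}

theorem setAverage_sub_mul [IsFiniteMeasure μ] (hf : Integrable f μ) (hs : 0 < μ s) (c : ℝ) :
    ((⨍ x in s, f x ∂μ) - c) * μ.real s = ∫ x in s, (f x - c) ∂μ := by
  have h0 : μ.real s ≠ 0 := (ENNReal.toReal_pos hs.ne' (measure_ne_top _ _)).ne'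
  rw [integral_sub hf.integrableOn (integrable_const _), setIntegral_const, setAverage_eq,
    smul_eq_mul, smul_eq_mul]
  field_simp

theorem setAverage_le [IsFiniteMeasure μ] (hf : Integrable f μ) (hs : 0 < μ s) {c : ℝ}
    (h : ∀ᵐ x ∂μ.restrict s, f x ≤ c) : ⨍ x in s, f x ∂μ ≤ c := by
  have h0 : 0 < μ.real s := ENNReal.toReal_pos hs.ne' (measure_ne_top _ _)
  have hmul := setAverage_sub_mul hf hs c
  have hint : ∫ x in s, (f x - c) ∂μ ≤ 0 :=
    integral_nonpos_of_ae (h.mono fun x hx => sub_nonpos.2 hx)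
  exact sub_nonpos.1 (nonpos_of_mul_nonpos_left (hmul.trans_le hint) h0)

theorem le_setAverage [IsFiniteMeasure μ] (hf : Integrable f μ) (hs : 0 < μ s) {c : ℝ}
    (h : ∀ᵐ x ∂μ.restrict s, c ≤ f x) : c ≤ ⨍ x in s, f x ∂μ := by
  have h0 : 0 < μ.real s := ENNReal.toReal_pos hs.ne' (measure_ne_top _ _)
  have hmul := setAverage_sub_mul hf hs c
  have hint : 0 ≤ ∫ x in s, (f x - c) ∂μ :=
    integral_nonneg_of_ae (h.mono fun x hx => sub_nonneg.2 hx)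
  exact sub_nonneg.1 (nonneg_of_mul_nonneg_left (hint.trans_eq hmul.symm) h0)

theorem setIntegral_le_setIntegral_of_sign (hf : Integrable f μ) (hs : MeasurableSet s)
    (ht : MeasurableSet t) (hst : ∀ x ∈ s \ t, f x ≤ 0) (hts : ∀ x ∈ t \ s, 0 ≤ f x) :
    ∫ x in s, f x ∂μ ≤ ∫ x in t, f x ∂μ := by
  rw [← integral_indicator hs, ← integral_indicator ht]
  refine integral_mono (hf.indicator hs) (hf.indicator ht) fun x => ?_
  by_cases h1 : x ∈ s <;> by_cases h2 : x ∈ t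
  · simp [h1, h2]
  · simpa [h1, h2] using hst x ⟨h1, h2⟩
  · simpa [h1, h2] using hts x ⟨h2, h1⟩
  · simp [h1, h2]

theorem setIntegral_inter_nonpos (hf : Integrable f μ) (hs : MeasurableSet s)
    (ht : MeasurableSet t) (h0 : ∫ x in t, f x ∂μ = 0)
    (hcross : (∀ x ∈ s ∩ t, f x ≤ 0) ∨ ∀ x ∈ t \ s, 0 ≤ f x) :
    ∫ x in s ∩ t, f x ∂μ ≤ 0 := by
  rcases hcross with hneg | hpos
  · exact setIntegral_nonpos (hs.inter ht) hneg
  · refine (setIntegral_le_setIntegral_of_sign hf (hs.inter ht) ht ?_ ?_).trans_eq h0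
    · exact fun x hx => absurd hx.1.2 hx.2
    · exact fun x hx => hpos x ⟨hx.1, fun h => hx.2 ⟨h, hx.1⟩⟩

end Averages

section IntervalIntegrals

variable {ν : Measure ℝ} {f : ℝ → ℝ}

theorem isLUB_setIntegral_Ico (hf : Integrable f ν) {a b : ℝ} (hab : a ≤ b)
    (hm : MonotoneOn f (Ico a b)) :
    IsLUB (range fun v : Icc a b => ∫ y in Ico (v : ℝ) b, f y ∂ν)
      (∫ y in {v ∈ Ico a b | 0 < f v}, f y ∂ν) := by
  set s := {v ∈ Ico a b | 0 < f v}
  have hup : ∀ x ∈ s, ∀ y, x ≤ y → y < b → y ∈ s := fun x hx y hxy hyb =>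
    have hy : y ∈ Ico a b := ⟨hx.1.1.trans hxy, hyb⟩
    ⟨hy, hx.2.trans_le (hm hx.1 hy hxy)⟩
  have hconn : s.OrdConnected := ⟨fun x hx y hy z hz => hup x hx z hz.1 (hz.2.trans_lt hy.1.2)⟩
  refine ⟨?_, fun K hK => ?_⟩
  · rintro _ ⟨v, rfl⟩
    refine setIntegral_le_setIntegral_of_sign hf measurableSet_Ico hconn.measurableSet
      (fun y hy => ?_) fun y hy => hy.1.2.le
    exact not_lt.1 fun hlt => hy.2 ⟨⟨v.2.1.trans hy.1.1, hy.1.2⟩, hlt⟩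
  have hK' : ∀ v ∈ Icc a b, ∫ y in Ico v b, f y ∂ν ≤ K := fun v hv => hK ⟨⟨v, hv⟩, rfl⟩
  rcases s.eq_empty_or_nonempty with he | hne
  · simpa [he] using hK' b ⟨hab, le_rfl⟩
  have : Nonempty s := hne.to_subtype
  have hU : ⋃ v : (s : Type)ᵒᵈ, Ico ((OrderDual.ofDual v : s) : ℝ) b = s := by
    refine Subset.antisymm (iUnion_subset fun v x hx => hup _ v.2 x hx.1 hx.2) fun x hx => ?_
    exact mem_iUnion.2 ⟨OrderDual.toDual ⟨x, hx⟩, le_rfl, hx.1.2⟩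
  have hlim := tendsto_setIntegral_of_monotone (μ := ν) (f := f)
    (s := fun v : (s : Type)ᵒᵈ => Ico ((OrderDual.ofDual v : s) : ℝ) b)
    (fun _ => measurableSet_Ico) (fun v w hvw => Ico_subset_Ico_left hvw) hf.integrableOn
  rw [hU] at hlim
  exact le_of_tendsto' hlim fun v => hK' _ ⟨v.2.1.1, v.2.1.2.le⟩

theorem tendsto_setIntegral_Ioc_initial (hf : Integrable f ν) {b : ℝ} {s : Set ℝ}
    (hs : s ⊆ Ioi b) (hlow : ∀ x ∈ s, ∀ y, b < y → y ≤ x → y ∈ s) (hne : s.Nonempty) :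
    Tendsto (fun w : s => ∫ y in Ioc b (w : ℝ), f y ∂ν) atTop (𝓝 (∫ y in s, f y ∂ν)) := by
  have : Nonempty s := hne.to_subtype
  have : s.OrdConnected := ⟨fun x hx y hy z hz => hlow y hy z ((hs hx).out.trans_le hz.1) hz.2⟩
  have hU : ⋃ w : s, Ioc b (w : ℝ) = s := by
    refine Subset.antisymm (iUnion_subset fun w x hx => hlow _ w.2 x hx.1 hx.2) fun x hx => ?_
    exact mem_iUnion.2 ⟨⟨x, hx⟩, hs hx, le_rfl⟩
  have hlim := tendsto_setIntegral_of_monotone (μ := ν) (f := f) (s := fun w : s => Ioc b (w : ℝ))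
    (fun _ => measurableSet_Ioc) (fun v w hvw => Ioc_subset_Ioc_right hvw) hf.integrableOn
  rwa [hU] at hlim

theorem tendsto_setIntegral_Ioc_shrink (hf : Integrable f ν) {b : ℝ} {s : Set ℝ}
    (hs : s ⊆ Ioi b) (hlow : ∀ x ∈ s, ∀ y, b < y → y ≤ x → y ∈ s) (hne : s.Nonempty) :
    Tendsto (fun w : s => ∫ y in Ioc b (w : ℝ), f y ∂ν) atBot (𝓝 0) := by
  obtain ⟨w₀, hw₀⟩ := hne
  have : s.OrdConnected := ⟨fun x hx y hy z hz => hlow y hy z ((hs hx).out.trans_le hz.1) hz.2⟩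
  have hI : ⋂ w : (s : Type)ᵒᵈ, Ioc b ((OrderDual.ofDual w : s) : ℝ) = ∅ := by
    refine eq_empty_of_forall_notMem fun x hx => ?_
    have hbx : b < x := (mem_iInter.1 hx (OrderDual.toDual ⟨w₀, hw₀⟩)).1
    have hxw : x ≤ w₀ := (mem_iInter.1 hx (OrderDual.toDual ⟨w₀, hw₀⟩)).2
    have hm : (b + x) / 2 ∈ s := hlow w₀ hw₀ _ (by linarith) (by linarith)
    have : x ≤ (b + x) / 2 := (mem_iInter.1 hx (OrderDual.toDual ⟨_, hm⟩)).2
    linarith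
  have : Nonempty s := ⟨⟨w₀, hw₀⟩⟩
  have hlim := tendsto_setIntegral_of_antitone (μ := ν) (f := f)
    (s := fun w : (s : Type)ᵒᵈ => Ioc b ((OrderDual.ofDual w : s) : ℝ))
    (fun _ => measurableSet_Ioc) (fun v w hvw => Ioc_subset_Ioc_right hvw)
    ⟨OrderDual.toDual ⟨w₀, hw₀⟩, hf.integrableOn⟩
  rwa [hI, Measure.restrict_empty, integral_zero_measure] at hlim

theorem isGLB_setIntegral_Ioc (hf : Integrable f ν) {b : ℝ} {s : Set ℝ} (hs : s ⊆ Ioi b)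
    (hlow : ∀ x ∈ s, ∀ y, b < y → y ≤ x → y ∈ s) (hne : s.Nonempty) (hm : MonotoneOn f s) :
    IsGLB (range fun w : s => ∫ y in Ioc b (w : ℝ), f y ∂ν)
      (∫ y in {w ∈ s | f w < 0}, f y ∂ν) := by
  set r := {w ∈ s | f w < 0}
  have hrlow : ∀ x ∈ r, ∀ y, b < y → y ≤ x → y ∈ r := fun x hx y hby hyx =>
    have hy := hlow x hx.1 y hby hyx
    ⟨hy, (hm hy hx.1 hyx).trans_lt hx.2⟩
  have hr : MeasurableSet r := OrdConnected.measurableSet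
    ⟨fun x hx y hy z hz => hrlow y hy z ((hs hx.1).out.trans_le hz.1) hz.2⟩
  refine ⟨?_, fun K hK => ?_⟩
  · rintro _ ⟨w, rfl⟩
    refine setIntegral_le_setIntegral_of_sign hf hr measurableSet_Ioc (fun y hy => hy.1.2.le)
      fun y hy => ?_
    exact not_lt.1 fun hlt => hy.2 ⟨hlow w w.2 y hy.1.1 hy.1.2, hlt⟩
  have hK' : ∀ w ∈ s, K ≤ ∫ y in Ioc b w, f y ∂ν := fun w hw => hK ⟨⟨w, hw⟩, rfl⟩
  have : Nonempty s := hne.to_subtype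
  rcases r.eq_empty_or_nonempty with he | hrne
  · rw [he, Measure.restrict_empty, integral_zero_measure]
    exact ge_of_tendsto' (tendsto_setIntegral_Ioc_shrink hf hs hlow hne) fun w => hK' w w.2
  · have : Nonempty r := hrne.to_subtype
    exact ge_of_tendsto' (tendsto_setIntegral_Ioc_initial hf ((sep_subset _ _).trans hs) hrlow hrne)
      fun w => hK' w w.2.1

/-- At the minimax value `T` of the quotients `K v w`, the extremal numerators balance: there is no
duality gap since the numerator of `K v w - T` separates into a part depending on `v` and a part
depending on `w`. -/
theorem add_eq_zero_of_minimax {V W : Type*} {K P : V → W → ℝ} {A : V → ℝ} {B S : W → ℝ}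
    {a b c T : ℝ} (hK : ∀ v w, (K v w - T) * P v w = A v + c + B w) (hP : ∀ v w, 0 ≤ P v w)
    (hP1 : ∀ v w, P v w ≤ 1) (ha : IsLUB (range A) a) (hb : IsGLB (range B) b)
    (hS : ∀ w, IsLUB (range fun v => K v w) (S w)) (hT : IsGLB (range S) T) :
    a + c + b = 0 := by
  refine le_antisymm (not_lt.1 fun hpos => ?_) (not_lt.1 fun hneg => ?_)
  · have hlow : ∀ w, T + (a + c + b) / 2 ≤ S w := fun w => by
      obtain ⟨_, ⟨v, rfl⟩, hv⟩ := (lt_isLUB_iff ha).1 (show a - (a + c + b) / 2 < a by linarith)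
      have hB : b ≤ B w := hb.1 ⟨w, rfl⟩
      have hKS : K v w ≤ S w := (hS w).1 ⟨v, rfl⟩
      nlinarith [hK v w, hP v w, hP1 v w]
    linarith [hT.2 (forall_mem_range.2 hlow)]
  · obtain ⟨_, ⟨w, rfl⟩, hw⟩ := (isGLB_lt_iff hb).1 (show b < b - (a + c + b) / 2 by linarith)
    have hup : ∀ v, K v w ≤ T + (a + c + b) / 2 := fun v => by
      have hA : A v ≤ a := ha.1 ⟨v, rfl⟩
      by_contra! hlt
      nlinarith [hK v w, hP v w, hP1 v w]
    linarith [(hS w).2 (forall_mem_range.2 hup), hT.1 ⟨w, rfl⟩]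

end IntervalIntegrals

/-! ### Invariants of the pooling procedure -/

/-- A function from which pooling may start.  The conditions `gap` and `gap_zero` say that `G₀`
does not start to decrease inside a gap of `ν`, so that every first descent begins at a point where
`ν` has mass and the conditional means in the procedure are honest. -/
structure IsPoolStart (ν : Measure ℝ) (G₀ : ℝ → ℝ) : Prop where
  sub : MonotoneOn (fun y => y - G₀ y) (massRange ν)
  zero : G₀ 0 ≤ 0
  memLp : MemLp G₀ 2 ν
  gap : ∀ a b w, 0 ≤ a → a < b → b < w → b ∈ massRange ν → ν (Icc b w) = 0 →
    MonotoneOn G₀ (Ioo a b) → MonotoneOn G₀ (Ioo a w)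
  gap_zero : ∀ w, 0 < w → ν (Icc 0 w) = 0 → MonotoneOn G₀ (Ico 0 w)

/-- The properties that every pooling step preserves.  `tail` and `orth` are the optimality
conditions in the projection of `G₀` onto the non-decreasing functions: `G₀ - G` lies in the polar
cone and is orthogonal to all functions of `G`. -/
structure PoolInvariant (ν : Measure ℝ) (G₀ G : ℝ → ℝ) : Prop where
  sub : MonotoneOn (fun y => y - G y) (massRange ν)
  zero : G 0 ≤ 0
  memLp : MemLp G 2 ν
  tail : ∀ A : Set ℝ, IsUpperSet A → ∫ y in A, (G₀ y - G y) ∂ν ≤ 0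
  orth : ∀ ψ : ℝ → ℝ, Measurable ψ → (∃ C, ∀ x, |ψ x| ≤ C) →
    ∫ y, (G₀ y - G y) * ψ (G y) ∂ν = 0

theorem IsPoolStart.invariant {ν : Measure ℝ} {G₀ : ℝ → ℝ} (h : IsPoolStart ν G₀) :
    PoolInvariant ν G₀ G₀ where
  sub := h.sub
  zero := h.zero
  memLp := h.memLp
  tail A _ := by simp
  orth ψ _ _ := by simp

namespace PoolInvariant

variable {ν : Measure ℝ} {G₀ G : ℝ → ℝ}

theorem le_add_sub (h : PoolInvariant ν G₀ G) {x y : ℝ} (hx : x ∈ massRange ν)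
    (hy : y ∈ massRange ν) (hxy : x ≤ y) : G y ≤ G x + (y - x) := by
  have := h.sub hx hy hxy
  simp only at this
  linarith

theorem le_id [NeZero ν] (h : PoolInvariant ν G₀ G) (hν : ν (Iio 0) = 0) {y : ℝ}
    (hy : y ∈ massRange ν) : G y ≤ y := by
  linarith [h.le_add_sub (zero_mem_massRange hν) hy hy.1, h.zero]

theorem integrable [IsFiniteMeasure ν] (h : PoolInvariant ν G₀ G) : Integrable G ν :=
  h.memLp.integrable (by norm_num)

end PoolInvariant

/-! ### Pooling around a descent -/

/-- The function obtained from `G` by giving it the value `T` on `P`. -/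
noncomputable def flatten (G : ℝ → ℝ) (P : Set ℝ) (T : ℝ) : ℝ → ℝ :=
  open Classical in fun y => if y ∈ P then T else G y

/-- The pooled set at level `T` around a decreasing interval `M` that starts at `b` and is followed
by a non-decreasing interval `I`.  Both forms of the pooled interval in the procedure are instances:
`I` is empty if `M` extends to the end of the mass range. -/
def poolSet (G : ℝ → ℝ) (b : ℝ) (M I : Set ℝ) (T : ℝ) : Set ℝ :=
  {v ∈ Ico 0 b | T < G v} ∪ M ∪ {w ∈ I | G w < T}

/-- A place where a function `G` obtained from `G₀` can be pooled: `G` is non-decreasing on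
`[0, b)`, then non-increasing on the interval `M`, then non-decreasing on the interval `I` next to
`M`, and from `b` on `G` has not been changed yet. -/
structure IsDescent (ν : Measure ℝ) (G₀ G : ℝ → ℝ) (b : ℝ) (M I : Set ℝ) : Prop where
  null : ν (Iio 0) = 0
  inv : PoolInvariant ν G₀ G
  eqOn : ∀ y ∈ massRange ν, b ≤ y → G y = G₀ y
  left_mem : b ∈ M
  subset : M ⊆ massRange ν ∩ Ici b
  ordConnected : M.OrdConnected
  mono_left : MonotoneOn G (Ico 0 b)
  anti : AntitoneOn G M
  lt_right : ∀ m ∈ M, ∀ w ∈ I, m < w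
  right_initial : ∀ w ∈ I, ∀ y, b ≤ y → y ≤ w → y ∉ M → y ∈ I
  mono_right : MonotoneOn G I

/-- `T` is an admissible level for the pooling of a descent: the mean of `G` over the pooled set,
which is not too large for the function on the left of the pooled set and not too small for the
function on the right of it. -/
structure IsPoolLevel (ν : Measure ℝ) (G : ℝ → ℝ) (b : ℝ) (M I : Set ℝ) (T : ℝ) : Prop where
  le_of_forall_le : ∀ K, (∀ y ∈ Icc 0 b, G y ≤ K) → T ≤ K
  sub_le : ∀ m ∈ M, ∀ y ∈ massRange ν, m < y → y ∉ M → G y - (y - m) ≤ T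
  balance : ∫ y in poolSet G b M I T, (G y - T) ∂ν = 0

section Flatten

variable {G : ℝ → ℝ} {P : Set ℝ} {T : ℝ}

theorem flatten_of_mem {y : ℝ} (hy : y ∈ P) : flatten G P T y = T := if_pos hy

theorem flatten_of_notMem {y : ℝ} (hy : y ∉ P) : flatten G P T y = G y := if_neg hy

theorem flatten_eq_sub_indicator (y : ℝ) :
    flatten G P T y = G y - P.indicator (fun x => G x - T) y := by
  by_cases hy : y ∈ P
  · rw [flatten_of_mem hy, indicator_of_mem hy, sub_sub_cancel]
  · rw [flatten_of_notMem hy, indicator_of_notMem hy, sub_zero]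

theorem memLp_flatten {ν : Measure ℝ} [IsFiniteMeasure ν] (hG : MemLp G 2 ν)
    (hP : MeasurableSet P) : MemLp (flatten G P T) 2 ν := by
  rw [funext flatten_eq_sub_indicator]
  exact hG.sub ((hG.sub (memLp_const T)).indicator hP)

end Flatten

namespace IsDescent

variable {ν : Measure ℝ} {G₀ G : ℝ → ℝ} {b T : ℝ} {M I : Set ℝ}

theorem mem_massRange (h : IsDescent ν G₀ G b M I) : b ∈ massRange ν := (h.subset h.left_mem).1

theorem nonneg (h : IsDescent ν G₀ G b M I) : 0 ≤ b := h.mem_massRange.1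

theorem lt_of_notMem (h : IsDescent ν G₀ G b M I) {m y : ℝ} (hm : m ∈ M) (hby : b ≤ y)
    (hy : y ∉ M) : m < y :=
  not_le.1 fun hle => hy (h.ordConnected.out h.left_mem hm ⟨hby, hle⟩)

theorem flatten_left (h : IsDescent ν G₀ G b M I) {y : ℝ} (hy : y ∈ Ico 0 b) :
    flatten G (poolSet G b M I T) T y = min (G y) T := by
  rcases lt_or_ge T (G y) with hlt | hle
  · rw [flatten_of_mem (Or.inl (Or.inl ⟨hy, hlt⟩)), min_eq_right hlt.le]
  · rw [flatten_of_notMem, min_eq_left hle]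
    rintro ((hL | hM) | hR)
    · exact hle.not_gt hL.2
    · exact hy.2.not_ge (h.subset hM).2
    · exact (h.lt_right b h.left_mem y hR.1).not_gt hy.2

theorem flatten_middle {y : ℝ} (hy : y ∈ M) : flatten G (poolSet G b M I T) T y = T :=
  flatten_of_mem (Or.inl (Or.inr hy))

theorem mem_poolSet_iff_of_notMem {y : ℝ} (hby : b ≤ y) (hy : y ∉ M) :
    y ∈ poolSet G b M I T ↔ y ∈ I ∧ G y < T := by
  refine ⟨?_, Or.inr⟩
  rintro ((hL | hM) | hR)
  · exact absurd hby (not_le.2 hL.1.2)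
  · exact absurd hM hy
  · exact hR

theorem flatten_right (h : IsDescent ν G₀ G b M I) {y : ℝ} (hy : y ∈ I) :
    flatten G (poolSet G b M I T) T y = max (G y) T := by
  have hmem := mem_poolSet_iff_of_notMem (G := G) (I := I) (T := T)
    (h.lt_right b h.left_mem y hy).le fun hM => (h.lt_right y hM y hy).false
  rcases lt_or_ge (G y) T with hlt | hle
  · rw [flatten_of_mem (hmem.2 ⟨hy, hlt⟩), max_eq_right hlt.le]
  · rw [flatten_of_notMem fun hP => hle.not_gt (hmem.1 hP).2, max_eq_left hle]

theorem flatten_beyond {y : ℝ} (hby : b ≤ y) (hM : y ∉ M) (hI : y ∉ I) :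
    flatten G (poolSet G b M I T) T y = G y :=
  flatten_of_notMem fun hP => hI ((mem_poolSet_iff_of_notMem hby hM).1 hP).1

theorem measurableSet_left (h : IsDescent ν G₀ G b M I) :
    MeasurableSet {v ∈ Ico 0 b | T < G v} := by
  refine OrdConnected.measurableSet ⟨fun x hx y hy z hz => ?_⟩
  have hz' : z ∈ Ico 0 b := ⟨hx.1.1.trans hz.1, hz.2.trans_lt hy.1.2⟩
  exact ⟨hz', hx.2.trans_le (h.mono_left hx.1 hz' hz.1)⟩

theorem measurableSet_right (h : IsDescent ν G₀ G b M I) :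
    MeasurableSet {w ∈ I | G w < T} := by
  refine OrdConnected.measurableSet ⟨fun x hx y hy z hz => ?_⟩
  have hbz : b < z := (h.lt_right b h.left_mem x hx.1).trans_le hz.1
  have hzI : z ∈ I := h.right_initial y hy.1 z hbz.le hz.2 fun hM =>
    (h.lt_right z hM x hx.1).not_ge hz.1
  exact ⟨hzI, (h.mono_right hzI hy.1 hz.2).trans_lt hy.2⟩

theorem measurableSet_poolSet (h : IsDescent ν G₀ G b M I) :
    MeasurableSet (poolSet G b M I T) :=
  (h.measurableSet_left.union h.ordConnected.measurableSet).union h.measurableSet_right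

theorem setIntegral_poolSet (h : IsDescent ν G₀ G b M I) {f : ℝ → ℝ} (hf : Integrable f ν) :
    ∫ y in poolSet G b M I T, f y ∂ν = (∫ y in {v ∈ Ico 0 b | T < G v}, f y ∂ν) +
      (∫ y in M, f y ∂ν) + ∫ y in {w ∈ I | G w < T}, f y ∂ν := by
  rw [poolSet, setIntegral_union ?_ h.measurableSet_right hf.integrableOn hf.integrableOn,
    setIntegral_union ?_ h.ordConnected.measurableSet hf.integrableOn hf.integrableOn]
  · exact disjoint_left.2 fun x hx hx' => (h.subset hx').2.not_gt hx.1.2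
  · refine disjoint_left.2 fun x hx hx' => ?_
    rcases hx with hL | hM
    · exact (h.lt_right b h.left_mem x hx'.1).not_gt hL.1.2
    · exact (h.lt_right x hM x hx'.1).false

theorem le_of_mem_poolSet (h : IsDescent ν G₀ G b M I) {x y : ℝ} (hx : x ∈ poolSet G b M I T)
    (hy : y ∈ poolSet G b M I T) (hxy : x ≤ y) (hlt : T < G y) : T ≤ G x := by
  rcases hx with (hxL | hxM) | hxR
  · exact hxL.2.le
  · rcases hy with (hyL | hyM) | hyR
    · exact absurd hyL.1.2 (not_lt.2 ((h.subset hxM).2.out.trans hxy))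
    · exact hlt.le.trans (h.anti hxM hyM hxy)
    · exact absurd hyR.2 hlt.not_gt
  · rcases hy with (hyL | hyM) | hyR
    · exact absurd hyL.1.2 (not_lt.2 ((h.lt_right b h.left_mem x hxR.1).le.trans hxy))
    · exact absurd (h.lt_right y hyM x hxR.1) (not_lt.2 hxy)
    · exact absurd hyR.2 hlt.not_gt

theorem setIntegral_upper_le (h : IsDescent ν G₀ G b M I) [IsFiniteMeasure ν]
    (hT : IsPoolLevel ν G b M I T) {A : Set ℝ} (hA : IsUpperSet A) :
    ∫ y in A ∩ poolSet G b M I T, (G y - T) ∂ν ≤ 0 := by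
  refine setIntegral_inter_nonpos (h.inv.integrable.sub (integrable_const T))
    hA.ordConnected.measurableSet h.measurableSet_poolSet hT.balance ?_
  by_contra! hcon
  obtain ⟨⟨y, hy, hTy⟩, x, hx, hxT⟩ := hcon
  have hxy : x ≤ y := not_lt.1 fun hlt => hx.2 (hA hlt.le hy.1)
  linarith [h.le_of_mem_poolSet hx.1 hy.2 hxy (sub_pos.1 hTy)]

theorem le_add_of_isPoolLevel (h : IsDescent ν G₀ G b M I) (hT : IsPoolLevel ν G b M I T)
    {x : ℝ} (hx : x ∈ Ico 0 b) : T ≤ G x + (b - x) := by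
  refine hT.le_of_forall_le _ fun y hy => ?_
  rcases lt_or_ge y x with hyx | hxy
  · linarith [h.mono_left ⟨hy.1, hyx.trans hx.2⟩ hx hyx.le, hx.2]
  · linarith [h.inv.le_add_sub (massRange_of_le h.mem_massRange hx.1 hx.2.le)
      (massRange_of_le h.mem_massRange hy.1 hy.2) hxy, hy.2]

theorem sub_flatten_left_le (h : IsDescent ν G₀ G b M I) (hT : IsPoolLevel ν G b M I T)
    {x : ℝ} (hx : x ∈ Ico 0 b) : x - flatten G (poolSet G b M I T) T x ≤ b - T := by
  have hGx := h.le_add_of_isPoolLevel hT hx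
  rw [h.flatten_left hx]
  rcases min_choice (G x) T with e | e <;> rw [e] <;> linarith [hx.2]

theorem le_sub_flatten (h : IsDescent ν G₀ G b M I) (hT : IsPoolLevel ν G b M I T) {m y : ℝ}
    (hm : m ∈ M) (hy : y ∈ massRange ν) (hmy : m ≤ y) :
    m - T ≤ y - flatten G (poolSet G b M I T) T y := by
  have hby : b ≤ y := (h.subset hm).2.out.trans hmy
  by_cases hyM : y ∈ M
  · rw [flatten_middle hyM]; linarith
  have hlt := h.lt_of_notMem hm hby hyM
  have hGy := hT.sub_le m hm y hy hlt hyM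
  by_cases hyI : y ∈ I
  · rw [h.flatten_right hyI]
    rcases max_choice (G y) T with e | e <;> rw [e] <;> linarith
  · rw [flatten_beyond hby hyM hyI]; linarith

theorem sub_flatten_le_sub_flatten_of_notMem (h : IsDescent ν G₀ G b M I) {x y : ℝ}
    (hx : x ∈ massRange ν) (hy : y ∈ massRange ν) (hbx : b ≤ x) (hxM : x ∉ M) (hxy : x ≤ y) :
    x - flatten G (poolSet G b M I T) T x ≤ y - flatten G (poolSet G b M I T) T y := by
  have hsub := h.inv.le_add_sub hx hy hxy
  have hyM : y ∉ M := fun hM => (h.lt_of_notMem hM hbx hxM).not_ge hxy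
  by_cases hyI : y ∈ I
  · rw [h.flatten_right hyI, h.flatten_right (h.right_initial y hyI x hbx hxy hxM)]
    have hGx := le_max_left (G x) T
    have hTx := le_max_right (G x) T
    rcases max_choice (G y) T with e | e <;> rw [e] <;> linarith
  · rw [flatten_beyond (hbx.trans hxy) hyM hyI]
    by_cases hxI : x ∈ I
    · rw [h.flatten_right hxI]
      linarith [le_max_left (G x) T]
    · rw [flatten_beyond hbx hxM hxI]
      linarith

theorem monotoneOn_sub_flatten (h : IsDescent ν G₀ G b M I) (hT : IsPoolLevel ν G b M I T) :
    MonotoneOn (fun y => y - flatten G (poolSet G b M I T) T y) (massRange ν) := by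
  intro x hx y hy hxy
  simp only
  rcases lt_or_ge x b with hxb | hbx
  · rcases lt_or_ge y b with hyb | hby
    · rw [h.flatten_left ⟨hx.1, hxb⟩, h.flatten_left ⟨hy.1, hyb⟩]
      have hsub := h.inv.le_add_sub hx hy hxy
      have hGy := min_le_left (G y) T
      have hTy := min_le_right (G y) T
      rcases min_choice (G x) T with e | e <;> rw [e] <;> linarith
    · exact (h.sub_flatten_left_le hT ⟨hx.1, hxb⟩).trans (h.le_sub_flatten hT h.left_mem hy hby)
  · by_cases hxM : x ∈ M
    · rw [flatten_middle hxM]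
      exact h.le_sub_flatten hT hxM hy hxy
    · exact h.sub_flatten_le_sub_flatten_of_notMem hx hy hbx hxM hxy

theorem flatten_zero (h : IsDescent ν G₀ G b M I) (hT : IsPoolLevel ν G b M I T) :
    flatten G (poolSet G b M I T) T 0 ≤ 0 := by
  rcases h.nonneg.eq_or_lt with rfl | h0
  · rw [flatten_middle h.left_mem]
    refine hT.le_of_forall_le 0 fun y hy => ?_
    rw [le_antisymm hy.2 hy.1]
    exact h.inv.zero
  · rw [h.flatten_left ⟨le_rfl, h0⟩]
    exact (min_le_left _ _).trans h.inv.zero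

theorem monotoneOn_flatten (h : IsDescent ν G₀ G b M I) :
    MonotoneOn (flatten G (poolSet G b M I T) T) (Ico 0 b ∪ M ∪ I) := by
  have hleft : ∀ x ∈ Ico 0 b ∪ M, flatten G (poolSet G b M I T) T x ≤ T := by
    rintro x (hx | hx)
    · exact (h.flatten_left hx).trans_le (min_le_right _ _)
    · exact (flatten_middle hx).le
  have hright : ∀ y ∈ M ∪ I, T ≤ flatten G (poolSet G b M I T) T y := by
    rintro y (hy | hy)
    · exact (flatten_middle hy).ge
    · exact (le_max_right _ _).trans_eq (h.flatten_right hy).symm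
  intro x hx y hy hxy
  rcases hx with hx | hxI
  · rcases hy with (hyL | hyM) | hyI
    · have hxL : x ∈ Ico 0 b := ⟨hx.elim (·.1) fun hM => h.nonneg.trans (h.subset hM).2,
        hxy.trans_lt hyL.2⟩
      rw [h.flatten_left hxL, h.flatten_left hyL]
      exact min_le_min_right _ (h.mono_left hxL hyL hxy)
    · exact (hleft x hx).trans (hright y (Or.inl hyM))
    · exact (hleft x hx).trans (hright y (Or.inr hyI))
  · rcases hy with (hyL | hyM) | hyI
    · exact absurd (hxy.trans_lt hyL.2) (h.lt_right b h.left_mem x hxI).not_gt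
    · exact absurd (h.lt_right y hyM x hxI) hxy.not_gt
    · rw [h.flatten_right hxI, h.flatten_right hyI]
      exact max_le_max_right _ (h.mono_right hxI hyI hxy)

theorem setIntegral_sub_flatten_nonpos [IsFiniteMeasure ν] (h : IsDescent ν G₀ G b M I)
    (h₀ : Integrable G₀ ν) (hT : IsPoolLevel ν G b M I T) {A : Set ℝ} (hA : IsUpperSet A) :
    ∫ y in A, (G₀ y - flatten G (poolSet G b M I T) T y) ∂ν ≤ 0 := by
  have hP := h.measurableSet_poolSet (T := T)
  have hd : Integrable (fun y => G₀ y - G y) ν := h₀.sub h.inv.integrable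
  have hind : Integrable ((poolSet G b M I T).indicator fun y => G y - T) ν :=
    (h.inv.integrable.sub (integrable_const T)).indicator hP
  simp only [flatten_eq_sub_indicator, sub_sub_eq_add_sub, add_sub_right_comm]
  rw [integral_add hd.integrableOn hind.integrableOn]
  exact add_nonpos (h.inv.tail A hA)
    ((setIntegral_indicator hP).trans_le (h.setIntegral_upper_le hT hA))

/-- On the left of `b` pooling replaces `G` by `min G T`; on the right of `b` the factor `G₀ - G`
vanishes, so that the test function may be cut off at `T` there as well. -/
theorem sub_flatten_mul_eq (h : IsDescent ν G₀ G b M I) (ψ : ℝ → ℝ) {y : ℝ}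
    (hy : y ∈ massRange ν) :
    (G₀ y - flatten G (poolSet G b M I T) T y) * ψ (flatten G (poolSet G b M I T) T y) =
      (G₀ y - G y) * ψ (min (G y) T) +
        ψ T * (poolSet G b M I T).indicator (fun x => G x - T) y := by
  by_cases hP : y ∈ poolSet G b M I T
  · rw [flatten_of_mem hP, indicator_of_mem hP]
    rcases lt_or_ge y b with hyb | hby
    · rw [← h.flatten_left ⟨hy.1, hyb⟩, flatten_of_mem hP]
      ring
    · rw [h.eqOn y hy hby]
      ring
  · rw [flatten_of_notMem hP, indicator_of_notMem hP]
    rcases lt_or_ge y b with hyb | hby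
    · rw [← h.flatten_left ⟨hy.1, hyb⟩, flatten_of_notMem hP]
      ring
    · rw [h.eqOn y hy hby]
      ring

theorem integral_sub_flatten_mul_eq_zero [IsFiniteMeasure ν] (h : IsDescent ν G₀ G b M I)
    (h₀ : Integrable G₀ ν) (hT : IsPoolLevel ν G b M I T) {ψ : ℝ → ℝ} (hψ : Measurable ψ)
    (hC : ∃ C, ∀ x, |ψ x| ≤ C) :
    ∫ y, (G₀ y - flatten G (poolSet G b M I T) T y) *
      ψ (flatten G (poolSet G b M I T) T y) ∂ν = 0 := by
  obtain ⟨C, hC⟩ := hC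
  have hP := h.measurableSet_poolSet (T := T)
  have hψT : Measurable fun x => ψ (min x T) := hψ.comp (measurable_id.min measurable_const)
  have hcut : Integrable (fun y => (G₀ y - G y) * ψ (min (G y) T)) ν :=
    (h₀.sub h.inv.integrable).mul_bdd (c := C)
      (hψT.comp_aemeasurable h.inv.memLp.1.aemeasurable).aestronglyMeasurable
      (Eventually.of_forall fun y => hC _)
  have hind : Integrable ((poolSet G b M I T).indicator fun y => G y - T) ν :=
    (h.inv.integrable.sub (integrable_const T)).indicator hP
  rw [integral_congr_ae ((ae_mem_massRange h.null).mono fun y hy => h.sub_flatten_mul_eq ψ hy),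
    integral_add hcut (hind.const_mul _), integral_const_mul]
  have hbalance : ∫ y, (poolSet G b M I T).indicator (fun x => G x - T) y ∂ν = 0 :=
    (integral_indicator hP).trans hT.balance
  rw [h.inv.orth _ hψT ⟨C, fun x => hC _⟩]
  simpa using Or.inr hbalance

theorem poolInvariant_flatten [IsFiniteMeasure ν] (h : IsDescent ν G₀ G b M I)
    (h₀ : Integrable G₀ ν) (hT : IsPoolLevel ν G b M I T) :
    PoolInvariant ν G₀ (flatten G (poolSet G b M I T) T) where
  sub := h.monotoneOn_sub_flatten hT
  zero := h.flatten_zero hT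
  memLp := memLp_flatten h.inv.memLp h.measurableSet_poolSet
  tail _ hA := h.setIntegral_sub_flatten_nonpos h₀ hT hA
  orth _ hψ hC := h.integral_sub_flatten_mul_eq_zero h₀ hT hψ hC

end IsDescent

section InnerDescent

variable {ν : Measure ℝ} {G₀ G : ℝ → ℝ} {b₁ b₂ : ℝ}

theorem rightMNDI_subset_Ioi : rightMNDI ν G b₂ ⊆ Ioi b₂ := fun _ h => h.2.1

theorem mem_rightMNDI_of_le (hb : 0 ≤ b₂) {x y : ℝ} (hx : x ∈ rightMNDI ν G b₂) (hy : b₂ < y)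
    (hyx : y ≤ x) : y ∈ rightMNDI ν G b₂ := by
  obtain ⟨hxS, -, ε, hε, hm⟩ := hx
  exact ⟨massRange_of_le hxS (hb.trans hy.le) hyx, hy, ε, hε,
    hm.mono (inter_subset_inter_right _ (Ioo_subset_Ioo_right (by linarith)))⟩

theorem monotoneOn_rightMNDI : MonotoneOn G (rightMNDI ν G b₂) := by
  rintro x ⟨hxS, hbx, -⟩ y ⟨hyS, hby, ε, hε, hm⟩ hxy
  exact hm ⟨hxS, hbx, by linarith⟩ ⟨hyS, hby, by linarith⟩ hxy

theorem inter_Ioo_subset_rightMNDI {c : ℝ} (hm : MonotoneOn G (massRange ν ∩ Ioo b₂ c)) :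
    massRange ν ∩ Ioo b₂ c ⊆ rightMNDI ν G b₂ := fun y hy =>
  ⟨hy.1, hy.2.1, c - y, sub_pos.2 hy.2.2, by rwa [add_sub_cancel]⟩

namespace IsFirstMDI

theorem nonneg (h : IsFirstMDI ν G b₁ b₂) : 0 ≤ b₂ := h.mem.1.trans h.le

theorem right_mem (h : IsFirstMDI ν G b₁ b₂) : b₂ ∈ massRange ν :=
  ⟨h.nonneg, h.mass_right.trans_le (measure_mono Ioi_subset_Ici_self)⟩

theorem rightMNDI_nonempty (h : IsFirstMDI ν G b₁ b₂) (hν : ν (Iio 0) = 0) :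
    (rightMNDI ν G b₂).Nonempty := by
  obtain ⟨ε, hε, hm⟩ := h.mono_right
  obtain ⟨y, hy, hby⟩ := exists_mem_massRange_gt hν h.mass_right
  have hlt : b₂ < min y (b₂ + ε / 2) := lt_min hby (by linarith)
  refine ⟨min y (b₂ + ε / 2), inter_Ioo_subset_rightMNDI hm ⟨?_, hlt, ?_⟩⟩
  · exact massRange_of_le hy (h.nonneg.trans hlt.le) (min_le_left _ _)
  · exact (min_le_right _ _).trans_lt (by linarith)

theorem isDescent (h : IsFirstMDI ν G b₁ b₂) (hν : ν (Iio 0) = 0) (hinv : PoolInvariant ν G₀ G)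
    (heq : ∀ y ∈ massRange ν, b₁ ≤ y → G y = G₀ y) :
    IsDescent ν G₀ G b₁ (Icc b₁ b₂) (rightMNDI ν G b₂) where
  null := hν
  inv := hinv
  eqOn := heq
  left_mem := ⟨le_rfl, h.le⟩
  subset _ hy := ⟨massRange_of_le h.right_mem (h.mem.1.trans hy.1) hy.2, hy.1⟩
  ordConnected := ordConnected_Icc
  mono_left := h.mono_left
  anti := h.anti.antitoneOn
  lt_right _ hm _ hw := hm.2.trans_lt (rightMNDI_subset_Ioi hw)
  right_initial _ hw _ hby hyw hyM :=
    mem_rightMNDI_of_le h.nonneg hw (not_le.1 fun hyb => hyM ⟨hby, hyb⟩) hyw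
  mono_right := monotoneOn_rightMNDI

theorem setIntegral_Icc (h : IsFirstMDI ν G b₁ b₂) {f : ℝ → ℝ} (hf : Integrable f ν) {v w : ℝ}
    (hv : v ≤ b₁) (hw : b₂ < w) :
    ∫ y in Icc v w, f y ∂ν =
      (∫ y in Ico v b₁, f y ∂ν) + (∫ y in Icc b₁ b₂, f y ∂ν) + ∫ y in Ioc b₂ w, f y ∂ν := by
  rw [← Icc_union_Ioc_eq_Icc (hv.trans h.le) hw.le, setIntegral_union
    (disjoint_left.2 fun x hx hx' => hx.2.not_gt hx'.1) measurableSet_Ioc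
    hf.integrableOn hf.integrableOn, ← Ico_union_Icc_eq_Icc hv h.le, setIntegral_union
    (disjoint_left.2 fun x hx hx' => hx'.1.not_gt hx.2) measurableSet_Icc
    hf.integrableOn hf.integrableOn]

variable [IsProbabilityMeasure ν]

theorem sub_le_condMean (h : IsFirstMDI ν G b₁ b₂) (hinv : PoolInvariant ν G₀ G) {z w : ℝ}
    (hz : z ∈ rightMNDI ν G b₂) (hw : w ∈ rightMNDI ν G b₂) (hpos : 0 < ν (Icc b₁ w)) :
    G z - (z - b₂) ≤ condMean ν G b₁ w := by
  refine le_setAverage hinv.integrable hpos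
    (ae_restrict_of_forall_mem measurableSet_Icc fun y hy => ?_)
  have hbz := rightMNDI_subset_Ioi hz
  rcases le_or_gt y b₂ with hyb | hby
  · have hGy := h.anti.antitoneOn ⟨hy.1, hyb⟩ ⟨h.le, le_rfl⟩ hyb
    linarith [hinv.le_add_sub h.right_mem hz.1 hbz.out.le]
  · have hyI := mem_rightMNDI_of_le h.nonneg hw hby hy.2
    rcases le_or_gt y z with hyz | hzy
    · linarith [hinv.le_add_sub hyI.1 hz.1 hyz]
    · linarith [monotoneOn_rightMNDI hz hyI hzy.le, hbz.out]

theorem isLUB_condMean (h : IsFirstMDI ν G b₁ b₂) (hν : ν (Iio 0) = 0)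
    (hinv : PoolInvariant ν G₀ G) {w : ℝ} (hw : w ∈ massRange ν) (hpos : 0 < ν (Icc b₁ w)) :
    IsLUB (range fun v : Icc (0 : ℝ) b₁ => condMean ν G v w)
      (⨆ v : Icc (0 : ℝ) b₁, condMean ν G v w) := by
  have : Nonempty (Icc (0 : ℝ) b₁) := ⟨⟨0, le_rfl, h.mem.1⟩⟩
  refine isLUB_ciSup ⟨w, forall_mem_range.2 fun v => ?_⟩
  refine setAverage_le hinv.integrable (hpos.trans_le (measure_mono (Icc_subset_Icc_left v.2.2)))
    (ae_restrict_of_forall_mem measurableSet_Icc fun y hy => ?_)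
  exact (hinv.le_id hν (massRange_of_le hw (v.2.1.trans hy.1) hy.2)).trans hy.2

theorem isGLB_minMaxValue (h : IsFirstMDI ν G b₁ b₂) (hν : ν (Iio 0) = 0)
    (hinv : PoolInvariant ν G₀ G) (hpos : ∀ w, b₁ < w → 0 < ν (Icc b₁ w)) :
    IsGLB (range fun w : rightMNDI ν G b₂ => ⨆ v : Icc (0 : ℝ) b₁, condMean ν G v w)
      (minMaxValue ν G b₁ b₂) := by
  obtain ⟨z, hz⟩ := h.rightMNDI_nonempty hν
  have : Nonempty (rightMNDI ν G b₂) := ⟨⟨z, hz⟩⟩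
  refine isGLB_ciInf ⟨G z - (z - b₂), forall_mem_range.2 fun w => ?_⟩
  have hw := hpos w (h.le.trans_lt w.2.2.1)
  exact (h.sub_le_condMean hinv hz w.2 hw).trans
    ((h.isLUB_condMean hν hinv w.2.1 hw).1 ⟨⟨b₁, h.mem.1, le_rfl⟩, rfl⟩)

theorem sub_le_minMaxValue (h : IsFirstMDI ν G b₁ b₂) (hν : ν (Iio 0) = 0)
    (hinv : PoolInvariant ν G₀ G) (hpos : ∀ w, b₁ < w → 0 < ν (Icc b₁ w)) {y : ℝ}
    (hy : y ∈ massRange ν) (hby : b₂ < y) : G y - (y - b₂) ≤ minMaxValue ν G b₁ b₂ := by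
  have hmin : ∃ z ∈ rightMNDI ν G b₂, z ≤ y := by
    obtain ⟨z, hz⟩ := h.rightMNDI_nonempty hν
    rcases le_total z y with hzy | hyz
    · exact ⟨z, hz, hzy⟩
    · exact ⟨y, mem_rightMNDI_of_le h.nonneg hz hby hyz, le_rfl⟩
  obtain ⟨z, hz, hzy⟩ := hmin
  refine (h.isGLB_minMaxValue hν hinv hpos).2 (forall_mem_range.2 fun w => ?_)
  have hw := hpos w (h.le.trans_lt w.2.2.1)
  have hcond := (h.isLUB_condMean hν hinv w.2.1 hw).1 ⟨⟨b₁, h.mem.1, le_rfl⟩, rfl⟩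
  linarith [h.sub_le_condMean hinv hz w.2 hw, hinv.le_add_sub hz.1 hy hzy]

theorem minMaxValue_le (h : IsFirstMDI ν G b₁ b₂) (hν : ν (Iio 0) = 0)
    (hinv : PoolInvariant ν G₀ G) (hpos : ∀ w, b₁ < w → 0 < ν (Icc b₁ w)) {K : ℝ}
    (hK : ∀ x ∈ Icc 0 b₁, G x ≤ K) : minMaxValue ν G b₁ b₂ ≤ K := by
  refine le_of_forall_pos_le_add fun ε hε => ?_
  obtain ⟨z, hz⟩ := h.rightMNDI_nonempty hν
  set w := min z (b₂ + ε)
  have hbw : b₂ < w := lt_min (rightMNDI_subset_Ioi hz) (by linarith)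
  have hw : w ∈ rightMNDI ν G b₂ := mem_rightMNDI_of_le h.nonneg hz hbw (min_le_left _ _)
  have hposw := hpos w (h.le.trans_lt hbw)
  refine ((h.isGLB_minMaxValue hν hinv hpos).1 ⟨⟨w, hw⟩, rfl⟩).trans
    ((h.isLUB_condMean hν hinv hw.1 hposw).2 (forall_mem_range.2 fun v => ?_))
  refine setAverage_le hinv.integrable
    (hposw.trans_le (measure_mono (Icc_subset_Icc_left v.2.2)))
    (ae_restrict_of_forall_mem measurableSet_Icc fun y hy => ?_)
  have hKb₁ := hK b₁ ⟨h.mem.1, le_rfl⟩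
  rcases le_or_gt y b₁ with hyb | hby
  · linarith [hK y ⟨v.2.1.trans hy.1, hyb⟩]
  rcases le_or_gt y b₂ with hyb | hby'
  · linarith [h.anti.antitoneOn ⟨le_rfl, h.le⟩ ⟨hby.le, hyb⟩ hby.le]
  · have hyS := massRange_of_le hw.1 (h.nonneg.trans hby'.le) hy.2
    linarith [hinv.le_add_sub h.right_mem hyS hby'.le, hy.2.trans (min_le_right _ _),
      h.anti.antitoneOn ⟨le_rfl, h.le⟩ ⟨h.le, le_rfl⟩ h.le]

theorem isPoolLevel (h : IsFirstMDI ν G b₁ b₂) (hd : IsDescent ν G₀ G b₁ (Icc b₁ b₂)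
    (rightMNDI ν G b₂)) (hpos : ∀ w, b₁ < w → 0 < ν (Icc b₁ w)) :
    IsPoolLevel ν G b₁ (Icc b₁ b₂) (rightMNDI ν G b₂) (minMaxValue ν G b₁ b₂) where
  le_of_forall_le K hK := h.minMaxValue_le hd.null hd.inv hpos hK
  sub_le m hm y hy hmy hyM := by
    have hby : b₂ < y := not_le.1 fun hyb => hyM ⟨hm.1.trans hmy.le, hyb⟩
    linarith [h.sub_le_minMaxValue hd.null hd.inv hpos hy hby, hm.2]
  balance := by
    have hGi := hd.inv.integrable
    set T := minMaxValue ν G b₁ b₂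
    have hf : Integrable (fun y => G y - T) ν := hGi.sub (integrable_const _)
    have hleft := isLUB_setIntegral_Ico hf hd.nonneg fun x hx y hy hxy =>
      sub_le_sub_right (h.mono_left hx hy hxy) T
    have hright := isGLB_setIntegral_Ioc hf rightMNDI_subset_Ioi
      (fun x hx y hby hyx => mem_rightMNDI_of_le h.nonneg hx hby hyx)
      (h.rightMNDI_nonempty hd.null) fun x hx y hy hxy =>
      sub_le_sub_right (monotoneOn_rightMNDI hx hy hxy) T
    have hpos' : ∀ w ∈ rightMNDI ν G b₂, 0 < ν (Icc b₁ w) := fun w hw =>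
      hpos w (h.le.trans_lt hw.2.1)
    rw [hd.setIntegral_poolSet hf]
    simp only [sub_pos, sub_neg] at hleft hright
    refine add_eq_zero_of_minimax (V := Icc (0 : ℝ) b₁) (W := rightMNDI ν G b₂)
      (K := fun v w => condMean ν G v w) (P := fun v w => ν.real (Icc v w)) (fun v w => ?_)
      (fun _ _ => measureReal_nonneg) (fun _ _ => measureReal_le_one) hleft hright
      (fun w => h.isLUB_condMean hd.null hd.inv w.2.1 (hpos' w w.2))
      (h.isGLB_minMaxValue hd.null hd.inv hpos)
    exact (setAverage_sub_mul hGi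
      ((hpos' w w.2).trans_le (measure_mono (Icc_subset_Icc_left v.2.2))) T).trans
      (h.setIntegral_Icc hf v.2.2 w.2.2.1)

end IsFirstMDI

end InnerDescent

namespace IsFirstMDIToEnd

variable {ν : Measure ℝ} {G₀ G : ℝ → ℝ} {b : ℝ}

theorem isDescent (h : IsFirstMDIToEnd ν G b) (hν : ν (Iio 0) = 0) (hinv : PoolInvariant ν G₀ G)
    (heq : ∀ y ∈ massRange ν, b ≤ y → G y = G₀ y) :
    IsDescent ν G₀ G b (massRange ν ∩ Ici b) ∅ where
  null := hν
  inv := hinv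
  eqOn := heq
  left_mem := ⟨h.mem, self_mem_Ici⟩
  subset := Subset.rfl
  ordConnected := ordConnected_massRange.inter ordConnected_Ici
  mono_left := h.mono_left
  anti := h.anti.antitoneOn
  lt_right _ _ _ hw := hw.elim
  right_initial _ hw := hw.elim
  mono_right _ hx := hx.elim

theorem condMeanToEnd_le [IsFiniteMeasure ν] (h : IsFirstMDIToEnd ν G b) (hν : ν (Iio 0) = 0)
    (hG : Integrable G ν) {v K : ℝ} (hv : v ≤ b) (hK : ∀ y ∈ Icc 0 b, G y ≤ K) :
    condMeanToEnd ν G v ≤ K := by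
  refine setAverage_le hG (h.mem.2.trans_le (measure_mono (Ici_subset_Ici.2 hv)))
    (ae_restrict_of_ae ((ae_mem_massRange hν).mono fun y hy => ?_))
  rcases le_or_gt y b with hyb | hby
  · exact hK y ⟨hy.1, hyb⟩
  · exact (h.anti.antitoneOn ⟨h.mem, self_mem_Ici⟩ ⟨hy, hby.le⟩ hby.le).trans
      (hK b ⟨h.mem.1, le_rfl⟩)

theorem isLUB_maxValueToEnd [IsProbabilityMeasure ν] (h : IsFirstMDIToEnd ν G b)
    (hν : ν (Iio 0) = 0) (hinv : PoolInvariant ν G₀ G) :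
    IsLUB (range fun v : Icc (0 : ℝ) b => condMeanToEnd ν G v) (maxValueToEnd ν G b) := by
  have : Nonempty (Icc (0 : ℝ) b) := ⟨⟨0, le_rfl, h.mem.1⟩⟩
  refine isLUB_ciSup ⟨b, forall_mem_range.2 fun v => ?_⟩
  exact h.condMeanToEnd_le hν hinv.integrable v.2.2 fun y hy =>
    (hinv.le_id hν (massRange_of_le h.mem hy.1 hy.2)).trans hy.2

theorem setIntegral_Ici (hν : ν (Iio 0) = 0) {f : ℝ → ℝ} (hf : Integrable f ν) {v : ℝ}
    (hv : v ≤ b) :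
    ∫ y in Ici v, f y ∂ν = (∫ y in Ico v b, f y ∂ν) + ∫ y in massRange ν ∩ Ici b, f y ∂ν := by
  have htail : (massRange ν ∩ Ici b : Set ℝ) =ᵐ[ν] Ici b := by
    filter_upwards [ae_mem_massRange hν] with y hy
    exact propext ⟨And.right, And.intro hy⟩
  rw [setIntegral_congr_set htail, ← Ico_union_Ici_eq_Ici hv, setIntegral_union
    (disjoint_left.2 fun x hx hx' => hx'.out.not_gt hx.2) measurableSet_Ici
    hf.integrableOn hf.integrableOn]

theorem isPoolLevel [IsProbabilityMeasure ν] (h : IsFirstMDIToEnd ν G b)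
    (hd : IsDescent ν G₀ G b (massRange ν ∩ Ici b) ∅) :
    IsPoolLevel ν G b (massRange ν ∩ Ici b) ∅ (maxValueToEnd ν G b) where
  le_of_forall_le K hK := (h.isLUB_maxValueToEnd hd.null hd.inv).2
    (forall_mem_range.2 fun v => h.condMeanToEnd_le hd.null hd.inv.integrable v.2.2 hK)
  sub_le _ hm y hy hmy hyM := absurd ⟨hy, hm.2.out.trans hmy.le⟩ hyM
  balance := by
    set T := maxValueToEnd ν G b
    have hf : Integrable (fun y => G y - T) ν := hd.inv.integrable.sub (integrable_const _)
    have hleft := isLUB_setIntegral_Ico hf hd.nonneg fun x hx y hy hxy =>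
      sub_le_sub_right (h.mono_left hx hy hxy) T
    rw [hd.setIntegral_poolSet hf, sep_empty, setIntegral_empty]
    simp only [sub_pos] at hleft
    refine add_eq_zero_of_minimax (V := Icc (0 : ℝ) b) (W := Unit) (B := fun _ => 0)
      (S := fun _ => T) (b := 0) (T := T) (K := fun v _ => condMeanToEnd ν G v)
      (P := fun v _ => ν.real (Ici v)) (fun v _ => ?_) (fun _ _ => measureReal_nonneg)
      (fun _ _ => measureReal_le_one) hleft (by simp)
      (fun _ => h.isLUB_maxValueToEnd hd.null hd.inv) (by simp)
    rw [add_zero, ← setIntegral_Ici hd.null hf v.2.2]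
    exact setAverage_sub_mul hd.inv.integrable
      (h.mem.2.trans_le (measure_mono (Ici_subset_Ici.2 v.2.2))) T

end IsFirstMDIToEnd

/-! ### Progress of the pooling procedure -/

section Monotone

variable {α β : Type*} [LinearOrder α] [Preorder β] {f : α → β} {s : Set α}

theorem subsingleton_of_monotoneOn_of_strictAntiOn (hm : MonotoneOn f s) (ha : StrictAntiOn f s) :
    s.Subsingleton := fun _ hx _ hy =>
  le_antisymm (not_lt.1 fun hlt => (ha hy hx hlt).not_ge (hm hy hx hlt.le))
    (not_lt.1 fun hlt => (ha hx hy hlt).not_ge (hm hx hy hlt.le))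

theorem monotoneOn_inter_Iio_of_overlap [DenselyOrdered α] (hs : s.OrdConnected) {a b w : α}
    (hb : b ∈ s) (hab : a < b) (hleft : MonotoneOn f (s ∩ Iio b))
    (hright : MonotoneOn f (s ∩ Ioo a w)) : MonotoneOn f (s ∩ Iio w) := by
  intro x hx y hy hxy
  rcases lt_or_ge y b with hyb | hby
  · exact hleft ⟨hx.1, hxy.trans_lt hyb⟩ ⟨hy.1, hyb⟩ hxy
  rcases lt_or_ge a x with hax | hxa
  · exact hright ⟨hx.1, hax, hx.2⟩ ⟨hy.1, hax.trans_le hxy, hy.2⟩ hxy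
  obtain ⟨m, ham, hmb⟩ := exists_between hab
  have hm : m ∈ s := hs.out hx.1 hb ⟨hxa.trans ham.le, hmb.le⟩
  exact (hleft ⟨hx.1, (hxa.trans_lt ham).trans hmb⟩ ⟨hm, hmb⟩ (hxa.trans ham.le)).trans
    (hright ⟨hm, ham, (hmb.trans_le hby).trans hy.2⟩ ⟨hy.1, hab.trans_le hby, hy.2⟩
      (hmb.le.trans hby))

end Monotone

/-- `G` is non-decreasing before `c` and untouched by pooling from `c` on.  By `start`, `c` is `0`
or a point where `G₀` ceases to be non-decreasing; if `G₀` has finitely many MDIs there are only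
finitely many such points, so that the procedure terminates. -/
structure PoolFrontier (ν : Measure ℝ) (G₀ G : ℝ → ℝ) (c : ℝ) : Prop where
  mem : c ∈ massRange ν
  mono : MonotoneOn G (Ico 0 c)
  eqOn : ∀ y ∈ massRange ν, c ≤ y → G y = G₀ y
  start : c = 0 ∨ ∃ a, 0 ≤ a ∧ a < c ∧ MonotoneOn G₀ (Ioo a c) ∧
    ∀ w, c < w → ¬ MonotoneOn G₀ (massRange ν ∩ Ioo a w)

theorem poolFrontier_zero {ν : Measure ℝ} [NeZero ν] (hν : ν (Iio 0) = 0) {G₀ : ℝ → ℝ} :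
    PoolFrontier ν G₀ G₀ 0 where
  mem := zero_mem_massRange hν
  mono := by simp [MonotoneOn]
  eqOn _ _ _ := rfl
  start := Or.inl rfl

namespace PoolFrontier

variable {ν : Measure ℝ} {G₀ G : ℝ → ℝ} {b c : ℝ}

theorem le_of_descent (hc : PoolFrontier ν G₀ G c) (hb : StartsFirstDescent ν G b) : c ≤ b := by
  by_contra! hlt
  refine hb.descent (c - b) (by linarith) fun x hx y hy hxy => ?_
  exact hc.mono ⟨hx.1.1, by linarith [hx.2.2]⟩ ⟨hy.1.1, by linarith [hy.2.2]⟩ hxy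

theorem monotoneOn_congr (hc : PoolFrontier ν G₀ G c) {s : Set ℝ} (hs : s ⊆ massRange ν ∩ Ici c) :
    MonotoneOn G s ↔ MonotoneOn G₀ s := by
  have heq : EqOn G G₀ s := fun y hy => hc.eqOn y (hs hy).1 (hs hy).2
  exact ⟨fun h => h.congr heq, fun h => h.congr heq.symm⟩

theorem measure_Icc_pos (hc : PoolFrontier ν G₀ G c) (h₀ : IsPoolStart ν G₀)
    (hb : StartsFirstDescent ν G b) {w : ℝ} (hw : b < w) : 0 < ν (Icc b w) := by
  refine pos_iff_ne_zero.2 fun hnull => ?_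
  have hc0 : 0 ≤ c := hc.mem.1
  rcases (hc.le_of_descent hb).lt_or_eq with hlt | rfl
  · have hleft : MonotoneOn G₀ (Ioo c b) := (hc.monotoneOn_congr fun y hy =>
      ⟨massRange_of_le hb.mem (hc0.trans hy.1.le) hy.2.le, hy.1.le⟩).1
      (hb.mono_left.mono fun y hy => ⟨hc0.trans hy.1.le, hy.2⟩)
    have hnear : massRange ν ∩ Ioo (b - min (b - c) (w - b)) (b + min (b - c) (w - b)) ⊆
        massRange ν ∩ Ioo c w := inter_subset_inter_right _
      (Ioo_subset_Ioo (by linarith [min_le_left (b - c) (w - b)])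
        (by linarith [min_le_right (b - c) (w - b)]))
    refine hb.descent (min (b - c) (w - b)) (lt_min (by linarith) (by linarith))
      (MonotoneOn.mono ?_ hnear)
    exact (hc.monotoneOn_congr (inter_subset_inter_right _ fun y hy => hy.1.le)).2
      ((h₀.gap c b w hc0 hlt hw hb.mem hnull hleft).mono inter_subset_right)
  · rcases hc.start with rfl | ⟨a, ha0, hac, hm, hn⟩
    · refine hb.descent w hw ((hc.monotoneOn_congr fun y hy => ⟨hy.1, hy.1.1⟩).2 ?_)
      exact (h₀.gap_zero w hw hnull).mono fun y hy => ⟨hy.1.1, by linarith [hy.2.2]⟩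
    · exact hn w hw ((h₀.gap a c w ha0 hac hw hc.mem hnull hm).mono inter_subset_right)

end PoolFrontier

namespace IsFirstMDI

variable {ν : Measure ℝ} {G₀ G : ℝ → ℝ} {b₁ b₂ T : ℝ}

theorem rightMNDI_eq_Ioo (h : IsFirstMDI ν G b₁ b₂) (hν : ν (Iio 0) = 0) :
    massRange ν ∩ Ioi b₂ ⊆ rightMNDI ν G b₂ ∨
      ∃ c ∈ massRange ν, b₂ < c ∧ c ∉ rightMNDI ν G b₂ ∧ rightMNDI ν G b₂ = Ioo b₂ c := by
  refine or_iff_not_imp_left.2 fun hsub => ?_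
  obtain ⟨y, ⟨hyS, hby⟩, hyI⟩ := not_subset.1 hsub
  obtain ⟨z, hz⟩ := h.rightMNDI_nonempty hν
  have hub : y ∈ upperBounds (rightMNDI ν G b₂) := fun x hx =>
    not_lt.1 fun hlt => hyI (mem_rightMNDI_of_le h.nonneg hx hby hlt.le)
  have hlub := isLUB_csSup ⟨z, hz⟩ ⟨y, hub⟩
  set c := sSup (rightMNDI ν G b₂)
  have hbc : b₂ < c := hz.2.1.trans_le (hlub.1 hz)
  have hcy : c ≤ y := hlub.2 hub
  have hcI : c ∉ rightMNDI ν G b₂ := fun hc => by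
    have hcy' : c < y := hcy.lt_of_ne fun he => hyI (he ▸ hc)
    obtain ⟨-, -, ε, hε, hm⟩ := hc
    obtain ⟨x, hcx, hxy⟩ := exists_between (lt_min hcy' (lt_add_of_pos_right c hε))
    have hxS := massRange_of_le hyS (h.nonneg.trans (hbc.trans hcx).le)
      (hxy.trans_le (min_le_left _ _)).le
    exact hcx.not_ge (hlub.1 (inter_Ioo_subset_rightMNDI hm
      ⟨hxS, hbc.trans hcx, hxy.trans_le (min_le_right _ _)⟩))
  refine ⟨c, massRange_of_le hyS (h.nonneg.trans hbc.le) hcy, hbc, hcI, ?_⟩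
  ext x
  refine ⟨fun hx => ⟨hx.2.1, (hlub.1 hx).lt_of_ne fun he => hcI (he ▸ hx)⟩, fun hx => ?_⟩
  obtain ⟨x', hx', hxx'⟩ := (lt_isLUB_iff hlub).1 hx.2
  exact mem_rightMNDI_of_le h.nonneg hx' hx.1 hxx'.le

theorem poolFrontier_flatten (h : IsFirstMDI ν G b₁ b₂)
    (hd : IsDescent ν G₀ G b₁ (Icc b₁ b₂) (rightMNDI ν G b₂)) {c : ℝ} (hc : c ∈ massRange ν)
    (hbc : b₂ < c) (hcI : c ∉ rightMNDI ν G b₂) (hI : rightMNDI ν G b₂ = Ioo b₂ c) :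
    PoolFrontier ν G₀ (flatten G (poolSet G b₁ (Icc b₁ b₂) (rightMNDI ν G b₂) T) T) c where
  mem := hc
  mono := hd.monotoneOn_flatten.mono fun y hy => by
    rcases lt_or_ge y b₁ with hyb₁ | hby₁
    · exact Or.inl (Or.inl ⟨hy.1, hyb₁⟩)
    rcases le_or_gt y b₂ with hyb₂ | hby₂
    · exact Or.inl (Or.inr ⟨hby₁, hyb₂⟩)
    · exact Or.inr (hI ▸ ⟨hby₂, hy.2⟩)
  eqOn y hy hcy := by
    have hby : b₁ ≤ y := h.le.trans (hbc.le.trans hcy)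
    rw [IsDescent.flatten_beyond hby (fun hM => hM.2.not_gt (hbc.trans_le hcy))
      (fun hyI => hcI (mem_rightMNDI_of_le h.nonneg hyI hbc hcy)), hd.eqOn y hy hby]
  start := by
    refine Or.inr ⟨b₂, h.nonneg, hbc, ?_, fun w hw hm => hcI ⟨hc, hbc, w - c, by linarith, ?_⟩⟩
    · rw [← hI]
      exact monotoneOn_rightMNDI.congr fun y hy => hd.eqOn y hy.1 (h.le.trans hy.2.1.le)
    · rw [add_sub_cancel]
      exact hm.congr fun y hy => (hd.eqOn y hy.1 (h.le.trans hy.2.1.le)).symm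

theorem monotoneOn_or_poolFrontier_flatten (h : IsFirstMDI ν G b₁ b₂)
    (hd : IsDescent ν G₀ G b₁ (Icc b₁ b₂) (rightMNDI ν G b₂)) :
    MonotoneOn (flatten G (poolSet G b₁ (Icc b₁ b₂) (rightMNDI ν G b₂) T) T) (massRange ν) ∨
      ∃ c, b₂ < c ∧
        PoolFrontier ν G₀ (flatten G (poolSet G b₁ (Icc b₁ b₂) (rightMNDI ν G b₂) T) T) c := by
  refine (h.rightMNDI_eq_Ioo hd.null).imp (fun hsub => hd.monotoneOn_flatten.mono fun y hy => ?_)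
    fun ⟨c, hc, hbc, hcI, hI⟩ => ⟨c, hbc, h.poolFrontier_flatten hd hc hbc hcI hI⟩
  rcases lt_or_ge y b₁ with hyb₁ | hby₁
  · exact Or.inl (Or.inl ⟨hy.1, hyb₁⟩)
  rcases le_or_gt y b₂ with hyb₂ | hby₂
  · exact Or.inl (Or.inr ⟨hby₁, hyb₂⟩)
  · exact Or.inr (hsub ⟨hy, hby₂⟩)

end IsFirstMDI

namespace IsFirstMDIToEnd

variable {ν : Measure ℝ} {G₀ G : ℝ → ℝ} {b T : ℝ}

theorem monotoneOn_flatten (hd : IsDescent ν G₀ G b (massRange ν ∩ Ici b) ∅) :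
    MonotoneOn (flatten G (poolSet G b (massRange ν ∩ Ici b) ∅ T) T) (massRange ν) :=
  hd.monotoneOn_flatten.mono fun y hy => Or.inl <|
    (lt_or_ge y b).imp (fun hyb => ⟨hy.1, hyb⟩) fun hby => ⟨hy, hby⟩

theorem pooledIntervalToEnd_eq_poolSet :
    pooledIntervalToEnd ν G b T = poolSet G b (massRange ν ∩ Ici b) ∅ T := by
  rw [pooledIntervalToEnd, poolSet, sep_empty, union_empty]

end IsFirstMDIToEnd

section Invariant

variable {ν : Measure ℝ} {G₀ G G' : ℝ → ℝ}

theorem StartsFirstDescent.not_monotoneOn {b : ℝ} (h : StartsFirstDescent ν G b) :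
    ¬ MonotoneOn G (massRange ν) :=
  fun hm => h.descent 1 one_pos (hm.mono inter_subset_left)

theorem PoolStep.not_monotoneOn (h : PoolStep ν G G') : ¬ MonotoneOn G (massRange ν) := by
  cases h with
  | inner _ _ h => exact h.not_monotoneOn
  | toEnd _ h => exact h.not_monotoneOn

variable [IsProbabilityMeasure ν]

theorem PoolStep.progress (hs : PoolStep ν G G') (hν : ν (Iio 0) = 0) (h₀ : IsPoolStart ν G₀)
    (hinv : PoolInvariant ν G₀ G) {c : ℝ} (hc : PoolFrontier ν G₀ G c) :
    PoolInvariant ν G₀ G' ∧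
      (MonotoneOn G' (massRange ν) ∨ ∃ c', c < c' ∧ PoolFrontier ν G₀ G' c') := by
  have hG₀ := h₀.invariant.integrable
  cases hs with
  | inner b₁ b₂ hb =>
    have hcb := hc.le_of_descent hb.toStartsFirstDescent
    have hd := hb.isDescent hν hinv fun y hy hby => hc.eqOn y hy (hcb.trans hby)
    have hT := hb.isPoolLevel hd fun w hw => hc.measure_Icc_pos h₀ hb.toStartsFirstDescent hw
    exact ⟨hd.poolInvariant_flatten hG₀ hT, (hb.monotoneOn_or_poolFrontier_flatten hd).imp_right
      fun ⟨c', hc', hf⟩ => ⟨c', (hcb.trans hb.le).trans_lt hc', hf⟩⟩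
  | toEnd b hb =>
    have hcb := hc.le_of_descent hb.toStartsFirstDescent
    have hd := hb.isDescent hν hinv fun y hy hby => hc.eqOn y hy (hcb.trans hby)
    set T := maxValueToEnd ν G b
    change PoolInvariant ν G₀ (flatten G (pooledIntervalToEnd ν G b T) T) ∧
      (MonotoneOn (flatten G (pooledIntervalToEnd ν G b T) T) _ ∨ _)
    rw [IsFirstMDIToEnd.pooledIntervalToEnd_eq_poolSet]
    exact ⟨hd.poolInvariant_flatten hG₀ (hb.isPoolLevel hd),
      Or.inl (IsFirstMDIToEnd.monotoneOn_flatten hd)⟩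

theorem poolInvariant_of_reflTransGen (hν : ν (Iio 0) = 0) (h₀ : IsPoolStart ν G₀)
    (h : Relation.ReflTransGen (PoolStep ν) G₀ G) : PoolInvariant ν G₀ G := by
  suffices PoolInvariant ν G₀ G ∧ (MonotoneOn G (massRange ν) ∨ ∃ c, PoolFrontier ν G₀ G c) from
    this.1
  induction h with
  | refl => exact ⟨h₀.invariant, Or.inr ⟨0, poolFrontier_zero hν⟩⟩
  | tail _ hs ih =>
    obtain ⟨hinv, hm | ⟨c, hc⟩⟩ := ih
    · exact absurd hm hs.not_monotoneOn
    · obtain ⟨hinv', hp⟩ := hs.progress hν h₀ hinv hc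
      exact ⟨hinv', hp.imp_right fun ⟨c', _, h⟩ => ⟨c', h⟩⟩

end Invariant

section Determinism

variable {ν : Measure ℝ} {G : ℝ → ℝ}

theorem StartsFirstDescent.le {b b' : ℝ} (h : StartsFirstDescent ν G b)
    (h' : StartsFirstDescent ν G b') : b' ≤ b := by
  by_contra! hlt
  refine h.descent (b' - b) (by linarith) fun x hx y hy hxy => ?_
  exact h'.mono_left ⟨hx.1.1, by linarith [hx.2.2]⟩ ⟨hy.1.1, by linarith [hy.2.2]⟩ hxy

theorem StartsFirstDescent.eq {b b' : ℝ} (h : StartsFirstDescent ν G b)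
    (h' : StartsFirstDescent ν G b') : b = b' :=
  le_antisymm (h'.le h) (h.le h')

theorem IsFirstMDI.not_strictAntiOn {b₁ b₂ z : ℝ} (h : IsFirstMDI ν G b₁ b₂)
    (hz : z ∈ massRange ν) (hbz : b₂ < z) : ¬ StrictAntiOn G (Icc b₁ z) := by
  intro hanti
  obtain ⟨ε, hε, hm⟩ := h.mono_right
  obtain ⟨y, hby, hy⟩ := exists_between (lt_min hbz (lt_add_of_pos_right b₂ hε))
  obtain ⟨x, hbx, hxy⟩ := exists_between hby
  have hmem : ∀ u, b₂ < u → u ≤ y → u ∈ massRange ν ∩ Ioo b₂ (b₂ + ε) ∩ Icc b₁ z := by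
    intro u hbu huy
    have huz : u < z := huy.trans_lt (hy.trans_le (min_le_left _ _))
    exact ⟨⟨massRange_of_le hz (h.nonneg.trans hbu.le) huz.le, hbu,
      huy.trans_lt (hy.trans_le (min_le_right _ _))⟩, h.le.trans hbu.le, huz.le⟩
  exact hxy.ne (subsingleton_of_monotoneOn_of_strictAntiOn (hm.mono inter_subset_left)
    (hanti.mono inter_subset_right) (hmem x hbx hxy.le) (hmem y hby le_rfl))

theorem IsFirstMDI.right_unique {b₁ b₂ b₂' : ℝ} (h : IsFirstMDI ν G b₁ b₂)
    (h' : IsFirstMDI ν G b₁ b₂') : b₂ = b₂' :=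
  le_antisymm (not_lt.1 fun hlt => h'.not_strictAntiOn h.right_mem hlt h.anti)
    (not_lt.1 fun hlt => h.not_strictAntiOn h'.right_mem hlt h'.anti)

theorem IsFirstMDI.not_isFirstMDIToEnd (hν : ν (Iio 0) = 0) {b₁ b₂ : ℝ}
    (h : IsFirstMDI ν G b₁ b₂) : ¬ IsFirstMDIToEnd ν G b₁ := fun h' => by
  obtain ⟨z, hz, hbz⟩ := exists_mem_massRange_gt hν h.mass_right
  exact h.not_strictAntiOn hz hbz (h'.anti.mono fun y hy =>
    ⟨massRange_of_le hz (h.mem.1.trans hy.1) hy.2, hy.1⟩)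

theorem PoolStep.unique (hν : ν (Iio 0) = 0) {G₁ G₂ : ℝ → ℝ} (h₁ : PoolStep ν G G₁)
    (h₂ : PoolStep ν G G₂) : G₁ = G₂ := by
  cases h₁ with
  | inner b₁ b₂ h =>
    cases h₂ with
    | inner b₁' b₂' h' =>
      obtain rfl := h.toStartsFirstDescent.eq h'.toStartsFirstDescent
      obtain rfl := h.right_unique h'
      rfl
    | toEnd b₁' h' =>
      obtain rfl := h.toStartsFirstDescent.eq h'.toStartsFirstDescent
      exact absurd h' (h.not_isFirstMDIToEnd hν)
  | toEnd b₁ h =>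
    cases h₂ with
    | inner b₁' b₂' h' =>
      obtain rfl := h.toStartsFirstDescent.eq h'.toStartsFirstDescent
      exact absurd h (h'.not_isFirstMDIToEnd hν)
    | toEnd b₁' h' =>
      obtain rfl := h.toStartsFirstDescent.eq h'.toStartsFirstDescent
      rfl

theorem poolOutput_unique (hν : ν (Iio 0) = 0) {G₁ G₂ : ℝ → ℝ}
    (h₁ : Relation.ReflTransGen (PoolStep ν) G G₁) (hm₁ : MonotoneOn G₁ (massRange ν))
    (h₂ : Relation.ReflTransGen (PoolStep ν) G G₂) (hm₂ : MonotoneOn G₂ (massRange ν)) :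
    G₁ = G₂ := by
  induction h₁ using Relation.ReflTransGen.head_induction_on with
  | refl =>
    rcases h₂.cases_head with h | ⟨_, h, _⟩
    · exact h
    · exact absurd hm₁ h.not_monotoneOn
  | head h _ ih =>
    rcases h₂.cases_head with rfl | ⟨_, h', hr⟩
    · exact absurd hm₂ h.not_monotoneOn
    · obtain rfl := h.unique hν h'
      exact ih hr

end Determinism

/-! ### Termination of the pooling procedure -/

section Termination

variable {ν : Measure ℝ} {G₀ G : ℝ → ℝ}

namespace PoolInvariant

theorem le_of_forall_Ioo_le (h : PoolInvariant ν G₀ G) {x y K : ℝ} (hx : 0 ≤ x)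
    (hy : y ∈ massRange ν) (hxy : x < y) (hK : ∀ w ∈ Ioo x y, G w ≤ K) : G y ≤ K := by
  refine le_of_forall_pos_le_add fun δ hδ => ?_
  obtain ⟨w, hw, hwy⟩ := exists_between (max_lt hxy (sub_lt_self y hδ))
  have hxw : x < w := (le_max_left _ _).trans_lt hw
  have hδw : y - δ < w := (le_max_right _ _).trans_lt hw
  linarith [h.le_add_sub (massRange_of_le hy (hx.trans hxw.le) hwy.le) hy hwy.le, hK w ⟨hxw, hwy⟩]

theorem le_of_forall_Ioo_ge (h : PoolInvariant ν G₀ G) {x y K : ℝ} (hx : 0 ≤ x)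
    (hy : y ∈ massRange ν) (hxy : x < y) (hK : ∀ w ∈ Ioo x y, K ≤ G w) : K ≤ G x := by
  refine le_of_forall_pos_le_add fun δ hδ => ?_
  obtain ⟨w, hxw, hw⟩ := exists_between (lt_min hxy (lt_add_of_pos_right x hδ))
  have hwy : w < y := hw.trans_le (min_le_left _ _)
  have hwδ : w < x + δ := hw.trans_le (min_le_right _ _)
  linarith [h.le_add_sub (massRange_of_le hy hx hxy.le)
    (massRange_of_le hy (hx.trans hxw.le) hwy.le) hxw.le, hK w ⟨hxw, hwy⟩]

theorem strictAntiOn_Icc_of_Ico (h : PoolInvariant ν G₀ G) {a b : ℝ} (ha : 0 ≤ a)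
    (hb : b ∈ massRange ν) (hanti : StrictAntiOn G (Ico a b)) : StrictAntiOn G (Icc a b) := by
  intro x hx y hy hxy
  obtain ⟨m, hxm, hmy⟩ := exists_between hxy
  have hmem : ∀ u, x ≤ u → u < y → u ∈ Ico a b := fun u hu huy =>
    ⟨hx.1.trans hu, huy.trans_le hy.2⟩
  refine (h.le_of_forall_Ioo_le (ha.trans (hx.1.trans hxm.le))
    (massRange_of_le hb (ha.trans hy.1) hy.2) hmy fun w hw => ?_).trans_lt
    (hanti (hmem x le_rfl hxy) (hmem m hxm.le hmy) hxm)
  exact (hanti (hmem m hxm.le hmy) (hmem w (hxm.trans hw.1).le hw.2) hw.1).le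

theorem strictAntiOn_Icc_of_Ioc (h : PoolInvariant ν G₀ G) {a b : ℝ} (ha : 0 ≤ a)
    (hb : b ∈ massRange ν) (hanti : StrictAntiOn G (Ioc a b)) : StrictAntiOn G (Icc a b) := by
  intro x hx y hy hxy
  obtain ⟨m, hxm, hmy⟩ := exists_between hxy
  have hmem : ∀ u, x < u → u ≤ y → u ∈ Ioc a b := fun u hu huy =>
    ⟨hx.1.trans_lt hu, huy.trans hy.2⟩
  refine (hanti (hmem m hxm hmy.le) (hmem y hxy le_rfl) hmy).trans_le
    (h.le_of_forall_Ioo_ge (ha.trans hx.1)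
      (massRange_of_le hb (ha.trans (hx.1.trans hxm.le)) (hmy.le.trans hy.2)) hxm fun w hw => ?_)
  exact (hanti (hmem w hw.1 (hw.2.trans hmy).le) (hmem m hxm hmy.le) hw.2).le

theorem exists_strictAntiOn_Icc_gt (h : PoolInvariant ν G₀ G) {a b ε z : ℝ} (hab : a ≤ b)
    (hb : b ∈ massRange ν) (hleft : StrictAntiOn G (Icc a b)) (hε : 0 < ε)
    (hright : StrictAntiOn G (massRange ν ∩ Ioo b (b + ε))) (hz : z ∈ massRange ν) (hbz : b < z) :
    ∃ c ∈ massRange ν, b < c ∧ StrictAntiOn G (Icc a c) := by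
  obtain ⟨c, hbc, hc⟩ := exists_between (lt_min hbz (lt_add_of_pos_right b hε))
  have hcS := massRange_of_le hz (hb.1.trans hbc.le) (hc.trans_le (min_le_left _ _)).le
  have hIcc : StrictAntiOn G (Icc b c) := h.strictAntiOn_Icc_of_Ioc hb.1 hcS <|
    hright.mono fun y hy => ⟨massRange_of_le hcS (hb.1.trans hy.1.le) hy.2, hy.1,
      hy.2.trans_lt (hc.trans_le (min_le_right _ _))⟩
  refine ⟨c, hcS, hbc, ?_⟩
  rw [← Icc_union_Icc_eq_Icc hab hbc.le]
  exact hleft.union hIcc (isGreatest_Icc hab) (isLeast_Icc hbc.le)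

theorem exists_maximal_strictAntiOn (h : PoolInvariant ν G₀ G) {b₁ : ℝ} (hb₁ : b₁ ∈ massRange ν) :
    StrictAntiOn G (massRange ν ∩ Ici b₁) ∨ ∃ b₂ ∈ massRange ν, b₁ ≤ b₂ ∧
      StrictAntiOn G (Icc b₁ b₂) ∧ ∀ c ∈ massRange ν, StrictAntiOn G (Icc b₁ c) → c ≤ b₂ := by
  refine or_iff_not_imp_left.2 fun hend => ?_
  obtain ⟨x, hx, y, hy, hxy, hle⟩ : ∃ x ∈ massRange ν ∩ Ici b₁, ∃ y ∈ massRange ν ∩ Ici b₁,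
      x < y ∧ G x ≤ G y := by
    simpa only [StrictAntiOn, not_forall, not_lt, exists_prop] using hend
  set E := {b ∈ massRange ν | b₁ ≤ b ∧ StrictAntiOn G (Icc b₁ b)}
  have hE : b₁ ∈ E := ⟨hb₁, le_rfl, by simp⟩
  have hub : y ∈ upperBounds E := fun b hb => not_lt.1 fun hyb =>
    (hb.2.2 ⟨hx.2, (hxy.trans hyb).le⟩ ⟨hy.2, hyb.le⟩ hxy).not_ge hle
  have hlub := isLUB_csSup ⟨b₁, hE⟩ ⟨y, hub⟩
  have hb₁E : b₁ ≤ sSup E := hlub.1 hE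
  have hES : sSup E ∈ massRange ν := massRange_of_le hy.1 (hb₁.1.trans hb₁E) (hlub.2 hub)
  refine ⟨sSup E, hES, hb₁E, h.strictAntiOn_Icc_of_Ico hb₁.1 hES ?_, fun c hc hanti => ?_⟩
  · intro u hu v hv huv
    obtain ⟨b, hb, hvb⟩ := (lt_isLUB_iff hlub).1 hv.2
    exact hb.2.2 ⟨hu.1, (huv.trans hvb).le⟩ ⟨hv.1, hvb.le⟩ huv
  · exact (le_total b₁ c).elim (fun hbc => hlub.1 ⟨hc, hbc, hanti⟩) fun hcb => hcb.trans hb₁E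

end PoolInvariant

theorem exists_startsFirstDescent [NeZero ν] (hν : ν (Iio 0) = 0)
    (hG : ¬ MonotoneOn G (massRange ν)) : ∃ b, StartsFirstDescent ν G b := by
  obtain ⟨x, hx, y, hy, hxy, hlt⟩ : ∃ x ∈ massRange ν, ∃ y ∈ massRange ν, x ≤ y ∧ G y < G x := by
    simpa only [MonotoneOn, not_forall, not_le, exists_prop] using hG
  set B := {b ∈ massRange ν | MonotoneOn G (Ico 0 b)}
  have h0 : (0 : ℝ) ∈ B := ⟨zero_mem_massRange hν, by simp [MonotoneOn]⟩
  have hub : y ∈ upperBounds B := fun b hb => not_lt.1 fun hyb =>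
    hlt.not_ge (hb.2 ⟨hx.1, hxy.trans_lt hyb⟩ ⟨hy.1, hyb⟩ hxy)
  have hlub := isLUB_csSup ⟨0, h0⟩ ⟨y, hub⟩
  set b := sSup B
  have hbS : b ∈ massRange ν := massRange_of_le hy (hlub.1 h0) (hlub.2 hub)
  have hmono : MonotoneOn G (Ico 0 b) := by
    intro u hu v hv huv
    obtain ⟨c, hc, hvc⟩ := (lt_isLUB_iff hlub).1 hv.2
    exact hc.2 ⟨hu.1, huv.trans_lt hvc⟩ ⟨hv.1, hvc⟩ huv
  refine ⟨b, hbS, hmono, fun ε hε hm => ?_⟩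
  have hglue : MonotoneOn G (massRange ν ∩ Iio (b + ε)) :=
    monotoneOn_inter_Iio_of_overlap ordConnected_massRange hbS (sub_lt_self b hε)
      (hmono.mono fun u hu => ⟨hu.1.1, hu.2⟩) hm
  have hby : b + ε ≤ y := not_lt.1 fun hyb =>
    hlt.not_ge (hglue ⟨hx, hxy.trans_lt hyb⟩ ⟨hy, hyb⟩ hxy)
  have hbε : b + ε ∈ B := ⟨massRange_of_le hy (by linarith [hbS.1]) hby,
    hglue.mono fun u hu => ⟨massRange_of_le hy hu.1 (hu.2.le.trans hby), hu.2⟩⟩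
  linarith [hlub.1 hbε]

theorem HasFinitelyManyMDIs.exists_Ioo_right (h : HasFinitelyManyMDIs ν G) (b : ℝ) :
    ∃ ε > 0, MonotoneOn G (massRange ν ∩ Ioo b (b + ε)) ∨
      StrictAntiOn G (massRange ν ∩ Ioo b (b + ε)) := by
  obtain ⟨A, hA⟩ := h
  have hnear : ((A : Set ℝ)ᶜ) ∈ 𝓝[>] b := by
    rw [compl_eq_univ_sdiff]
    exact nhdsGT_le_nhdsNE b (nhdsNE_of_nhdsNE_sdiff_finite univ_mem A.finite_toSet)
  obtain ⟨u, hu, hsub⟩ := mem_nhdsGT_iff_exists_Ioo_subset.1 hnear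
  refine ⟨u - b, sub_pos.2 hu, ?_⟩
  rw [add_sub_cancel]
  exact hA _ inter_subset_left (ordConnected_massRange.inter ordConnected_Ioo)
    (disjoint_left.2 fun x hx => hsub hx.2)

theorem PoolFrontier.exists_poolStep [NeZero ν] {c : ℝ} (hc : PoolFrontier ν G₀ G c)
    (hν : ν (Iio 0) = 0) (hfin : HasFinitelyManyMDIs ν G₀) (h : PoolInvariant ν G₀ G)
    (hG : ¬ MonotoneOn G (massRange ν)) : ∃ G', PoolStep ν G G' := by
  obtain ⟨b₁, hb⟩ := exists_startsFirstDescent hν hG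
  rcases h.exists_maximal_strictAntiOn hb.mem with hend | ⟨b₂, hb₂, hle, hanti, hmax⟩
  · exact ⟨_, PoolStep.toEnd b₁ ⟨hb, hend⟩⟩
  by_cases hmass : 0 < ν (Ioi b₂)
  swap
  · refine ⟨_, PoolStep.toEnd b₁ ⟨hb, hanti.mono fun y hy => ⟨hy.2, not_lt.1 fun hgt => ?_⟩⟩⟩
    exact hmass (hy.1.2.trans_le (measure_mono (Ici_subset_Ioi.2 hgt)))
  obtain ⟨ε, hε, hmono⟩ := hfin.exists_Ioo_right b₂
  have heq : EqOn G G₀ (massRange ν ∩ Ioo b₂ (b₂ + ε)) := fun y hy =>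
    hc.eqOn y hy.1 ((hc.le_of_descent hb).trans (hle.trans hy.2.1.le))
  rcases hmono with hm | ha
  · exact ⟨_, PoolStep.inner b₁ b₂ ⟨hb, hle, hmass, hanti, ε, hε, hm.congr heq.symm⟩⟩
  · obtain ⟨z, hz, hbz⟩ := exists_mem_massRange_gt hν hmass
    obtain ⟨c, hcS, hbc, hanti'⟩ :=
      h.exists_strictAntiOn_Icc_gt hle hb₂ hanti hε (ha.congr heq.symm) hz hbz
    exact absurd (hmax c hcS hanti') hbc.not_ge

theorem HasFinitelyManyMDIs.exists_finset_frontier (h : HasFinitelyManyMDIs ν G₀) :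
    ∃ A : Finset ℝ, ∀ G c, PoolFrontier ν G₀ G c → c ∈ A := by
  classical
  obtain ⟨A, hA⟩ := h
  refine ⟨insert 0 A, fun G c hc => ?_⟩
  rcases hc.start with rfl | ⟨a, ha0, hac, hm, hn⟩
  · exact Finset.mem_insert_self _ _
  refine Finset.mem_insert_of_mem (not_not.1 fun hcA => ?_)
  obtain ⟨l, u, ⟨hlc, hcu⟩, hsub⟩ := mem_nhds_iff_exists_Ioo_subset.1
    (A.finite_toSet.isClosed.isOpen_compl.mem_nhds (mem_compl hcA))
  have hac' : max a l < c := max_lt hac hlc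
  have hS : ∀ x, max a l < x → x < c → x ∈ massRange ν := fun x hx hxc =>
    massRange_of_le hc.mem (ha0.trans ((le_max_left a l).trans hx.le)) hxc.le
  have hmono : MonotoneOn G₀ (massRange ν ∩ Ioo (max a l) u) := by
    refine (hA (massRange ν ∩ Ioo (max a l) u) inter_subset_left
      (ordConnected_massRange.inter ordConnected_Ioo) (disjoint_left.2 fun x hx =>
        hsub ⟨(le_max_right a l).trans_lt hx.2.1, hx.2.2⟩)).resolve_right fun hanti => ?_
    obtain ⟨x, hax, hxc⟩ := exists_between hac'
    obtain ⟨y, hxy, hyc⟩ := exists_between hxc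
    refine hxy.ne (subsingleton_of_monotoneOn_of_strictAntiOn (s := Ioo (max a l) c)
      (hm.mono (Ioo_subset_Ioo_left (le_max_left a l))) (hanti.mono fun z hz =>
      ⟨hS z hz.1 hz.2, hz.1, hz.2.trans hcu⟩) ⟨hax, hxc⟩ ⟨hax.trans hxy, hyc⟩)
  have hoc : (massRange ν ∩ Ioi a).OrdConnected := ordConnected_massRange.inter ordConnected_Ioi
  refine hn u hcu ((monotoneOn_inter_Iio_of_overlap (w := u) hoc ⟨hc.mem, hac⟩ hac'
    (hm.mono fun x hx => ⟨hx.1.2, hx.2⟩) (hmono.mono ?_)).mono ?_)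
  · exact inter_subset_inter_left _ inter_subset_left
  · exact fun x hx => ⟨⟨hx.1, hx.2.1⟩, hx.2.2⟩

theorem exists_poolOutput [IsProbabilityMeasure ν] (hν : ν (Iio 0) = 0) (h₀ : IsPoolStart ν G₀)
    (hfin : HasFinitelyManyMDIs ν G₀) :
    ∃ G, Relation.ReflTransGen (PoolStep ν) G₀ G ∧ MonotoneOn G (massRange ν) := by
  obtain ⟨A, hA⟩ := hfin.exists_finset_frontier
  refine (A.finite_toSet.wellFoundedOn (r := (· > ·))).induction (P := fun c => ∀ G,
    PoolInvariant ν G₀ G → PoolFrontier ν G₀ G c →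
      ∃ G', Relation.ReflTransGen (PoolStep ν) G G' ∧ MonotoneOn G' (massRange ν))
    (hA _ _ (poolFrontier_zero hν)) (fun c _ ih G hG hc => ?_) _ h₀.invariant (poolFrontier_zero hν)
  by_cases hm : MonotoneOn G (massRange ν)
  · exact ⟨G, .refl, hm⟩
  obtain ⟨G₁, hs⟩ := hc.exists_poolStep hν hfin hG hm
  obtain ⟨hG₁, hm₁ | ⟨c', hcc', hc'⟩⟩ := hs.progress hν h₀ hG hc
  · exact ⟨G₁, .single hs, hm₁⟩
  · obtain ⟨G', hr, hm'⟩ := ih c' (hA _ _ hc') hcc' G₁ hG₁ hc'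
    exact ⟨G', .head hs hr, hm'⟩

end Termination

/-! ### Quantile functions -/

/-- Lebesgue measure on the unit interval, the common domain of all quantile functions. -/
noncomputable def unitMeasure : Measure ℝ := volume.restrict (Ioo 0 1)

instance : IsProbabilityMeasure unitMeasure := ⟨by simp [unitMeasure]⟩

theorem ae_mem_Ioo_unitMeasure : ∀ᵐ u ∂unitMeasure, u ∈ Ioo (0 : ℝ) 1 :=
  ae_restrict_mem measurableSet_Ioo

theorem unitMeasure_Iic {c : ℝ} (hc : c ≤ 1) : unitMeasure (Iic c) = ENNReal.ofReal c := by
  have h : Iic c ∩ Icc 0 1 = Icc 0 c := by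
    ext u
    simp only [mem_inter_iff, mem_Iic, mem_Icc]
    grind
  rw [unitMeasure, Measure.restrict_congr_set Ioo_ae_eq_Icc,
    Measure.restrict_apply measurableSet_Iic, h, Real.volume_Icc, sub_zero]

theorem setIntegral_unitMeasure {s : Set ℝ} (hs : MeasurableSet s) (h : s ⊆ Ioo 0 1) (f : ℝ → ℝ) :
    ∫ u in s, f u ∂unitMeasure = ∫ u in s, f u := by
  rw [unitMeasure, Measure.restrict_restrict hs, inter_eq_left.2 h]

section Quantile

variable {μ : Measure ℝ}

theorem le_cdf_quantile {u : ℝ} (hu : u ∈ Ioo 0 1) : u ≤ cdf μ (quantile μ u) := by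
  have hne : {x | u ≤ cdf μ x}.Nonempty :=
    ((tendsto_cdf_atTop μ).eventually (eventually_ge_nhds hu.2)).exists
  rw [← (cdf μ).iInf_Ioi_eq, quantile, if_pos hu.1]
  refine le_ciInf fun r => ?_
  obtain ⟨y, hy, hyr⟩ := exists_lt_of_csInf_lt hne r.2
  exact le_trans hy (monotone_cdf μ hyr.le)

theorem quantile_le_iff {u x : ℝ} (hu : u ∈ Ioo 0 1) : quantile μ u ≤ x ↔ u ≤ cdf μ x := by
  refine ⟨fun h => (le_cdf_quantile hu).trans (monotone_cdf μ h), fun h => ?_⟩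
  rw [quantile, if_pos hu.1]
  refine csInf_le ?_ h
  obtain ⟨y, hy⟩ := ((tendsto_cdf_atBot μ).eventually (eventually_lt_nhds hu.1)).exists
  exact ⟨y, fun x hx => not_lt.1 fun hlt =>
    ((monotone_cdf μ hlt.le).trans_lt hy).not_ge hx⟩

theorem lt_quantile_iff {u x : ℝ} (hu : u ∈ Ioo 0 1) : x < quantile μ u ↔ cdf μ x < u := by
  rw [← not_le, quantile_le_iff hu, not_le]

theorem leftLim_cdf_le_of_le_quantile {u : ℝ} (hu : u ∈ Ioo 0 1) {y : ℝ} (h : y ≤ quantile μ u) :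
    Function.leftLim (cdf μ) y ≤ u := by
  refine le_of_tendsto ((monotone_cdf μ).tendsto_leftLim y) ?_
  filter_upwards [self_mem_nhdsWithin] with x hx
  exact ((lt_quantile_iff hu).1 (lt_of_lt_of_le hx h)).le

theorem le_quantile_of_leftLim_cdf_lt {u : ℝ} (hu : u ∈ Ioo 0 1) {y : ℝ}
    (h : Function.leftLim (cdf μ) y < u) : y ≤ quantile μ u :=
  not_lt.1 fun hlt =>
    ((le_cdf_quantile hu).trans ((monotone_cdf μ).le_leftLim hlt)).not_gt h

theorem quantile_eq_of_mem_Ioc {u y : ℝ} (hu : u ∈ Ioo 0 1)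
    (h : u ∈ Ioc (Function.leftLim (cdf μ) y) (cdf μ y)) : quantile μ u = y :=
  le_antisymm ((quantile_le_iff hu).2 h.2) (le_quantile_of_leftLim_cdf_lt hu h.1)

theorem monotoneOn_quantile : MonotoneOn (quantile μ) (Ioo 0 1) :=
  fun _ hu _ hv huv => (quantile_le_iff hu).2 (huv.trans (le_cdf_quantile hv))

theorem aemeasurable_quantile : AEMeasurable (quantile μ) unitMeasure :=
  aemeasurable_restrict_of_monotoneOn measurableSet_Ioo monotoneOn_quantile

variable [IsProbabilityMeasure μ]

theorem map_quantile : unitMeasure.map (quantile μ) = μ := by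
  have : IsProbabilityMeasure (unitMeasure.map (quantile μ)) :=
    Measure.isProbabilityMeasure_map aemeasurable_quantile
  refine Measure.ext_of_Iic _ _ fun x => ?_
  have hpre : (quantile μ ⁻¹' Iic x : Set ℝ) =ᵐ[unitMeasure] Iic (cdf μ x) := by
    filter_upwards [ae_mem_Ioo_unitMeasure] with u hu
    exact propext (quantile_le_iff hu)
  rw [Measure.map_apply_of_aemeasurable aemeasurable_quantile measurableSet_Iic,
    measure_congr hpre, unitMeasure_Iic (cdf_le_one μ x), ofReal_cdf]

theorem integral_comp_quantile {f : ℝ → ℝ} (hf : AEStronglyMeasurable f μ) :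
    ∫ u, f (quantile μ u) ∂unitMeasure = ∫ x, f x ∂μ := by
  conv_rhs => rw [← map_quantile (μ := μ)]
  rw [integral_map aemeasurable_quantile (by rwa [map_quantile])]

theorem memLp_comp_quantile_iff {f : ℝ → ℝ} (hf : AEStronglyMeasurable f μ) {p : ENNReal} :
    MemLp (fun u => f (quantile μ u)) p unitMeasure ↔ MemLp f p μ := by
  conv_rhs => rw [← map_quantile (μ := μ)]
  exact (memLp_map_measure_iff (by rwa [map_quantile]) aemeasurable_quantile).symm

theorem memLp_comp_quantile {f : ℝ → ℝ} {p : ENNReal} (hf : MemLp f p μ) :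
    MemLp (fun u => f (quantile μ u)) p unitMeasure :=
  (memLp_comp_quantile_iff hf.1).2 hf

theorem cdf_eq_zero_of_neg (h : μ (Iio 0) = 0) {x : ℝ} (hx : x < 0) : cdf μ x = 0 := by
  rw [cdf_eq_real, measureReal_def, measure_mono_null (Iic_subset_Iio.2 hx) h, ENNReal.toReal_zero]

theorem quantile_zero_nonneg (h : μ (Iio 0) = 0) : 0 ≤ quantile μ 0 := by
  rw [quantile, if_neg (lt_irrefl _)]
  exact Real.sInf_nonneg fun x hx => not_lt.1 fun hneg => hx.ne' (cdf_eq_zero_of_neg h hneg)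

theorem monotoneOn_quantile_Ico (h : μ (Iio 0) = 0) : MonotoneOn (quantile μ) (Ico 0 1) := by
  rintro u hu v hv huv
  rcases hu.1.eq_or_lt with rfl | hu0
  · rcases huv.eq_or_lt with rfl | hv0
    · exact le_rfl
    · conv_lhs => rw [quantile, if_neg (lt_irrefl _)]
      exact csInf_le ⟨0, fun x hx => not_lt.1 fun hneg => ne_of_gt hx (cdf_eq_zero_of_neg h hneg)⟩
        (hv0.trans_le (le_cdf_quantile ⟨hv0, hv.2⟩))
  · exact monotoneOn_quantile ⟨hu0, hu.2⟩ ⟨hu0.trans_le huv, hv.2⟩ huv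

end Quantile

/-! ### The function `λ(y)` -/

section Cdf

variable {ν : Measure ℝ} [IsProbabilityMeasure ν]

theorem leftLim_cdf (y : ℝ) : Function.leftLim (cdf ν) y = ν.real (Iio y) := by
  have h := (cdf ν).measure_Iio (tendsto_cdf_atBot ν) y
  rw [measure_cdf, sub_zero] at h
  rw [measureReal_def, h, ENNReal.toReal_ofReal]
  exact (cdf_nonneg ν (y - 1)).trans ((monotone_cdf ν).le_leftLim (sub_one_lt y))

theorem leftLim_cdf_nonneg (y : ℝ) : 0 ≤ Function.leftLim (cdf ν) y := by
  rw [leftLim_cdf]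
  exact measureReal_nonneg

theorem leftLim_cdf_lt_one {y : ℝ} (hy : y ∈ massRange ν) : Function.leftLim (cdf ν) y < 1 := by
  have h := probReal_add_probReal_compl (μ := ν) (measurableSet_Iio (a := y))
  have hpos : 0 < ν.real (Ici y) := ENNReal.toReal_pos hy.2.ne' (measure_ne_top _ _)
  rw [compl_Iio] at h
  rw [leftLim_cdf]
  linarith

theorem cdf_sub_leftLim (y : ℝ) : cdf ν y - Function.leftLim (cdf ν) y = ν.real {y} := by
  rw [leftLim_cdf, cdf_eq_real, ← Iio_insert, measureReal_def, insert_eq,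
    measure_union (by simp) measurableSet_Iio]
  simp [measureReal_def, ENNReal.toReal_add]

theorem leftLim_cdf_eq_cdf {y : ℝ} (h : ν {y} = 0) : Function.leftLim (cdf ν) y = cdf ν y := by
  linarith [cdf_sub_leftLim (ν := ν) y, (measureReal_eq_zero_iff (μ := ν)).2 h]

theorem leftLim_cdf_lt_cdf {y : ℝ} (h : ν {y} ≠ 0) : Function.leftLim (cdf ν) y < cdf ν y := by
  linarith [cdf_sub_leftLim (ν := ν) y, ENNReal.toReal_pos h (measure_ne_top ν {y}),
    measureReal_def ν {y}]

theorem cdf_eq_of_measure_Icc_eq_zero {b w y : ℝ} (h : ν (Icc b w) = 0) (hy : y ∈ Icc b w) :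
    cdf ν y = cdf ν b := by
  rw [cdf_eq_real, cdf_eq_real, ← Iic_union_Ioc_eq_Iic hy.1]
  exact measureReal_congr (union_ae_eq_left_of_ae_eq_empty (ae_eq_empty.2 (measure_mono_null
    (Ioc_subset_Icc_self.trans (Icc_subset_Icc_right hy.2)) h)))

end Cdf

section LamFun

variable {ν μl : Measure ℝ}

theorem lamFun_of_null {y : ℝ} (h : ν {y} = 0) : lamFun ν μl y = quantile μl (cdf ν y) :=
  if_pos h

/-- The levels `u` at which the quantile function of `ν` takes the value `y`, up to the two end
points; the interval is empty unless `y` is an atom. -/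
noncomputable def levelInterval (ν : Measure ℝ) (y : ℝ) : Set ℝ :=
  Ioo (Function.leftLim (cdf ν) y) (cdf ν y)

theorem measurableSet_levelInterval (y : ℝ) : MeasurableSet (levelInterval ν y) :=
  measurableSet_Ioo

variable [IsProbabilityMeasure ν]

theorem levelInterval_subset (y : ℝ) : levelInterval ν y ⊆ Ioo 0 1 :=
  Ioo_subset_Ioo (leftLim_cdf_nonneg y) (cdf_le_one ν y)

theorem unitMeasure_real_levelInterval (y : ℝ) :
    unitMeasure.real (levelInterval ν y) = cdf ν y - Function.leftLim (cdf ν) y := by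
  rw [unitMeasure, measureReal_restrict_apply (measurableSet_levelInterval y),
    inter_eq_left.2 (levelInterval_subset y), levelInterval,
    Real.volume_real_Ioo_of_le ((monotone_cdf ν).leftLim_le le_rfl)]

theorem unitMeasure_levelInterval_pos {y : ℝ} (h : ν {y} ≠ 0) :
    0 < unitMeasure (levelInterval ν y) := by
  refine pos_iff_ne_zero.2 fun h0 => (sub_pos.2 (leftLim_cdf_lt_cdf h)).ne' ?_
  rw [← unitMeasure_real_levelInterval, measureReal_def, h0, ENNReal.toReal_zero]

theorem lamFun_of_atom {y : ℝ} (h : ν {y} ≠ 0) :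
    lamFun ν μl y = ⨍ u in levelInterval ν y, quantile μl u ∂unitMeasure := by
  rw [setAverage_eq, unitMeasure_real_levelInterval,
    setIntegral_unitMeasure (measurableSet_levelInterval y) (levelInterval_subset y),
    levelInterval, ← integral_Ioc_eq_integral_Ioo,
    ← intervalIntegral.integral_of_le (leftLim_cdf_lt_cdf h).le, smul_eq_mul, ← div_eq_inv_mul]
  exact if_neg h

theorem lamFun_eq_of_measure_Icc_eq_zero {b w y : ℝ} (h : ν (Icc b w) = 0) (hy : y ∈ Icc b w) :
    lamFun ν μl y = quantile μl (cdf ν b) := by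
  rw [lamFun_of_null (measure_mono_null (singleton_subset_iff.2 hy) h),
    cdf_eq_of_measure_Icc_eq_zero h hy]

variable [IsProbabilityMeasure μl]

theorem integrable_quantile (hl : Integrable id μl) : Integrable (quantile μl) unitMeasure :=
  memLp_one_iff_integrable.1 (memLp_comp_quantile (memLp_one_iff_integrable.2 hl))

theorem quantile_le_lamFun (hl : Integrable id μl) (hl0 : μl (Iio 0) = 0) {y : ℝ}
    (hy : y ∈ massRange ν) {u : ℝ} (hu0 : 0 ≤ u) (hu : u ≤ Function.leftLim (cdf ν) y) :
    quantile μl u ≤ lamFun ν μl y := by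
  have hlt1 := leftLim_cdf_lt_one hy
  have hmono := monotoneOn_quantile_Ico hl0
  by_cases h : ν {y} = 0
  · have heq := leftLim_cdf_eq_cdf h
    rw [lamFun_of_null h]
    exact hmono ⟨hu0, hu.trans_lt hlt1⟩ ⟨cdf_nonneg ν y, heq ▸ hlt1⟩ (heq ▸ hu)
  · rw [lamFun_of_atom h]
    refine le_setAverage (integrable_quantile hl) (unitMeasure_levelInterval_pos h) ?_
    filter_upwards [ae_restrict_mem (measurableSet_levelInterval y)] with v hv
    exact hmono ⟨hu0, hu.trans_lt hlt1⟩ (Ioo_subset_Ico_self (levelInterval_subset y hv))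
      (hu.trans hv.1.le)

theorem lamFun_le_quantile (hl : Integrable id μl) (hl0 : μl (Iio 0) = 0) {y u : ℝ}
    (hu1 : u < 1) (hu : cdf ν y ≤ u) : lamFun ν μl y ≤ quantile μl u := by
  have hmono := monotoneOn_quantile_Ico hl0
  have h0 := cdf_nonneg ν y
  by_cases h : ν {y} = 0
  · rw [lamFun_of_null h]
    exact hmono ⟨h0, hu.trans_lt hu1⟩ ⟨h0.trans hu, hu1⟩ hu
  · rw [lamFun_of_atom h]
    refine setAverage_le (integrable_quantile hl) (unitMeasure_levelInterval_pos h) ?_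
    filter_upwards [ae_restrict_mem (measurableSet_levelInterval y)] with v hv
    exact hmono (Ioo_subset_Ico_self (levelInterval_subset y hv)) ⟨h0.trans hu, hu1⟩
      (hv.2.le.trans hu)

theorem monotoneOn_lamFun (hl : Integrable id μl) (hl0 : μl (Iio 0) = 0) :
    MonotoneOn (lamFun ν μl) (massRange ν) := by
  intro x _ y hy hxy
  rcases hxy.eq_or_lt with rfl | hlt
  · exact le_rfl
  · have h := (monotone_cdf ν).le_leftLim hlt
    exact (lamFun_le_quantile hl hl0 (h.trans_lt (leftLim_cdf_lt_one hy)) le_rfl).trans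
      (quantile_le_lamFun hl hl0 hy (cdf_nonneg ν x) h)

theorem lamFun_nonneg (hl : Integrable id μl) (hl0 : μl (Iio 0) = 0) {y : ℝ}
    (hy : y ∈ massRange ν) : 0 ≤ lamFun ν μl y :=
  (quantile_zero_nonneg hl0).trans (quantile_le_lamFun hl hl0 hy le_rfl (leftLim_cdf_nonneg y))

theorem aemeasurable_lamFun (hν : ν (Iio 0) = 0) (hl : Integrable id μl)
    (hl0 : μl (Iio 0) = 0) : AEMeasurable (lamFun ν μl) ν := by
  have h := aemeasurable_restrict_of_monotoneOn (μ := ν) measurableSet_massRange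
    (monotoneOn_lamFun (ν := ν) hl hl0)
  rwa [Measure.restrict_eq_self_of_ae_mem (ae_mem_massRange hν)] at h

theorem exists_lt_lamFun_left (hl : Integrable id μl) (hl0 : μl (Iio 0) = 0) {a b c : ℝ}
    (ha : 0 ≤ a) (hab : a < b) (hb : b ∈ massRange ν) (hatom : ν {b} = 0)
    (hc : c < quantile μl (cdf ν b)) : ∃ x ∈ Ioo a b, c < lamFun ν μl x := by
  have heq := leftLim_cdf_eq_cdf hatom
  have hb1 : cdf ν b < 1 := heq ▸ leftLim_cdf_lt_one hb
  have hS : ∀ x ∈ Ioo a b, x ∈ massRange ν := fun x hx =>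
    massRange_of_le hb (ha.trans hx.1.le) hx.2.le
  rcases (cdf_nonneg ν b).eq_or_lt with h0 | h0
  · obtain ⟨x, hx⟩ := exists_between hab
    rw [← h0] at hc
    exact ⟨x, hx, hc.trans_le (quantile_le_lamFun hl hl0 (hS x hx) le_rfl (leftLim_cdf_nonneg x))⟩
  · obtain ⟨u, hcu, hub⟩ := exists_between (max_lt ((lt_quantile_iff ⟨h0, hb1⟩).1 hc) h0)
    have hu0 : 0 < u := (le_max_right _ _).trans_lt hcu
    have hlim := (monotone_cdf ν).tendsto_leftLim b
    rw [heq] at hlim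
    obtain ⟨x, hux, hxb : x < b⟩ :=
      ((hlim.eventually (lt_mem_nhds hub)).and self_mem_nhdsWithin).exists
    obtain ⟨z, hz, hzb⟩ := exists_between (max_lt hxb hab)
    have hz' : z ∈ Ioo a b := ⟨(le_max_right x a).trans_lt hz, hzb⟩
    refine ⟨z, hz', ((lt_quantile_iff ⟨hu0, hub.trans hb1⟩).2
      ((le_max_left _ _).trans_lt hcu)).trans_le (quantile_le_lamFun hl hl0 (hS z hz') hu0.le ?_)⟩
    exact hux.le.trans ((monotone_cdf ν).le_leftLim ((le_max_left x a).trans_lt hz))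

end LamFun

section Levels

variable {ν μl : Measure ℝ} [IsProbabilityMeasure ν]

theorem quantile_eq_of_mem_levelInterval {u y : ℝ} (hu : u ∈ levelInterval ν y) :
    quantile ν u = y :=
  quantile_eq_of_mem_Ioc (levelInterval_subset y hu) (Ioo_subset_Ioc_self hu)

theorem pairwise_disjoint_levelInterval :
    Pairwise (Function.onFun Disjoint fun y : {y | 0 < ν {y}} => levelInterval ν y) :=
  fun _ _ hxy => disjoint_left.2 fun _ hu hu' => hxy (Subtype.ext
    ((quantile_eq_of_mem_levelInterval hu).symm.trans (quantile_eq_of_mem_levelInterval hu')))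

/-- The levels at which the quantile function of `ν` takes an atom as value. -/
noncomputable def atomLevels (ν : Measure ℝ) : Set ℝ :=
  ⋃ y : {y | 0 < ν {y}}, levelInterval ν y

instance countable_atoms : Countable {y | 0 < ν {y}} :=
  (Measure.countable_meas_pos_of_disjoint_iUnion (μ := ν) measurableSet_singleton
    fun _ _ hxy => disjoint_singleton.2 hxy).to_subtype

theorem measurableSet_atomLevels : MeasurableSet (atomLevels ν) :=
  .iUnion fun y => measurableSet_levelInterval y.1

theorem ae_quantile_eq_lamFun_of_notMem_atomLevels :
    ∀ᵐ u ∂unitMeasure, u ∉ atomLevels ν → quantile μl u = lamFun ν μl (quantile ν u) := by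
  have hends : (⋃ y : {y | 0 < ν {y}},
      ({Function.leftLim (cdf ν) y, cdf ν y} : Set ℝ)).Countable :=
    countable_iUnion fun y => (Set.toFinite _).countable
  filter_upwards [ae_mem_Ioo_unitMeasure, ae_restrict_of_ae (hends.ae_notMem volume)]
    with u hu huE hlev
  have hle : Function.leftLim (cdf ν) (quantile ν u) ≤ u := leftLim_cdf_le_of_le_quantile hu le_rfl
  have hge : u ≤ cdf ν (quantile ν u) := le_cdf_quantile hu
  have hnull : ν {quantile ν u} = 0 := by
    by_contra hatom
    let y : {y | 0 < ν {y}} := ⟨quantile ν u, pos_iff_ne_zero.2 hatom⟩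
    have hne := fun h => huE (mem_iUnion.2 ⟨y, h⟩)
    exact hlev (mem_iUnion.2 ⟨y, lt_of_le_of_ne hle fun h => hne (Or.inl h.symm),
      lt_of_le_of_ne hge fun h => hne (Or.inr h)⟩)
  rw [lamFun_of_null hnull, le_antisymm (leftLim_cdf_eq_cdf hnull ▸ hle) hge]

variable [IsProbabilityMeasure μl]

theorem memLp_quantile {p : ENNReal} (hl : MemLp id p μl) : MemLp (quantile μl) p unitMeasure :=
  memLp_comp_quantile hl

theorem setLIntegral_lamFun_sq_le (hl : MemLp id 2 μl) {y : ℝ} (hy : 0 < ν {y}) :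
    ∫⁻ u in levelInterval ν y, ENNReal.ofReal (lamFun ν μl (quantile ν u) ^ 2) ∂unitMeasure ≤
      ∫⁻ u in levelInterval ν y, ENNReal.ofReal (quantile μl u ^ 2) ∂unitMeasure := by
  have hq := memLp_quantile hl
  have hpos := unitMeasure_levelInterval_pos hy.ne'
  have hjensen : lamFun ν μl y ^ 2 ≤ ⨍ u in levelInterval ν y, quantile μl u ^ 2 ∂unitMeasure := by
    rw [lamFun_of_atom hy.ne']
    exact even_two.convexOn_pow.map_set_average_le (continuous_pow 2).continuousOn isClosed_univ
      hpos.ne' (measure_ne_top _ _) (by simp) (hq.integrable one_le_two).integrableOn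
      hq.integrable_sq.integrableOn
  rw [setLIntegral_congr_fun (measurableSet_levelInterval y) fun u hu => by
      rw [quantile_eq_of_mem_levelInterval hu],
    ← ofReal_integral_eq_lintegral_ofReal (integrable_const _) (.of_forall fun _ => sq_nonneg _),
    ← ofReal_integral_eq_lintegral_ofReal hq.integrable_sq.integrableOn
      (.of_forall fun _ => sq_nonneg _), setIntegral_const,
    ← measure_smul_setAverage _ (measure_ne_top _ _)]
  exact ENNReal.ofReal_le_ofReal (smul_le_smul_of_nonneg_left hjensen measureReal_nonneg)

theorem memLp_lamFun (hν : ν (Iio 0) = 0) (hl : MemLp id 2 μl) (hl0 : μl (Iio 0) = 0) :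
    MemLp (lamFun ν μl) 2 ν := by
  have hmeas := (aemeasurable_lamFun hν (hl.integrable one_le_two) hl0).aestronglyMeasurable
  have hmeas' : AEStronglyMeasurable (fun u => lamFun ν μl (quantile ν u)) unitMeasure := by
    have hmap : AEStronglyMeasurable (lamFun ν μl) (unitMeasure.map (quantile ν)) := by
      rwa [map_quantile]
    exact hmap.comp_aemeasurable aemeasurable_quantile
  have hle : ∫⁻ u, ENNReal.ofReal (lamFun ν μl (quantile ν u) ^ 2) ∂unitMeasure ≤
      ∫⁻ u, ENNReal.ofReal (quantile μl u ^ 2) ∂unitMeasure := by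
    rw [← lintegral_add_compl _ (measurableSet_atomLevels (ν := ν)), ← lintegral_add_compl
      (fun u => ENNReal.ofReal (quantile μl u ^ 2)) (measurableSet_atomLevels (ν := ν))]
    refine add_le_add ?_ (setLIntegral_congr_fun_ae measurableSet_atomLevels.compl ?_).le
    · have hmeasurable : ∀ y : {y | 0 < ν {y}}, MeasurableSet (levelInterval ν y) :=
        fun y => measurableSet_levelInterval y.1
      rw [atomLevels, lintegral_iUnion hmeasurable pairwise_disjoint_levelInterval,
        lintegral_iUnion hmeasurable pairwise_disjoint_levelInterval]
      exact ENNReal.tsum_le_tsum fun y => setLIntegral_lamFun_sq_le hl y.2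
    · filter_upwards [ae_quantile_eq_lamFun_of_notMem_atomLevels (ν := ν) (μl := μl)] with u hu hu'
      rw [hu hu']
  rw [← memLp_comp_quantile_iff hmeas, memLp_two_iff_integrable_sq hmeas']
  refine ⟨hmeas'.pow 2, ?_⟩
  rw [hasFiniteIntegral_iff_ofReal (.of_forall fun _ => sq_nonneg _)]
  refine hle.trans_lt ?_
  rw [← hasFiniteIntegral_iff_ofReal (.of_forall fun _ => sq_nonneg _)]
  exact (memLp_quantile hl).integrable_sq.2

theorem setIntegral_levelInterval_sub_lamFun (hl : Integrable id μl) {y : ℝ} (hy : 0 < ν {y}) :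
    ∫ u in levelInterval ν y, (quantile μl u - lamFun ν μl y) ∂unitMeasure = 0 := by
  rw [← setAverage_sub_mul (integrable_quantile hl) (unitMeasure_levelInterval_pos hy.ne'),
    lamFun_of_atom hy.ne', sub_self, zero_mul]

/-- `λ ∘ q` is the conditional expectation of the quantile function of `μl` given the quantile
function `q` of `ν`. -/
theorem integral_quantile_mul (hν : ν (Iio 0) = 0) (hl : MemLp id 2 μl) (hl0 : μl (Iio 0) = 0)
    {f : ℝ → ℝ} (hf : MemLp f 2 ν) :
    ∫ u, quantile μl u * f (quantile ν u) ∂unitMeasure = ∫ y, lamFun ν μl y * f y ∂ν := by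
  have hlam := memLp_lamFun hν hl hl0
  have hqf : Integrable (fun u => quantile μl u * f (quantile ν u)) unitMeasure :=
    (memLp_quantile hl).integrable_mul (memLp_comp_quantile hf)
  have hlf : Integrable (fun u => lamFun ν μl (quantile ν u) * f (quantile ν u)) unitMeasure :=
    (memLp_comp_quantile hlam).integrable_mul (memLp_comp_quantile hf)
  have hdiff : Integrable (fun u => quantile μl u * f (quantile ν u) -
    lamFun ν μl (quantile ν u) * f (quantile ν u)) unitMeasure := hqf.sub hlf
  have hatoms : ∫ u in atomLevels ν, (quantile μl u * f (quantile ν u) -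
      lamFun ν μl (quantile ν u) * f (quantile ν u)) ∂unitMeasure = 0 := by
    rw [atomLevels, integral_iUnion
      (fun y : {y | 0 < ν {y}} => measurableSet_levelInterval y.1)
      pairwise_disjoint_levelInterval hdiff.integrableOn]
    refine (tsum_congr fun y => ?_).trans tsum_zero
    rw [setIntegral_congr_fun (g := fun u => f y * (quantile μl u - lamFun ν μl y))
      (measurableSet_levelInterval _) fun u hu => ?_, integral_const_mul,
      setIntegral_levelInterval_sub_lamFun (hl.integrable one_le_two) y.2, mul_zero]
    simp only [quantile_eq_of_mem_levelInterval hu]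
    ring
  have hrest : ∫ u in (atomLevels ν)ᶜ, (quantile μl u * f (quantile ν u) -
      lamFun ν μl (quantile ν u) * f (quantile ν u)) ∂unitMeasure = 0 := by
    refine (setIntegral_congr_ae measurableSet_atomLevels.compl ?_).trans (integral_zero _ _)
    filter_upwards [ae_quantile_eq_lamFun_of_notMem_atomLevels (ν := ν) (μl := μl)] with u hu hu'
    rw [hu hu', sub_self]
  rw [← integral_comp_quantile (μ := ν) (f := fun y => lamFun ν μl y * f y) (hlam.1.mul hf.1),
    ← sub_eq_zero, ← integral_sub hqf hlf,
    ← integral_add_compl (measurableSet_atomLevels (ν := ν)) hdiff, hatoms, hrest, add_zero]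

theorem isPoolStart_initialG (hν : ν (Iio 0) = 0) (hy : MemLp id 2 ν) (hl : MemLp id 2 μl)
    (hl0 : μl (Iio 0) = 0) : IsPoolStart ν (initialG ν μl) where
  sub := by
    simpa only [initialG, sub_sub_cancel] using monotoneOn_lamFun (hl.integrable one_le_two) hl0
  zero := by
    simpa only [initialG, zero_sub, neg_nonpos] using
      lamFun_nonneg (hl.integrable one_le_two) hl0 (zero_mem_massRange hν)
  memLp := hy.sub (memLp_lamFun hν hl hl0)
  gap a b w ha _ hbw hb h0 hm := by
    have hflat : ∀ y ∈ Icc b w, initialG ν μl y = y - quantile μl (cdf ν b) := fun y hy => by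
      rw [initialG, lamFun_eq_of_measure_Icc_eq_zero h0 hy]
    intro x hx y hy hxy
    rcases lt_or_ge y b with hyb | hyb
    · exact hm ⟨hx.1, hxy.trans_lt hyb⟩ ⟨hy.1, hyb⟩ hxy
    rw [hflat y ⟨hyb, hy.2.le⟩]
    rcases lt_or_ge x b with hxb | hxb
    · refine le_of_forall_pos_le_add fun δ hδ => ?_
      obtain ⟨z, hz, hlt⟩ := exists_lt_lamFun_left (hl.integrable one_le_two) hl0
        (ha.trans hx.1.le) hxb hb (measure_mono_null (singleton_subset_iff.2
          (left_mem_Icc.2 hbw.le)) h0) (sub_lt_self (quantile μl (cdf ν b)) hδ)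
      have hxz : initialG ν μl x ≤ z - lamFun ν μl z :=
        hm ⟨hx.1, hxb⟩ ⟨hx.1.trans hz.1, hz.2⟩ hz.1.le
      linarith [hz.2]
    · rw [hflat x ⟨hxb, hx.2.le⟩]
      linarith
  gap_zero w _ h0 x hx y hy hxy := by
    rw [initialG, initialG, lamFun_eq_of_measure_Icc_eq_zero h0 ⟨hx.1, hx.2.le⟩,
      lamFun_eq_of_measure_Icc_eq_zero h0 ⟨hy.1, hy.2.le⟩]
    linarith

end Levels

section Tails

variable {ν μl : Measure ℝ}

theorem preimage_quantile_Ioi_ae_eq (y : ℝ) :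
    quantile ν ⁻¹' Ioi y =ᵐ[unitMeasure] Ioo (cdf ν y) 1 := by
  filter_upwards [ae_mem_Ioo_unitMeasure] with u hu
  exact propext ((lt_quantile_iff hu).trans (and_iff_left hu.2).symm)

theorem preimage_quantile_Ici_ae_eq (y : ℝ) :
    quantile ν ⁻¹' Ici y =ᵐ[unitMeasure] Ioo (Function.leftLim (cdf ν) y) 1 := by
  have hne : ∀ᵐ u ∂unitMeasure, u ≠ Function.leftLim (cdf ν) y :=
    ae_restrict_of_ae (Measure.ae_ne volume _)
  filter_upwards [ae_mem_Ioo_unitMeasure, hne] with u hu hu'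
  exact propext ⟨fun h => ⟨(leftLim_cdf_le_of_le_quantile hu h).lt_of_ne' hu', hu.2⟩,
    fun h => le_quantile_of_leftLim_cdf_lt hu h.1⟩

variable [IsProbabilityMeasure ν] [IsProbabilityMeasure μl]

theorem integral_sub_quantile_mul (hν : ν (Iio 0) = 0) (hl : MemLp id 2 μl) (hl0 : μl (Iio 0) = 0)
    {w f : ℝ → ℝ} (hw : MemLp w 2 ν) (hf : MemLp f 2 ν) :
    ∫ u, (w (quantile ν u) - quantile μl u) * f (quantile ν u) ∂unitMeasure =
      ∫ y, (w y - lamFun ν μl y) * f y ∂ν := by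
  have hwf : Integrable (fun y => w y * f y) ν := hw.integrable_mul hf
  have hlf : Integrable (fun y => lamFun ν μl y * f y) ν :=
    (memLp_lamFun hν hl hl0).integrable_mul hf
  have hwfq : Integrable (fun u => w (quantile ν u) * f (quantile ν u)) unitMeasure :=
    (memLp_comp_quantile hw).integrable_mul (memLp_comp_quantile hf)
  have hqf : Integrable (fun u => quantile μl u * f (quantile ν u)) unitMeasure :=
    (memLp_quantile hl).integrable_mul (memLp_comp_quantile hf)
  simp only [sub_mul]
  rw [integral_sub hwfq hqf, integral_sub hwf hlf, integral_quantile_mul hν hl hl0 hf,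
    integral_comp_quantile (μ := ν) (f := fun y => w y * f y) hwf.aestronglyMeasurable]

theorem setIntegral_preimage_quantile_sub (hν : ν (Iio 0) = 0) (hl : MemLp id 2 μl)
    (hl0 : μl (Iio 0) = 0) {w : ℝ → ℝ} (hw : MemLp w 2 ν) {A : Set ℝ} (hA : MeasurableSet A) :
    ∫ u in quantile ν ⁻¹' A, (w (quantile ν u) - quantile μl u) ∂unitMeasure =
      ∫ y in A, (w y - lamFun ν μl y) ∂ν := by
  have hind : MemLp (A.indicator fun _ => (1 : ℝ)) 2 ν := (memLp_const 1).indicator hA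
  rw [← integral_indicator₀ (aemeasurable_quantile.nullMeasurable hA), ← integral_indicator hA]
  convert integral_sub_quantile_mul hν hl hl0 hw hind using 3 with u y
  · by_cases h : quantile ν u ∈ A <;> simp [h]
  · by_cases h : y ∈ A <;> simp [h]

/-- On an interval on which the quantile function of `ν` is constant, the integrand is decreasing,
so that its tail integrals are largest at one of the end points. -/
theorem setIntegral_Ioo_sub_quantile_nonpos (hν : ν (Iio 0) = 0) (hl : MemLp id 2 μl)
    (hl0 : μl (Iio 0) = 0) {w : ℝ → ℝ} (hw : MemLp w 2 ν)
    (htail : ∀ A : Set ℝ, IsUpperSet A → ∫ y in A, (w y - lamFun ν μl y) ∂ν ≤ 0) {a : ℝ}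
    (ha : a ∈ Icc 0 1) :
    ∫ u in Ioo a 1, (w (quantile ν u) - quantile μl u) ≤ 0 := by
  have hint : Integrable (fun u => w (quantile ν u) - quantile μl u) unitMeasure :=
    ((memLp_comp_quantile hw).sub (memLp_quantile hl)).integrable one_le_two
  have hIoo : ∀ {c : ℝ} {A : Set ℝ}, IsUpperSet A →
      quantile ν ⁻¹' A =ᵐ[unitMeasure] Ioo c 1 →
      ∫ u in Ioo c 1, (w (quantile ν u) - quantile μl u) ∂unitMeasure ≤ 0 := by
    intro c A hA hAc
    rw [← setIntegral_congr_set hAc, setIntegral_preimage_quantile_sub hν hl hl0 hw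
      hA.ordConnected.measurableSet]
    exact htail A hA
  rw [← setIntegral_unitMeasure measurableSet_Ioo (Ioo_subset_Ioo_left ha.1)]
  rcases ha.1.eq_or_lt with rfl | ha0
  · refine hIoo isUpperSet_univ ?_
    filter_upwards [ae_mem_Ioo_unitMeasure] with u hu
    exact propext (iff_of_true (mem_univ _) hu)
  rcases ha.2.eq_or_lt with rfl | ha1
  · simp
  have hau : a ∈ Ioo 0 1 := ⟨ha0, ha1⟩
  set y := quantile ν a
  have hleft : Function.leftLim (cdf ν) y ≤ a := leftLim_cdf_le_of_le_quantile hau le_rfl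
  have hright : a ≤ cdf ν y := le_cdf_quantile hau
  have hmono := monotoneOn_quantile (μ := μl)
  rcases le_or_gt (w y) (quantile μl a) with hcase | hcase
  · refine (setIntegral_le_setIntegral_of_sign hint measurableSet_Ioo measurableSet_Ioo
      (fun u hu => ?_) fun u hu => absurd ⟨hright.trans_lt hu.1.1, hu.1.2⟩ hu.2).trans
      (hIoo (isUpperSet_Ioi y) (preimage_quantile_Ioi_ae_eq y))
    have hu0 : u ∈ Ioo 0 1 := ⟨ha0.trans hu.1.1, hu.1.2⟩
    rw [quantile_eq_of_mem_Ioc hu0 ⟨hleft.trans_lt hu.1.1, not_lt.1 fun h => hu.2 ⟨h, hu.1.2⟩⟩]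
    linarith [hmono hau hu0 hu.1.1.le]
  · refine (setIntegral_le_setIntegral_of_sign hint measurableSet_Ioo measurableSet_Ioo
      (fun u hu => absurd ⟨hleft.trans_lt hu.1.1, hu.1.2⟩ hu.2) fun u hu => ?_).trans
      (hIoo (isUpperSet_Ici y) (preimage_quantile_Ici_ae_eq y))
    have hua : u ≤ a := not_lt.1 fun h => hu.2 ⟨h, hu.1.2⟩
    have hu0 : u ∈ Ioo 0 1 := ⟨(leftLim_cdf_nonneg y).trans_lt hu.1.1, hu.1.2⟩
    rw [quantile_eq_of_mem_Ioc hu0 ⟨hu.1.1, hua.trans hright⟩]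
    linarith [hmono hu0 hau hua]

end Tails

/-! ### Shrinkage functions -/

/-- Odd, non-decreasing and `1`-Lipschitz functions: a class that is compact under pointwise
convergence and contains all outputs of the procedure. -/
structure IsShrinkage (η : ℝ → ℝ) : Prop where
  odd : ∀ t, η (-t) = -η t
  mono : Monotone η
  lipschitz : LipschitzWith 1 η

namespace IsShrinkage

variable {η : ℝ → ℝ}

theorem map_zero (h : IsShrinkage η) : η 0 = 0 := by
  have := h.odd 0
  rw [neg_zero] at this
  linarith

theorem abs_sub_le (h : IsShrinkage η) (x y : ℝ) : |η x - η y| ≤ |x - y| := by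
  simpa [Real.dist_eq] using h.lipschitz.dist_le_mul x y

theorem abs_le (h : IsShrinkage η) (x : ℝ) : |η x| ≤ |x| := by
  simpa [h.map_zero] using h.abs_sub_le x 0

theorem nonneg (h : IsShrinkage η) {x : ℝ} (hx : 0 ≤ x) : 0 ≤ η x :=
  h.map_zero ▸ h.mono hx

theorem monotone_sub (h : IsShrinkage η) : Monotone fun x => x - η x := by
  intro x y hxy
  have hlip := h.abs_sub_le y x
  rw [abs_of_nonneg (sub_nonneg.2 hxy), abs_of_nonneg (sub_nonneg.2 (h.mono hxy))] at hlip
  change x - η x ≤ y - η y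
  linarith

theorem le_self (h : IsShrinkage η) {x : ℝ} (hx : 0 ≤ x) : η x ≤ x :=
  sub_nonneg.1 (by simpa [h.map_zero] using h.monotone_sub hx)

theorem continuous (h : IsShrinkage η) : Continuous η := h.lipschitz.continuous

theorem memLp_comp (h : IsShrinkage η) {α : Type*} [MeasurableSpace α] {m : Measure α} {f : α → ℝ}
    {p : ENNReal} (hf : MemLp f p m) : MemLp (fun x => η (f x)) p m :=
  hf.mono (h.continuous.comp_aestronglyMeasurable hf.1) (.of_forall fun x => h.abs_le (f x))

theorem of_monotoneOn_Ici (hodd : ∀ t, η (-t) = -η t) (hm : MonotoneOn η (Ici 0))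
    (hs : MonotoneOn (fun t => t - η t) (Ici 0)) : IsShrinkage η := by
  have hmono : Monotone η := monotone_of_odd_of_monotoneOn_nonneg hodd hm
  have hsub : Monotone fun t => t - η t :=
    monotone_of_odd_of_monotoneOn_nonneg (fun t => by rw [hodd]; ring) hs
  refine ⟨hodd, hmono, LipschitzWith.of_le_add_mul 1 fun x y => ?_⟩
  rw [NNReal.coe_one, one_mul, Real.dist_eq]
  rcases le_total x y with hxy | hyx
  · linarith [hmono hxy, abs_nonneg (x - y)]
  · have hle : y - η y ≤ x - η x := hsub hyx
    linarith [le_abs_self (x - y)]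

end IsShrinkage

theorem sign_mul_max_zero_of_nonneg {g : ℝ → ℝ} (h0 : g 0 ≤ 0) {y : ℝ} (hy : 0 ≤ y) :
    Real.sign y * max 0 (g |y|) = max 0 (g y) := by
  rcases hy.eq_or_lt with rfl | hy
  · rw [Real.sign_zero, zero_mul, max_eq_left h0]
  · rw [Real.sign_of_pos hy, one_mul, abs_of_pos hy]

theorem isShrinkage_sign_mul_max_zero {g : ℝ → ℝ} (hm : MonotoneOn g (Ici 0))
    (hs : MonotoneOn (fun y => y - g y) (Ici 0)) (h0 : g 0 ≤ 0) :
    IsShrinkage fun y => Real.sign y * max 0 (g |y|) := by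
  refine .of_monotoneOn_Ici (fun t => by rw [Real.sign_neg, abs_neg, neg_mul]) ?_ ?_
  · intro x hx y hy hxy
    simp only [sign_mul_max_zero_of_nonneg h0 hx, sign_mul_max_zero_of_nonneg h0 hy]
    exact max_le_max_left _ (hm hx hy hxy)
  · intro x hx y hy hxy
    have hle : x - g x ≤ y - g y := hs hx hy hxy
    simp only [sign_mul_max_zero_of_nonneg h0 hx, sign_mul_max_zero_of_nonneg h0 hy]
    rcases max_choice 0 (g y) with e | e <;> rw [e] <;>
      linarith [le_max_left 0 (g x), le_max_right 0 (g x)]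

/-! ### Optimality of the output of the procedure -/

section ScalarOfG

variable {ν : Measure ℝ} {G₀ G : ℝ → ℝ}

/-- The function `G` of the output of the procedure, extended beyond the mass range. -/
noncomputable def extendBeyondRange (ν : Measure ℝ) (G : ℝ → ℝ) (y : ℝ) : ℝ :=
  open Classical in if y ∈ massRange ν then G y else y - ⨆ z : massRange ν, ((z : ℝ) - G z)

theorem extendBeyondRange_of_mem {y : ℝ} (hy : y ∈ massRange ν) :
    extendBeyondRange ν G y = G y :=
  if_pos hy

theorem extendBeyondRange_of_notMem {y : ℝ} (hy : y ∉ massRange ν) :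
    extendBeyondRange ν G y = y - ⨆ z : massRange ν, ((z : ℝ) - G z) :=
  if_neg hy

theorem lt_of_mem_massRange_of_notMem {y z : ℝ} (hy : 0 ≤ y) (hyS : y ∉ massRange ν)
    (hz : z ∈ massRange ν) : z < y :=
  not_le.1 fun hyz => hyS (massRange_of_le hz hy hyz)

theorem sub_le_sub_of_notMem_massRange (hm : MonotoneOn G (massRange ν))
    (hs : MonotoneOn (fun y => y - G y) (massRange ν)) {y : ℝ} (hy : 0 ≤ y)
    (hyS : y ∉ massRange ν) {z z' : ℝ} (hz : z ∈ massRange ν) (hz' : z' ∈ massRange ν) :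
    z' - G z' ≤ y - G z := by
  rcases le_total z' z with hzz | hzz
  · have hle : z' - G z' ≤ z - G z := hs hz' hz hzz
    linarith [lt_of_mem_massRange_of_notMem hy hyS hz]
  · linarith [hm hz hz' hzz, lt_of_mem_massRange_of_notMem hy hyS hz']

theorem monotoneOn_extendBeyondRange (hm : MonotoneOn G (massRange ν))
    (hs : MonotoneOn (fun y => y - G y) (massRange ν)) :
    MonotoneOn (extendBeyondRange ν G) (Ici 0) := by
  intro x hx y hy hxy
  by_cases hyS : y ∈ massRange ν
  · have hxS := massRange_of_le hyS hx hxy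
    rw [extendBeyondRange_of_mem hyS, extendBeyondRange_of_mem hxS]
    exact hm hxS hyS hxy
  by_cases hxS : x ∈ massRange ν
  · have : Nonempty (massRange ν) := ⟨⟨x, hxS⟩⟩
    rw [extendBeyondRange_of_notMem hyS, extendBeyondRange_of_mem hxS, le_sub_comm]
    exact ciSup_le fun z => sub_le_sub_of_notMem_massRange hm hs hy hyS hxS z.2
  · rw [extendBeyondRange_of_notMem hyS, extendBeyondRange_of_notMem hxS]
    exact sub_le_sub_right hxy _

theorem monotoneOn_sub_extendBeyondRange (hm : MonotoneOn G (massRange ν))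
    (hs : MonotoneOn (fun y => y - G y) (massRange ν)) :
    MonotoneOn (fun y => y - extendBeyondRange ν G y) (Ici 0) := by
  intro x hx y hy hxy
  by_cases hyS : y ∈ massRange ν
  · have hxS := massRange_of_le hyS hx hxy
    simp only [extendBeyondRange_of_mem hyS, extendBeyondRange_of_mem hxS]
    exact hs hxS hyS hxy
  by_cases hxS : x ∈ massRange ν
  · simp only [extendBeyondRange_of_notMem hyS, extendBeyondRange_of_mem hxS, sub_sub_cancel]
    refine le_ciSup (f := fun z : massRange ν => (z : ℝ) - G z) ⟨y - G x, ?_⟩ ⟨x, hxS⟩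
    exact forall_mem_range.2 fun z => sub_le_sub_of_notMem_massRange hm hs hy hyS hxS z.2
  · simp only [extendBeyondRange_of_notMem hyS, extendBeyondRange_of_notMem hxS, sub_sub_cancel,
      le_refl]

theorem scalarOfG_eq_sign_mul_max_zero :
    scalarOfG ν G = fun y => Real.sign y * max 0 (extendBeyondRange ν G |y|) := by
  funext y
  simp only [scalarOfG, extendBeyondRange]

variable [NeZero ν]

theorem extendBeyondRange_zero_nonpos (hν : ν (Iio 0) = 0) (h0 : G 0 ≤ 0) :
    extendBeyondRange ν G 0 ≤ 0 := by
  rwa [extendBeyondRange_of_mem (zero_mem_massRange hν)]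

theorem PoolInvariant.isShrinkage_scalarOfG (h : PoolInvariant ν G₀ G) (hν : ν (Iio 0) = 0)
    (hm : MonotoneOn G (massRange ν)) : IsShrinkage (scalarOfG ν G) := by
  rw [scalarOfG_eq_sign_mul_max_zero]
  exact isShrinkage_sign_mul_max_zero (monotoneOn_extendBeyondRange hm h.sub)
    (monotoneOn_sub_extendBeyondRange hm h.sub) (extendBeyondRange_zero_nonpos hν h.zero)

theorem PoolInvariant.scalarOfG_of_mem_massRange (h : PoolInvariant ν G₀ G) (hν : ν (Iio 0) = 0)
    {y : ℝ} (hy : y ∈ massRange ν) : scalarOfG ν G y = max 0 (G y) := by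
  simp only [scalarOfG_eq_sign_mul_max_zero]
  rw [sign_mul_max_zero_of_nonneg (extendBeyondRange_zero_nonpos hν h.zero) hy.1,
    extendBeyondRange_of_mem hy]

end ScalarOfG

theorem PoolInvariant.integral_mul_max_zero {ν : Measure ℝ} {G₀ G : ℝ → ℝ}
    (h : PoolInvariant ν G₀ G) (hG₀ : MemLp G₀ 2 ν) :
    ∫ y, (G₀ y - G y) * max 0 (G y) ∂ν = 0 := by
  have hd : MemLp (fun y => G₀ y - G y) 2 ν := hG₀.sub h.memLp
  have htrunc : ∀ (n : ℕ) (t : ℝ), 0 ≤ min (max 0 t) n := fun n t =>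
    le_min (le_max_left _ _) n.cast_nonneg
  have hlim : Tendsto (fun n : ℕ => ∫ y, (G₀ y - G y) * min (max 0 (G y)) n ∂ν) atTop
      (𝓝 (∫ y, (G₀ y - G y) * max 0 (G y) ∂ν)) := by
    refine tendsto_integral_of_dominated_convergence (fun y => |G₀ y - G y| * |G y|)
      (fun n => hd.1.mul (((continuous_const.max continuous_id).min
        continuous_const).comp_aestronglyMeasurable h.memLp.1))
      (hd.abs.integrable_mul h.memLp.abs) (fun n => .of_forall fun y => ?_)
      (.of_forall fun y => ?_)
    · rw [Real.norm_eq_abs, abs_mul, abs_of_nonneg (htrunc n _)]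
      exact mul_le_mul_of_nonneg_left
        ((min_le_left _ _).trans (max_le (abs_nonneg _) (le_abs_self _))) (abs_nonneg _)
    · refine tendsto_const_nhds.congr' ?_
      filter_upwards [eventually_ge_atTop ⌈max 0 (G y)⌉₊] with n hn
      rw [min_eq_left (Nat.ceil_le.1 hn)]
  refine tendsto_nhds_unique hlim (tendsto_const_nhds.congr fun n => ?_)
  refine (h.orth (fun t => min (max 0 t) n)
    ((measurable_const.max measurable_id).min measurable_const) ⟨n, fun t => ?_⟩).symm
  rw [abs_of_nonneg (htrunc n t)]
  exact min_le_right _ _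

/-- `η ∘ q` is the projection of `q - ℓ` onto the cone of nonnegative non-decreasing functions on
the unit interval, where `q` and `ℓ` are the quantile functions of `ν` and `μl`. -/
structure IsOptimalShrinkage (ν μl : Measure ℝ) (η : ℝ → ℝ) : Prop extends IsShrinkage η where
  tail : ∀ a ∈ Icc (0 : ℝ) 1,
    ∫ u in Ioo a 1, (quantile ν u - η (quantile ν u) - quantile μl u) ≤ 0
  slack : ∫ u, (quantile ν u - η (quantile ν u) - quantile μl u) * η (quantile ν u) ∂unitMeasure = 0

theorem isOptimalShrinkage_scalarOfG {ν μl : Measure ℝ} [IsProbabilityMeasure ν]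
    [IsProbabilityMeasure μl] (hν : ν (Iio 0) = 0) (hy : MemLp id 2 ν) (hl : MemLp id 2 μl)
    (hl0 : μl (Iio 0) = 0) {G : ℝ → ℝ}
    (hr : Relation.ReflTransGen (PoolStep ν) (initialG ν μl) G)
    (hm : MonotoneOn G (massRange ν)) : IsOptimalShrinkage ν μl (scalarOfG ν G) := by
  have h₀ := isPoolStart_initialG hν hy hl hl0
  have hinv := poolInvariant_of_reflTransGen hν h₀ hr
  have hη := hinv.isShrinkage_scalarOfG hν hm
  have hval : ∀ᵐ y ∂ν, scalarOfG ν G y = max 0 (G y) :=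
    (ae_mem_massRange hν).mono fun y => hinv.scalarOfG_of_mem_massRange hν
  have hηL : MemLp (scalarOfG ν G) 2 ν := hη.memLp_comp hy
  have hw : MemLp (fun y => y - scalarOfG ν G y) 2 ν := hy.sub hηL
  refine ⟨hη, fun a ha => setIntegral_Ioo_sub_quantile_nonpos hν hl hl0 hw (fun A hA => ?_) ha, ?_⟩
  · refine le_trans (setIntegral_mono_ae
      ((hw.sub (memLp_lamFun hν hl hl0)).integrable one_le_two).integrableOn
      ((h₀.memLp.sub hinv.memLp).integrable one_le_two).integrableOn ?_) (hinv.tail A hA)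
    filter_upwards [hval] with y hyG
    simp only [Pi.sub_apply, initialG, hyG]
    linarith [le_max_right 0 (G y)]
  · rw [integral_sub_quantile_mul hν hl hl0 hw hηL, ← hinv.integral_mul_max_zero h₀.memLp]
    refine integral_congr_ae ?_
    filter_upwards [hval] with y hyG
    simp only [initialG, hyG]
    rcases max_choice 0 (G y) with e | e <;> rw [e] <;> ring

/-! ### Convergence in `L²` -/

section L2Convergence

variable {α : Type*} [MeasurableSpace α] {m : Measure α}

theorem inner_toLp_eq_integral {f g : α → ℝ} (hf : MemLp f 2 m) (hg : MemLp g 2 m) :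
    inner ℝ (hf.toLp f) (hg.toLp g) = ∫ x, f x * g x ∂m := by
  rw [L2.inner_def]
  refine integral_congr_ae ?_
  filter_upwards [hf.coeFn_toLp, hg.coeFn_toLp] with x hfx hgx
  rw [hfx, hgx, real_inner_comm]
  rfl

theorem norm_toLp_sq {f : α → ℝ} (hf : MemLp f 2 m) : ‖hf.toLp f‖ ^ 2 = ∫ x, f x ^ 2 ∂m := by
  rw [← real_inner_self_eq_norm_sq, inner_toLp_eq_integral]
  simp only [sq]

theorem abs_integral_mul_le {f g : α → ℝ} (hf : MemLp f 2 m) (hg : MemLp g 2 m) :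
    |∫ x, f x * g x ∂m| ≤ √(∫ x, f x ^ 2 ∂m) * √(∫ x, g x ^ 2 ∂m) := by
  rw [← inner_toLp_eq_integral hf hg, ← norm_toLp_sq hf, ← norm_toLp_sq hg,
    Real.sqrt_sq (norm_nonneg _), Real.sqrt_sq (norm_nonneg _)]
  exact abs_real_inner_le_norm _ _

theorem integral_sub_sq {f g : α → ℝ} (hf : MemLp f 2 m) (hg : MemLp g 2 m) :
    ∫ x, (f x - g x) ^ 2 ∂m =
      2 * ∫ x, f x ^ 2 ∂m + 2 * ∫ x, g x ^ 2 ∂m - ∫ x, (f x + g x) ^ 2 ∂m := by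
  have h := parallelogram_law_with_norm ℝ (hf.toLp f) (hg.toLp g)
  rw [← MemLp.toLp_add, ← MemLp.toLp_sub] at h
  simp only [norm_toLp_sq, Pi.add_apply, Pi.sub_apply] at h
  linarith

section CauchySchwarz

variable {f g h : α → ℝ} (hf : MemLp f 2 m) (hg : MemLp g 2 m) (hh : MemLp h 2 m)

include hf hg hh

theorem integral_mul_sub :
    ∫ x, f x * (g x - h x) ∂m = ∫ x, f x * g x ∂m - ∫ x, f x * h x ∂m := by
  simp only [mul_sub]
  exact integral_sub (hf.integrable_mul hg) (hf.integrable_mul hh)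

theorem integral_mul_le_integral_mul_add :
    ∫ x, f x * h x ∂m ≤
      ∫ x, g x * h x ∂m + √(∫ x, (f x - g x) ^ 2 ∂m) * √(∫ x, h x ^ 2 ∂m) := by
  have hcs := (le_abs_self _).trans (abs_integral_mul_le (hf.sub hg) hh)
  have hsub := integral_mul_sub hh hf hg
  simp only [mul_comm (h _)] at hsub
  exact sub_le_iff_le_add'.1 (hsub ▸ hcs)

end CauchySchwarz

section Filter

variable {ι : Type*} {l : Filter ι} {f g : ι → α → ℝ} {f' g' : α → ℝ}

theorem tendsto_toLp_iff (hf : ∀ n, MemLp (f n) 2 m) (hf' : MemLp f' 2 m) :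
    Tendsto (fun n => (hf n).toLp (f n)) l (𝓝 (hf'.toLp f')) ↔
      Tendsto (fun n => ∫ x, (f n x - f' x) ^ 2 ∂m) l (𝓝 0) := by
  have h : ∀ n, ∫ x, (f n x - f' x) ^ 2 ∂m = ‖(hf n).toLp (f n) - hf'.toLp f'‖ ^ 2 := fun n => by
    rw [← MemLp.toLp_sub, norm_toLp_sq]
    rfl
  rw [tendsto_iff_norm_sub_tendsto_zero]
  simp only [h]
  refine ⟨fun h0 => by simpa using h0.pow 2, fun h0 => ?_⟩
  simpa [Real.sqrt_sq] using h0.sqrt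

variable (hf : ∀ n, MemLp (f n) 2 m) (hg : ∀ n, MemLp (g n) 2 m) (hf' : MemLp f' 2 m)
  (hg' : MemLp g' 2 m) (hff' : Tendsto (fun n => ∫ x, (f n x - f' x) ^ 2 ∂m) l (𝓝 0))
  (hgg' : Tendsto (fun n => ∫ x, (g n x - g' x) ^ 2 ∂m) l (𝓝 0))

include hf hg hf' hg' hff' hgg'

theorem tendsto_integral_mul :
    Tendsto (fun n => ∫ x, f n x * g n x ∂m) l (𝓝 (∫ x, f' x * g' x ∂m)) := by
  have h := Tendsto.inner (𝕜 := ℝ) ((tendsto_toLp_iff hf hf').2 hff')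
    ((tendsto_toLp_iff hg hg').2 hgg')
  simpa only [inner_toLp_eq_integral] using h

theorem tendsto_integral_sub_sub_sq :
    Tendsto (fun n => ∫ x, ((f n x - g n x) - (f' x - g' x)) ^ 2 ∂m) l (𝓝 0) :=
  (tendsto_toLp_iff (fun n => (hf n).sub (hg n)) (hf'.sub hg')).1
    (((tendsto_toLp_iff hf hf').2 hff').sub ((tendsto_toLp_iff hg hg').2 hgg'))

end Filter

theorem tendsto_integral_sq_sub_trans {ι : Type*} {l : Filter ι} {f g : ι → α → ℝ} {h : α → ℝ}
    (hf : ∀ n, MemLp (f n) 2 m) (hg : ∀ n, MemLp (g n) 2 m) (hh : MemLp h 2 m)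
    (hfg : Tendsto (fun n => ∫ x, (f n x - g n x) ^ 2 ∂m) l (𝓝 0))
    (hgh : Tendsto (fun n => ∫ x, (g n x - h x) ^ 2 ∂m) l (𝓝 0)) :
    Tendsto (fun n => ∫ x, (f n x - h x) ^ 2 ∂m) l (𝓝 0) := by
  have h0 := tendsto_integral_sub_sub_sq (fun n => (hf n).sub (hg n)) (fun n => hh.sub (hg n))
    (MemLp.zero (ε := ℝ)) (MemLp.zero (ε := ℝ)) (by simpa using hfg)
    (hgh.congr fun n => by simp [sub_sq_comm (g n _)])
  simpa using h0

variable {f : ℕ → α → ℝ} {g : α → ℝ}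

theorem ofReal_integral_sq {f : α → ℝ} (hf : MemLp f 2 m) :
    ENNReal.ofReal (∫ x, f x ^ 2 ∂m) = ∫⁻ x, ENNReal.ofReal (f x ^ 2) ∂m :=
  ofReal_integral_eq_lintegral_ofReal hf.integrable_sq (.of_forall fun _ => sq_nonneg _)

theorem eventually_lt_integral_sq (hf : ∀ n, MemLp (f n) 2 m) (hg : MemLp g 2 m)
    (hae : ∀ᵐ x ∂m, Tendsto (fun n => f n x) atTop (𝓝 (g x))) {c : ℝ}
    (hc : c < ∫ x, g x ^ 2 ∂m) : ∀ᶠ n in atTop, c < ∫ x, f n x ^ 2 ∂m := by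
  rcases lt_or_ge c 0 with hc0 | hc0
  · exact .of_forall fun n => hc0.trans_le (integral_nonneg fun _ => sq_nonneg _)
  have hfatou : ∫⁻ x, ENNReal.ofReal (g x ^ 2) ∂m ≤
      liminf (fun n => ∫⁻ x, ENNReal.ofReal (f n x ^ 2) ∂m) atTop := by
    refine (lintegral_congr_ae ?_).trans_le
      (lintegral_liminf_le' fun n => (hf n).integrable_sq.1.aemeasurable.ennreal_ofReal)
    filter_upwards [hae] with x hx
    exact (ENNReal.tendsto_ofReal (hx.pow 2)).liminf_eq.symm
  simp only [← ofReal_integral_sq, hg, hf] at hfatou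
  filter_upwards [eventually_lt_of_lt_liminf
    (((ENNReal.ofReal_lt_ofReal_iff_of_nonneg hc0).2 hc).trans_le hfatou)] with n hn
  exact (ENNReal.ofReal_lt_ofReal_iff_of_nonneg hc0).1 hn

-- Radon–Riesz: the parallelogram law, with Fatou's lemma for `f n + g`.
theorem tendsto_integral_sq_sub_zero (hf : ∀ n, MemLp (f n) 2 m) (hg : MemLp g 2 m)
    (hae : ∀ᵐ x ∂m, Tendsto (fun n => f n x) atTop (𝓝 (g x)))
    (hsq : Tendsto (fun n => ∫ x, f n x ^ 2 ∂m) atTop (𝓝 (∫ x, g x ^ 2 ∂m))) :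
    Tendsto (fun n => ∫ x, (f n x - g x) ^ 2 ∂m) atTop (𝓝 0) := by
  have hdouble : ∫ x, (g x + g x) ^ 2 ∂m = 4 * ∫ x, g x ^ 2 ∂m := by
    rw [← integral_const_mul]
    exact integral_congr_ae (.of_forall fun x => by ring)
  refine tendsto_order.2 ⟨fun a ha => ?_, fun b hb => ?_⟩
  · exact .of_forall fun n => ha.trans_le (integral_nonneg fun _ => sq_nonneg _)
  · have hsum : ∀ᶠ n in atTop, 4 * (∫ x, g x ^ 2 ∂m) - b / 2 < ∫ x, (f n x + g x) ^ 2 ∂m :=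
      eventually_lt_integral_sq (fun n => (hf n).add hg) (hg.add hg)
        (hae.mono fun x hx => hx.add_const _) (by simp only [Pi.add_apply]; linarith)
    have hlt : ∫ x, g x ^ 2 ∂m < (∫ x, g x ^ 2 ∂m) + b / 4 := by linarith
    filter_upwards [hsum, hsq.eventually (gt_mem_nhds hlt)] with n hn₁ hn₂
    rw [integral_sub_sq (hf n) hg]
    linarith

end L2Convergence

/-! ### Convergence of quantile functions in `L²` -/

section QuantileConvergence

variable {μ : Measure ℝ} [IsProbabilityMeasure μ] {f : ℕ → ℝ → ℝ}

section Portmanteau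

variable (hf : ∀ n, AEMeasurable (f n) unitMeasure)
  (hweak : ∀ φ : BoundedContinuousFunction ℝ ℝ,
    Tendsto (fun n => ∫ u, φ (f n u) ∂unitMeasure) atTop (𝓝 (∫ t, φ t ∂μ)))

include hf hweak

theorem tendsto_law_of_tendsto_integral :
    Tendsto (β := ProbabilityMeasure ℝ)
      (fun n => ⟨unitMeasure.map (f n), Measure.isProbabilityMeasure_map (hf n)⟩) atTop
      (𝓝 ⟨μ, inferInstance⟩) := by
  refine ProbabilityMeasure.tendsto_iff_forall_integral_tendsto.2 fun φ => ?_
  refine (hweak φ).congr fun n => ?_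
  exact (integral_map (hf n) φ.continuous.aestronglyMeasurable).symm

theorem eventually_unitMeasure_preimage_lt {s : Set ℝ} (hs : IsClosed s) {c : ENNReal}
    (hc : μ s < c) : ∀ᶠ n in atTop, unitMeasure (f n ⁻¹' s) < c := by
  filter_upwards [eventually_lt_of_limsup_lt
    ((ProbabilityMeasure.limsup_measure_closed_le_of_tendsto
      (tendsto_law_of_tendsto_integral hf hweak) hs).trans_lt hc)] with n hn
  rwa [ProbabilityMeasure.coe_mk, Measure.map_apply_of_aemeasurable (hf n) hs.measurableSet] at hn

theorem eventually_lt_unitMeasure_preimage {s : Set ℝ} (hs : IsOpen s) {c : ENNReal}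
    (hc : c < μ s) : ∀ᶠ n in atTop, c < unitMeasure (f n ⁻¹' s) := by
  filter_upwards [eventually_lt_of_lt_liminf (hc.trans_le
    (ProbabilityMeasure.le_liminf_measure_open_of_tendsto
      (tendsto_law_of_tendsto_integral hf hweak) hs))] with n hn
  rwa [ProbabilityMeasure.coe_mk, Measure.map_apply_of_aemeasurable (hf n) hs.measurableSet] at hn

end Portmanteau

variable (hmono : ∀ n, MonotoneOn (f n) (Ioo 0 1))
  (hweak : ∀ φ : BoundedContinuousFunction ℝ ℝ,
    Tendsto (fun n => ∫ u, φ (f n u) ∂unitMeasure) atTop (𝓝 (∫ t, φ t ∂μ)))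

include hmono hweak

theorem eventually_lt_of_lt_quantile {u : ℝ} (hu : u ∈ Ioo 0 1) {a : ℝ} (ha : a < quantile μ u) :
    ∀ᶠ n in atTop, a < f n u := by
  have hIic : μ (Iic a) < ENNReal.ofReal u := by
    rw [← ofReal_cdf]
    exact (ENNReal.ofReal_lt_ofReal_iff hu.1).2 ((lt_quantile_iff hu).1 ha)
  filter_upwards [eventually_unitMeasure_preimage_lt
    (fun n => aemeasurable_restrict_of_monotoneOn measurableSet_Ioo (hmono n)) hweak isClosed_Iic
    hIic] with n hn
  contrapose! hn
  rw [← unitMeasure_Iic hu.2.le]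
  refine measure_mono_ae ?_
  filter_upwards [ae_mem_Ioo_unitMeasure] with v hv hvu
  exact (hmono n hv hu hvu).trans hn

theorem eventually_lt_of_quantile_lt {u v : ℝ} (hu : u ∈ Ioo 0 1) (hv : v ∈ Ioo u 1) {b : ℝ}
    (hb : quantile μ v < b) : ∀ᶠ n in atTop, f n u < b := by
  have hIio : ENNReal.ofReal u < μ (Iio b) := by
    refine ((ENNReal.ofReal_lt_ofReal_iff (hu.1.trans hv.1)).2 hv.1).trans_le ?_
    refine le_trans ?_ (measure_mono (Iic_subset_Iio.2 hb))
    rw [← ofReal_cdf]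
    exact ENNReal.ofReal_le_ofReal (le_cdf_quantile ⟨hu.1.trans hv.1, hv.2⟩)
  filter_upwards [eventually_lt_unitMeasure_preimage
    (fun n => aemeasurable_restrict_of_monotoneOn measurableSet_Ioo (hmono n)) hweak isOpen_Iio
    hIio] with n hn
  contrapose! hn
  rw [← unitMeasure_Iic hu.2.le]
  refine measure_mono_ae ?_
  filter_upwards [ae_mem_Ioo_unitMeasure] with w hw hwb
  exact not_lt.1 fun hlt => hwb.not_ge (hn.trans (hmono n hu hw hlt.le))

theorem ae_tendsto_quantile :
    ∀ᵐ u ∂unitMeasure, Tendsto (fun n => f n u) atTop (𝓝 (quantile μ u)) := by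
  have hcount := (monotoneOn_quantile (μ := μ)).countable_not_continuousWithinAt
  filter_upwards [ae_mem_Ioo_unitMeasure,
    ae_restrict_of_ae (s := Ioo (0 : ℝ) 1) (hcount.ae_notMem volume)] with u hu hcont
  refine tendsto_order.2 ⟨fun a ha => eventually_lt_of_lt_quantile hmono hweak hu ha,
    fun b hb => ?_⟩
  have hcont : ContinuousWithinAt (quantile μ) (Ioo 0 1) u := by
    by_contra hn
    exact hcont ⟨hu, hn⟩
  have hnear := hcont.eventually (gt_mem_nhds hb)
  rw [isOpen_Ioo.nhdsWithin_eq hu] at hnear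
  obtain ⟨v, hvb, hv⟩ :=
    ((hnear.filter_mono nhdsWithin_le_nhds).and (Ioo_mem_nhdsGT hu.2)).exists
  exact eventually_lt_of_quantile_lt hmono hweak hu hv hvb

theorem tendsto_integral_sq_sub_quantile (hμ : MemLp id 2 μ)
    (hf : ∀ n, MemLp (f n) 2 unitMeasure)
    (hsq : Tendsto (fun n => ∫ u, f n u ^ 2 ∂unitMeasure) atTop (𝓝 (∫ t, t ^ 2 ∂μ))) :
    Tendsto (fun n => ∫ u, (f n u - quantile μ u) ^ 2 ∂unitMeasure) atTop (𝓝 0) := by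
  refine tendsto_integral_sq_sub_zero hf (memLp_quantile hμ) (ae_tendsto_quantile hmono hweak) ?_
  rwa [integral_comp_quantile (f := fun t : ℝ => t ^ 2) (continuous_pow 2).aestronglyMeasurable]

end QuantileConvergence

/-! ### Limits of shrinkage functions -/

theorem tendsto_integral_sq_shrinkage {α : Type*} [MeasurableSpace α] {m : Measure α}
    {η : ℕ → ℝ → ℝ} {η' : ℝ → ℝ} (hη : ∀ n, IsShrinkage (η n)) (hη' : IsShrinkage η')
    (hlim : ∀ y, Tendsto (fun n => η n y) atTop (𝓝 (η' y))) {f : ℕ → α → ℝ} {f' : α → ℝ}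
    (hf : ∀ n, MemLp (f n) 2 m) (hf' : MemLp f' 2 m)
    (h : Tendsto (fun n => ∫ x, (f n x - f' x) ^ 2 ∂m) atTop (𝓝 0)) :
    Tendsto (fun n => ∫ x, (η n (f n x) - η' (f' x)) ^ 2 ∂m) atTop (𝓝 0) := by
  have hηf : ∀ n, MemLp (fun x => η n (f n x)) 2 m := fun n => (hη n).memLp_comp (hf n)
  have hηf' : ∀ n, MemLp (fun x => η n (f' x)) 2 m := fun n => (hη n).memLp_comp hf'
  have hη'f' : MemLp (fun x => η' (f' x)) 2 m := hη'.memLp_comp hf'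
  refine tendsto_integral_sq_sub_trans hηf hηf' hη'f' ?_ ?_
  · refine squeeze_zero (fun n => integral_nonneg fun _ => sq_nonneg _) (fun n => ?_) h
    exact integral_mono ((hηf n).sub (hηf' n)).integrable_sq ((hf n).sub hf').integrable_sq
      fun x => sq_le_sq.2 ((hη n).abs_sub_le _ _)
  · have hdom := tendsto_integral_of_dominated_convergence (μ := m)
      (F := fun n x => (η n (f' x) - η' (f' x)) ^ 2) (f := fun _ => 0) (fun x => (2 * f' x) ^ 2)
      (fun n => ((hηf' n).sub hη'f').integrable_sq.1) (hf'.const_mul 2).integrable_sq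
      (fun n => .of_forall fun x => ?_) (.of_forall fun x => ?_)
    · simpa using hdom
    · rw [Real.norm_eq_abs, abs_of_nonneg (sq_nonneg _), sq_le_sq, abs_mul, abs_two]
      linarith [abs_sub (η n (f' x)) (η' (f' x)), (hη n).abs_le (f' x), hη'.abs_le (f' x)]
    · simpa using ((hlim (f' x)).sub_const (η' (f' x))).pow 2

theorem IsShrinkage.memLp_residual {η : ℝ → ℝ} (h : IsShrinkage η) {α : Type*} [MeasurableSpace α]
    {m : Measure α} {f g : α → ℝ} {p : ENNReal} (hf : MemLp f p m) (hg : MemLp g p m) :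
    MemLp (fun x => f x - η (f x) - g x) p m :=
  (hf.sub (h.memLp_comp hf)).sub hg

theorem tendsto_integral_sq_residual {α : Type*} [MeasurableSpace α] {m : Measure α}
    {η : ℕ → ℝ → ℝ} {η' : ℝ → ℝ} (hη : ∀ n, IsShrinkage (η n)) (hη' : IsShrinkage η')
    (hlim : ∀ y, Tendsto (fun n => η n y) atTop (𝓝 (η' y))) {f g : ℕ → α → ℝ} {f' g' : α → ℝ}
    (hf : ∀ n, MemLp (f n) 2 m) (hf' : MemLp f' 2 m) (hg : ∀ n, MemLp (g n) 2 m)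
    (hg' : MemLp g' 2 m) (hff' : Tendsto (fun n => ∫ x, (f n x - f' x) ^ 2 ∂m) atTop (𝓝 0))
    (hgg' : Tendsto (fun n => ∫ x, (g n x - g' x) ^ 2 ∂m) atTop (𝓝 0)) :
    Tendsto (fun n => ∫ x, (f n x - η n (f n x) - g n x - (f' x - η' (f' x) - g' x)) ^ 2 ∂m)
      atTop (𝓝 0) :=
  have hηf : ∀ n, MemLp (fun x => η n (f n x)) 2 m := fun n => (hη n).memLp_comp (hf n)
  have hη'f' : MemLp (fun x => η' (f' x)) 2 m := hη'.memLp_comp hf'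
  tendsto_integral_sub_sub_sq (fun n => (hf n).sub (hηf n)) hg (hf'.sub hη'f') hg'
    (tendsto_integral_sub_sub_sq hf hηf hf' hη'f' hff'
      (tendsto_integral_sq_shrinkage hη hη' hlim hf hf' hff')) hgg'

theorem cauchySeq_of_lipschitzWith_of_dense {α β : Type*} [PseudoMetricSpace α]
    [PseudoMetricSpace β] {K : NNReal} {f : ℕ → α → β} (hf : ∀ n, LipschitzWith K (f n))
    {s : Set α} (hs : Dense s) (hcauchy : ∀ x ∈ s, CauchySeq fun n => f n x) (y : α) :
    CauchySeq fun n => f n y := by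
  refine Metric.cauchySeq_iff'.2 fun ε hε => ?_
  obtain ⟨x, hx, hxy⟩ := hs.exists_dist_lt y (show 0 < ε / (3 * (K + 1)) by positivity)
  have hK : K * dist y x ≤ ε / 3 := by
    rw [lt_div_iff₀ (by positivity)] at hxy
    linarith [dist_nonneg (x := y) (y := x)]
  obtain ⟨N, hN⟩ := Metric.cauchySeq_iff'.1 (hcauchy x hx) (ε / 3) (by linarith)
  refine ⟨N, fun n hn => (dist_triangle4 _ (f n x) (f N x) _).trans_lt ?_⟩
  have hleft := (hf n).dist_le_mul y x
  have hright := (hf N).dist_le_mul x y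
  rw [dist_comm x y] at hright
  linarith [hN n hn]

theorem isShrinkage_of_tendsto {ι : Type*} {l : Filter ι} [l.NeBot] {η : ι → ℝ → ℝ} {η' : ℝ → ℝ}
    (hη : ∀ n, IsShrinkage (η n)) (hlim : ∀ y, Tendsto (fun n => η n y) l (𝓝 (η' y))) :
    IsShrinkage η' := by
  refine ⟨fun t => tendsto_nhds_unique (hlim (-t)) ?_, fun x y hxy => ?_,
    LipschitzWith.of_dist_le_mul fun x y => ?_⟩
  · simpa only [(hη _).odd] using (hlim t).neg
  · exact le_of_tendsto_of_tendsto' (hlim x) (hlim y) fun n => (hη n).mono hxy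
  · exact le_of_tendsto' ((hlim x).dist (hlim y)) fun n => (hη n).lipschitz.dist_le_mul x y

theorem exists_tendsto_subseq_shrinkage {η : ℕ → ℝ → ℝ} (hη : ∀ n, IsShrinkage (η n)) :
    ∃ η' : ℝ → ℝ, IsShrinkage η' ∧ ∃ k : ℕ → ℕ, StrictMono k ∧
      ∀ y, Tendsto (fun n => η (k n) y) atTop (𝓝 (η' y)) := by
  have hK : IsCompact (Set.pi univ fun r : ℚ => Icc (-|(r : ℝ)|) |(r : ℝ)|) :=
    isCompact_univ_pi fun _ => isCompact_Icc
  obtain ⟨g, -, k, hk, hlim⟩ := hK.tendsto_subseq (x := fun n (r : ℚ) => η n r)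
    (fun n r _ => abs_le.1 ((hη n).abs_le r))
  rw [tendsto_pi_nhds] at hlim
  choose η' hη' using fun y => cauchySeq_tendsto_of_complete
    (cauchySeq_of_lipschitzWith_of_dense (fun n => (hη (k n)).lipschitz) Rat.denseRange_cast
      (forall_mem_range.2 fun r => (hlim r).cauchySeq) y)
  exact ⟨η', isShrinkage_of_tendsto (fun n => hη (k n)) hη', k, hk, hη'⟩

theorem tendsto_setIntegral_of_tendsto_integral_sq_sub {α : Type*} [MeasurableSpace α]
    {m : Measure α} [IsFiniteMeasure m] {ι : Type*} {l : Filter ι} {f : ι → α → ℝ} {f' : α → ℝ}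
    (hf : ∀ n, MemLp (f n) 2 m) (hf' : MemLp f' 2 m)
    (h : Tendsto (fun n => ∫ x, (f n x - f' x) ^ 2 ∂m) l (𝓝 0)) {s : Set α}
    (hs : MeasurableSet s) :
    Tendsto (fun n => ∫ x in s, f n x ∂m) l (𝓝 (∫ x in s, f' x ∂m)) := by
  have hone : MemLp (s.indicator fun _ => (1 : ℝ)) 2 m := (memLp_const 1).indicator hs
  have hmul := tendsto_integral_mul hf (fun _ => hone) hf' hone h
    (by simpa using tendsto_const_nhds)
  have hind : ∀ F : α → ℝ, ∫ x, F x * s.indicator (fun _ => (1 : ℝ)) x ∂m = ∫ x in s, F x ∂m := by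
    intro F
    rw [← integral_indicator hs]
    exact integral_congr_ae (.of_forall fun x => by by_cases hx : x ∈ s <;> simp [hx])
  simpa only [hind] using hmul

theorem isOptimalShrinkage_of_tendsto {ν μl : Measure ℝ} [IsProbabilityMeasure ν]
    [IsProbabilityMeasure μl] {ν' : ℕ → Measure ℝ} [∀ n, IsProbabilityMeasure (ν' n)]
    (hy : MemLp id 2 ν) (hy' : ∀ n, MemLp id 2 (ν' n)) (hl : MemLp id 2 μl) {η : ℕ → ℝ → ℝ}
    {η' : ℝ → ℝ} (hη : ∀ n, IsOptimalShrinkage (ν' n) μl (η n))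
    (hlim : ∀ y, Tendsto (fun n => η n y) atTop (𝓝 (η' y)))
    (hq : Tendsto (fun n => ∫ u, (quantile (ν' n) u - quantile ν u) ^ 2 ∂unitMeasure) atTop
      (𝓝 0)) :
    IsOptimalShrinkage ν μl η' := by
  have hη' : IsShrinkage η' := isShrinkage_of_tendsto (fun n => (hη n).toIsShrinkage) hlim
  have hqν' : ∀ n, MemLp (quantile (ν' n)) 2 unitMeasure := fun n => memLp_quantile (hy' n)
  have hqν : MemLp (quantile ν) 2 unitMeasure := memLp_quantile hy
  have hql : MemLp (quantile μl) 2 unitMeasure := memLp_quantile hl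
  have hres := tendsto_integral_sq_residual (fun n => (hη n).toIsShrinkage) hη' hlim hqν' hqν
    (fun _ => hql) hql hq (by simp)
  have hresν' := fun n => (hη n).memLp_residual (hqν' n) hql
  have hresν := hη'.memLp_residual hqν hql
  refine ⟨hη', fun a ha => ?_, ?_⟩
  · have hs : Ioo a 1 ⊆ Ioo (0 : ℝ) 1 := Ioo_subset_Ioo_left ha.1
    have htail := tendsto_setIntegral_of_tendsto_integral_sq_sub hresν' hresν hres
      (measurableSet_Ioo (a := a) (b := 1))
    simp only [setIntegral_unitMeasure measurableSet_Ioo hs] at htail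
    exact le_of_tendsto' htail fun n => (hη n).tail a ha
  · have hslack := tendsto_integral_mul hresν' (fun n => (hη n).memLp_comp (hqν' n)) hresν
      (hη'.memLp_comp hqν) hres
      (tendsto_integral_sq_shrinkage (fun n => (hη n).toIsShrinkage) hη' hlim hqν' hqν hq)
    exact tendsto_nhds_unique hslack (tendsto_const_nhds.congr fun n => (hη n).slack.symm)

/-! ### Existence of optimal shrinkage functions -/

/-- Rounding down to the grid of mesh `1 / (n + 1)` in `[0, n + 1]`. -/
noncomputable def gridFloor (n : ℕ) (y : ℝ) : ℝ :=
  (min ⌊y * ((n : ℝ) + 1)⌋₊ ((n + 1) * (n + 1)) : ℕ) / ((n : ℝ) + 1)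

theorem gridFloor_nonneg (n : ℕ) (y : ℝ) : 0 ≤ gridFloor n y := by
  unfold gridFloor
  positivity

theorem gridFloor_le (n : ℕ) {y : ℝ} (hy : 0 ≤ y) : gridFloor n y ≤ y := by
  have hn : (0 : ℝ) < (n : ℝ) + 1 := by positivity
  rw [gridFloor, div_le_iff₀ hn]
  refine le_trans ?_ (Nat.floor_le (mul_nonneg hy hn.le))
  exact_mod_cast min_le_left _ _

theorem measurable_gridFloor (n : ℕ) : Measurable (gridFloor n) :=
  (measurable_from_top.comp ((Nat.measurable_floor.comp (measurable_id.mul_const _)).min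
    measurable_const)).div_const _

theorem tendsto_gridFloor {y : ℝ} (hy : 0 ≤ y) :
    Tendsto (fun n => gridFloor n y) atTop (𝓝 y) := by
  have hatTop : Tendsto (fun n : ℕ => (n : ℝ) + 1) atTop atTop :=
    tendsto_atTop_add_const_right _ _ tendsto_natCast_atTop_atTop
  refine ((tendsto_nat_floor_mul_div_atTop hy).comp hatTop).congr' ?_
  filter_upwards [eventually_ge_atTop ⌈y⌉₊] with n hn
  have hyn : y ≤ n := Nat.ceil_le.1 hn
  simp only [Function.comp_apply, gridFloor]
  rw [min_eq_left]
  refine Nat.floor_le_of_le ?_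
  push_cast
  exact mul_le_mul_of_nonneg_right (by linarith) (by positivity)

theorem finite_range_gridFloor (n : ℕ) : (range (gridFloor n)).Finite := by
  refine ((finite_Iic ((n + 1) * (n + 1))).image fun i : ℕ => (i : ℝ) / ((n : ℝ) + 1)).subset ?_
  exact range_subset_iff.2 fun y => mem_image_of_mem _ (mem_Iic.2 (min_le_right _ _))

theorem hasFinitelyManyMDIs_of_finite {ν μl : Measure ℝ} [IsProbabilityMeasure ν]
    {A : Set ℝ} (hfin : A.Finite) (hA : ν Aᶜ = 0) :
    HasFinitelyManyMDIs ν (initialG ν μl) := by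
  refine ⟨hfin.toFinset, fun C _ hC hdis => Or.inl fun x hx y hy hxy => ?_⟩
  rw [hfin.coe_toFinset] at hdis
  have h0 : ν (Icc x y) = 0 :=
    measure_mono_null (fun z hz hzA => disjoint_left.1 hdis (hC.out hx hy hz) hzA) hA
  rw [initialG, initialG, lamFun_eq_of_measure_Icc_eq_zero h0 ⟨le_rfl, hxy⟩,
    lamFun_eq_of_measure_Icc_eq_zero h0 ⟨hxy, le_rfl⟩]
  linarith

theorem map_gridFloor_Iio_zero {ν : Measure ℝ} (n : ℕ) : ν.map (gridFloor n) (Iio 0) = 0 := by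
  rw [Measure.map_apply (measurable_gridFloor n) measurableSet_Iio]
  exact measure_mono_null (fun y hy => (gridFloor_nonneg n y).not_gt hy) measure_empty

theorem map_gridFloor_compl_range {ν : Measure ℝ} (n : ℕ) :
    ν.map (gridFloor n) (range (gridFloor n))ᶜ = 0 := by
  rw [Measure.map_apply (measurable_gridFloor n) (finite_range_gridFloor n).measurableSet.compl]
  exact measure_mono_null (fun y hy => hy (mem_range_self y)) measure_empty

theorem ae_abs_gridFloor_le {ν : Measure ℝ} (hν : ν (Iio 0) = 0) (n : ℕ) :
    ∀ᵐ y ∂ν, |gridFloor n y| ≤ |y| := by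
  filter_upwards [ae_mem_massRange hν] with y hy
  exact abs_le_abs_of_nonneg (gridFloor_nonneg n y) (gridFloor_le n hy.1)

theorem exists_isOptimalShrinkage_of_finite {ν μl : Measure ℝ} [IsProbabilityMeasure ν]
    [IsProbabilityMeasure μl] (hν : ν (Iio 0) = 0) (hy : MemLp id 2 ν) (hl : MemLp id 2 μl)
    (hl0 : μl (Iio 0) = 0) {A : Set ℝ} (hfin : A.Finite) (hA : ν Aᶜ = 0) :
    ∃ η, IsOptimalShrinkage ν μl η := by
  obtain ⟨G, hr, hG⟩ := exists_poolOutput hν (isPoolStart_initialG hν hy hl hl0)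
    (hasFinitelyManyMDIs_of_finite hfin hA)
  exact ⟨_, isOptimalShrinkage_scalarOfG hν hy hl hl0 hr hG⟩

instance isProbabilityMeasure_map_gridFloor {ν : Measure ℝ} [IsProbabilityMeasure ν] (n : ℕ) :
    IsProbabilityMeasure (ν.map (gridFloor n)) :=
  Measure.isProbabilityMeasure_map (measurable_gridFloor n).aemeasurable

theorem memLp_gridFloor {ν : Measure ℝ} (hν : ν (Iio 0) = 0) (hy : MemLp id 2 ν) (n : ℕ) :
    MemLp (gridFloor n) 2 ν :=
  hy.mono (measurable_gridFloor n).aestronglyMeasurable (ae_abs_gridFloor_le hν n)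

theorem memLp_id_map_gridFloor {ν : Measure ℝ} (hν : ν (Iio 0) = 0) (hy : MemLp id 2 ν) (n : ℕ) :
    MemLp id 2 (ν.map (gridFloor n)) :=
  (memLp_map_measure_iff aestronglyMeasurable_id (measurable_gridFloor n).aemeasurable).2
    (memLp_gridFloor hν hy n)

section Gridded

variable {ν : Measure ℝ} [IsProbabilityMeasure ν] (hν : ν (Iio 0) = 0) (hy : MemLp id 2 ν)

include hν hy

theorem tendsto_quantile_map_gridFloor :
    Tendsto (fun n => ∫ u, (quantile (ν.map (gridFloor n)) u - quantile ν u) ^ 2 ∂unitMeasure)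
      atTop (𝓝 0) := by
  have hcomp : ∀ {g : ℝ → ℝ}, Continuous g → ∀ n,
      ∫ u, g (quantile (ν.map (gridFloor n)) u) ∂unitMeasure = ∫ y, g (gridFloor n y) ∂ν := by
    intro g hg n
    rw [integral_comp_quantile hg.aestronglyMeasurable,
      integral_map (measurable_gridFloor n).aemeasurable hg.aestronglyMeasurable]
  have hlim : ∀ {g : ℝ → ℝ}, Continuous g →
      ∀ᵐ y ∂ν, Tendsto (fun n => g (gridFloor n y)) atTop (𝓝 (g y)) := fun hg =>
    (ae_mem_massRange hν).mono fun y hy => (hg.tendsto y).comp (tendsto_gridFloor hy.1)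
  have hmeas : ∀ {g : ℝ → ℝ}, Continuous g → ∀ n,
      AEStronglyMeasurable (fun y => g (gridFloor n y)) ν := fun hg n =>
    (hg.measurable.comp (measurable_gridFloor n)).aestronglyMeasurable
  refine tendsto_integral_sq_sub_quantile (fun n => monotoneOn_quantile) (fun φ => ?_) hy
    (fun n => memLp_quantile (memLp_id_map_gridFloor hν hy n)) ?_
  · simp only [hcomp φ.continuous]
    exact tendsto_integral_of_dominated_convergence (fun _ => ‖φ‖) (hmeas φ.continuous)
      (integrable_const _) (fun n => .of_forall fun y => φ.norm_coe_le_norm _)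
      (hlim φ.continuous)
  · simp only [hcomp (continuous_pow 2)]
    refine tendsto_integral_of_dominated_convergence (fun y => y ^ 2) (hmeas (continuous_pow 2))
      hy.integrable_sq (fun n => ?_) (hlim (continuous_pow 2))
    filter_upwards [ae_abs_gridFloor_le hν n] with y hle
    rw [Real.norm_eq_abs, abs_of_nonneg (sq_nonneg _)]
    exact sq_le_sq.2 hle

-- The procedure need not stop for `ν`, but it does for the gridded laws, which approximate `ν`.
theorem exists_isOptimalShrinkage {μl : Measure ℝ} [IsProbabilityMeasure μl] (hl : MemLp id 2 μl)
    (hl0 : μl (Iio 0) = 0) : ∃ η, IsOptimalShrinkage ν μl η := by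
  choose η hη using fun n => exists_isOptimalShrinkage_of_finite (map_gridFloor_Iio_zero n)
    (memLp_id_map_gridFloor hν hy n) hl hl0 (finite_range_gridFloor n)
    (map_gridFloor_compl_range n)
  obtain ⟨η', -, k, hk, hlim⟩ := exists_tendsto_subseq_shrinkage fun n => (hη n).toIsShrinkage
  exact ⟨η', isOptimalShrinkage_of_tendsto hy (fun n => memLp_id_map_gridFloor hν hy (k n)) hl
    (fun n => hη (k n)) hlim
    ((tendsto_quantile_map_gridFloor hν hy).comp hk.tendsto_atTop)⟩

end Gridded

/-! ### Vectors as step functions on the unit interval -/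

/-- The step function on `(0, 1)` that takes the value `a i` on `[i / p, (i + 1) / p)`; for a
non-decreasing vector `a`, it is the quantile function of the empirical law of its coordinates. -/
noncomputable def stepFun {p : ℕ} (a : Fin p → ℝ) (u : ℝ) : ℝ :=
  if h : ⌊(p : ℝ) * u⌋₊ < p then a ⟨⌊(p : ℝ) * u⌋₊, h⟩ else 0

section StepFun

variable {p : ℕ}

theorem floor_mul_lt (hp : 0 < p) {u : ℝ} (hu : u ∈ Ioo (0 : ℝ) 1) : ⌊(p : ℝ) * u⌋₊ < p := by
  have hp' : (0 : ℝ) < p := Nat.cast_pos.2 hp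
  rw [Nat.floor_lt (mul_nonneg hp'.le hu.1.le)]
  exact mul_lt_of_lt_one_right hp' hu.2

theorem stepFun_apply (hp : 0 < p) (a : Fin p → ℝ) {u : ℝ} (hu : u ∈ Ioo (0 : ℝ) 1) :
    stepFun a u = a ⟨⌊(p : ℝ) * u⌋₊, floor_mul_lt hp hu⟩ :=
  dif_pos _

theorem stepFun_of_eq_zero (hp : p = 0) (a : Fin p → ℝ) (u : ℝ) : stepFun a u = 0 := by
  subst hp
  exact dif_neg (Nat.not_lt_zero _)

theorem monotoneOn_stepFun {a : Fin p → ℝ} (ha : Monotone a) :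
    MonotoneOn (stepFun a) (Ioo 0 1) := by
  intro u hu v hv huv
  rcases p.eq_zero_or_pos with hp | hp
  · rw [stepFun_of_eq_zero hp, stepFun_of_eq_zero hp]
  · rw [stepFun_apply hp a hu, stepFun_apply hp a hv]
    exact ha (Nat.floor_le_floor (mul_le_mul_of_nonneg_left huv (Nat.cast_nonneg p)))

theorem stepFun_ae_eq_sum (hp : 0 < p) (a : Fin p → ℝ) :
    stepFun a =ᵐ[unitMeasure] fun u => ∑ i : Fin p,
      (Ico ((i : ℝ) / p) (((i : ℝ) + 1) / p)).indicator (fun _ => a i) u := by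
  have hp' : (0 : ℝ) < p := Nat.cast_pos.2 hp
  filter_upwards [ae_mem_Ioo_unitMeasure] with u hu
  have hpu : 0 ≤ (p : ℝ) * u := mul_nonneg hp'.le hu.1.le
  have hiff : ∀ i : Fin p, u ∈ Ico ((i : ℝ) / p) (((i : ℝ) + 1) / p) ↔
      ⟨⌊(p : ℝ) * u⌋₊, floor_mul_lt hp hu⟩ = i := by
    intro i
    rw [mem_Ico, div_le_iff₀ hp', lt_div_iff₀ hp', Fin.ext_iff, Nat.floor_eq_iff hpu, mul_comm u]
  rw [stepFun_apply hp a hu, Finset.sum_eq_single ⟨⌊(p : ℝ) * u⌋₊, floor_mul_lt hp hu⟩]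
  · rw [indicator_of_mem ((hiff _).2 rfl)]
  · intro i _ hi
    rw [indicator_of_notMem fun h => hi ((hiff i).1 h).symm]
  · intro h
    exact absurd (Finset.mem_univ _) h

theorem memLp_stepFun (a : Fin p → ℝ) : MemLp (stepFun a) 2 unitMeasure := by
  rcases p.eq_zero_or_pos with hp | hp
  · have : stepFun a = fun _ => (0 : ℝ) := funext fun u => stepFun_of_eq_zero hp a u
    rw [this]
    exact memLp_const 0
  · refine MemLp.ae_eq (stepFun_ae_eq_sum hp a).symm ?_
    exact memLp_finsetSum _ fun i _ => (memLp_const (a i)).indicator measurableSet_Ico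

theorem integral_stepFun (a : Fin p → ℝ) : ∫ u, stepFun a u ∂unitMeasure = (∑ i, a i) / p := by
  rcases p.eq_zero_or_pos with hp | hp
  · simp only [stepFun_of_eq_zero hp, integral_zero, hp, Nat.cast_zero, div_zero]
  · have hp' : (0 : ℝ) < p := Nat.cast_pos.2 hp
    rw [integral_congr_ae (stepFun_ae_eq_sum hp a), integral_finsetSum _ fun i _ =>
      (integrable_const (a i)).indicator measurableSet_Ico, Finset.sum_div]
    refine Finset.sum_congr rfl fun i _ => ?_
    have hsub : Ico ((i : ℝ) / p) (((i : ℝ) + 1) / p) ⊆ Ico 0 1 := by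
      refine Ico_subset_Ico (by positivity) ?_
      rw [div_le_one hp']
      exact_mod_cast i.2
    have hvol : unitMeasure.real (Ico ((i : ℝ) / p) (((i : ℝ) + 1) / p)) = 1 / p := by
      rw [measureReal_def, unitMeasure, Measure.restrict_congr_set Ioo_ae_eq_Ico,
        Measure.restrict_apply measurableSet_Ico, inter_eq_left.2 hsub, Real.volume_Ico,
        ← sub_div, add_sub_cancel_left, ENNReal.toReal_ofReal (by positivity)]
    rw [integral_indicator measurableSet_Ico, setIntegral_const, hvol, smul_eq_mul]
    ring

theorem integral_eq_sum_of_stepFun (hp : 0 < p) {F : ℝ → ℝ} {b : Fin p → ℝ}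
    (h : ∀ u (hu : u ∈ Ioo (0 : ℝ) 1), F u = b ⟨⌊(p : ℝ) * u⌋₊, floor_mul_lt hp hu⟩) :
    ∫ u, F u ∂unitMeasure = (∑ i, b i) / p := by
  rw [← integral_stepFun]
  refine integral_congr_ae ?_
  filter_upwards [ae_mem_Ioo_unitMeasure] with u hu
  rw [h u hu, stepFun_apply hp b hu]

theorem exists_stepFun_eq_sum_indicator_Ici (hp : 0 < p) {x : Fin p → ℝ} (hx : Monotone x)
    (hx0 : ∀ i, 0 ≤ x i) : ∃ c : ℕ → ℝ, (∀ j < p, 0 ≤ c j) ∧ ∀ u ∈ Ioo (0 : ℝ) 1,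
      stepFun x u = ∑ j ∈ Finset.range p, (Ici ((j : ℝ) / p)).indicator (fun _ => c j) u := by
  have hp' : (0 : ℝ) < p := Nat.cast_pos.2 hp
  obtain ⟨X, hX0, hX⟩ : ∃ X : ℕ → ℝ, X 0 = 0 ∧ ∀ j (hj : j < p), X (j + 1) = x ⟨j, hj⟩ :=
    ⟨fun | 0 => 0 | j + 1 => if h : j < p then x ⟨j, h⟩ else 0, rfl, fun j hj => dif_pos hj⟩
  refine ⟨fun j => X (j + 1) - X j, fun j hj => ?_, fun u hu => ?_⟩
  · cases j with
    | zero => simpa only [hX 0 hj, hX0, sub_zero] using hx0 _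
    | succ j =>
      beta_reduce
      rw [hX _ hj, hX j (Nat.lt_of_succ_lt hj), sub_nonneg]
      exact hx (Fin.mk_le_mk.2 j.le_succ)
  · have hlt := floor_mul_lt hp hu
    have hmem : ∀ j : ℕ, u ∈ Ici ((j : ℝ) / p) ↔ j ∈ Finset.range (⌊(p : ℝ) * u⌋₊ + 1) := by
      intro j
      rw [mem_Ici, div_le_iff₀ hp', mul_comm, Finset.mem_range, Nat.lt_succ_iff,
        Nat.le_floor_iff (mul_nonneg hp'.le hu.1.le)]
    calc stepFun x u = X (⌊(p : ℝ) * u⌋₊ + 1) - X 0 := by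
          rw [stepFun_apply hp x hu, hX _ hlt, hX0, sub_zero]
      _ = ∑ j ∈ Finset.range (⌊(p : ℝ) * u⌋₊ + 1), (X (j + 1) - X j) :=
          (Finset.sum_range_sub X _).symm
      _ = ∑ j ∈ Finset.range (⌊(p : ℝ) * u⌋₊ + 1),
            (Ici ((j : ℝ) / p)).indicator (fun _ => X (j + 1) - X j) u :=
          Finset.sum_congr rfl fun j hj =>
            (indicator_of_mem ((hmem j).2 hj) fun _ => X (j + 1) - X j).symm
      _ = _ := Finset.sum_subset (Finset.range_subset_range.2 hlt) fun j _ hj =>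
          indicator_of_notMem (fun h => hj ((hmem j).1 h)) _

theorem integral_indicator_Ici_unitMeasure {a : ℝ} (ha : 0 ≤ a) (F : ℝ → ℝ) :
    ∫ u, (Ici a).indicator F u ∂unitMeasure = ∫ u in Ioo a 1, F u := by
  rw [integral_indicator measurableSet_Ici, unitMeasure, setIntegral_congr_set Ioi_ae_eq_Ici.symm,
    Measure.restrict_restrict measurableSet_Ioi, ← Ioi_inter_Iio, ← Ioi_inter_Iio, ← inter_assoc,
    inter_eq_left.2 (Ioi_subset_Ioi ha)]

theorem integral_mul_stepFun_nonpos (hp : 0 < p) {F : ℝ → ℝ} (hF : Integrable F unitMeasure)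
    (htail : ∀ a ∈ Icc (0 : ℝ) 1, ∫ u in Ioo a 1, F u ≤ 0) {x : Fin p → ℝ} (hx : Monotone x)
    (hx0 : ∀ i, 0 ≤ x i) : ∫ u, F u * stepFun x u ∂unitMeasure ≤ 0 := by
  obtain ⟨c, hc, hsum⟩ := exists_stepFun_eq_sum_indicator_Ici hp hx hx0
  have hae : (fun u => F u * stepFun x u) =ᵐ[unitMeasure]
      fun u => ∑ j ∈ Finset.range p, c j * (Ici ((j : ℝ) / p)).indicator F u := by
    filter_upwards [ae_mem_Ioo_unitMeasure] with u hu
    rw [hsum u hu, Finset.mul_sum]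
    exact Finset.sum_congr rfl fun j _ => by
      by_cases hj : u ∈ Ici ((j : ℝ) / p) <;> simp [hj, mul_comm]
  rw [integral_congr_ae hae,
    integral_finsetSum _ fun j _ => (hF.indicator measurableSet_Ici).const_mul _]
  refine Finset.sum_nonpos fun j hj => ?_
  have hjp : j < p := Finset.mem_range.1 hj
  have hj0 : 0 ≤ (j : ℝ) / p := by positivity
  rw [integral_const_mul, integral_indicator_Ici_unitMeasure hj0]
  exact mul_nonpos_of_nonneg_of_nonpos (hc j hjp)
    (htail _ ⟨hj0, div_le_one_of_le₀ (Nat.cast_le.2 hjp.le) (Nat.cast_nonneg p)⟩)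

end StepFun

/-! ### Order statistics and the objective -/

section OrderStat

variable {p : ℕ}

theorem monotone_orderStat (a : Fin p → ℝ) : Monotone (orderStat a) := Tuple.monotone_sort a

theorem sum_comp_orderStat (a : Fin p → ℝ) (φ : ℝ → ℝ) :
    ∑ i, φ (orderStat a i) = ∑ i, φ (a i) :=
  Equiv.sum_comp (Tuple.sort a) fun i => φ (a i)

theorem orderStat_comp {φ : ℝ → ℝ} (hφ : Monotone φ) (a : Fin p → ℝ) (i : Fin p) :
    orderStat (fun j => φ (a j)) i = φ (orderStat a i) := by
  have h : (fun j => φ (a j)) ∘ Tuple.sort a =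
      (fun j => φ (a j)) ∘ Tuple.sort (fun j => φ (a j)) :=
    Tuple.comp_sort_eq_comp_iff_monotone.2 (hφ.comp (Tuple.monotone_sort a))
  exact (congrFun h i).symm

theorem sum_mul_comp_perm_le_sum_mul_orderStat {a : Fin p → ℝ} (ha : Monotone a) (b : Fin p → ℝ)
    (σ : Equiv.Perm (Fin p)) : ∑ i, a i * b (σ i) ≤ ∑ i, a i * orderStat b i := by
  have h := (ha.monovary (monotone_orderStat b)).sum_mul_comp_perm_le_sum_mul
    (σ := σ.trans (Tuple.sort b).symm)
  simpa only [orderStat, Function.comp_apply, Equiv.trans_apply, Equiv.apply_symm_apply] using h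

theorem sum_mul_le_sum_orderStat_mul (a b : Fin p → ℝ) :
    ∑ i, a i * b i ≤ ∑ i, orderStat a i * orderStat b i :=
  calc ∑ i, a i * b i = ∑ i, orderStat a i * b (Tuple.sort a i) :=
        (Equiv.sum_comp (Tuple.sort a) fun i => a i * b i).symm
    _ ≤ _ := sum_mul_comp_perm_le_sum_mul_orderStat (monotone_orderStat a) b _

theorem orderStat_abs_nonneg (x : Fin p → ℝ) (i : Fin p) : 0 ≤ orderStat (fun j => |x j|) i :=
  abs_nonneg _

/-- The sorted `ℓ₁` penalty, the smallest weight being paired with the smallest coordinate. -/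
noncomputable def sortedL1 (lam x : Fin p → ℝ) : ℝ := ∑ i, lam i * orderStat (fun j => |x j|) i

theorem slopeObjective_eq (lam y x : Fin p → ℝ) :
    slopeObjective lam y x = (1 / 2) * ∑ i, (y i - x i) ^ 2 + sortedL1 lam x := rfl

theorem sortedL1_nonneg {lam : Fin p → ℝ} (h : ∀ i, 0 ≤ lam i) (x : Fin p → ℝ) :
    0 ≤ sortedL1 lam x :=
  Finset.sum_nonneg fun i _ => mul_nonneg (h i) (orderStat_abs_nonneg x i)

section Prox

variable {lam : Fin p → ℝ} (hlam : Monotone lam)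

include hlam

theorem sortedL1_eq_sup (x : Fin p → ℝ) :
    sortedL1 lam x = Finset.univ.sup' Finset.univ_nonempty
      fun σ : Equiv.Perm (Fin p) => ∑ i, lam i * |x (σ i)| :=
  le_antisymm
    (Finset.le_sup' (fun σ : Equiv.Perm (Fin p) => ∑ i, lam i * |x (σ i)|)
      (Finset.mem_univ (Tuple.sort fun j => |x j|)))
    (Finset.sup'_le _ _ fun σ _ => sum_mul_comp_perm_le_sum_mul_orderStat hlam (fun j => |x j|) σ)

theorem continuous_sortedL1 : Continuous (sortedL1 lam) := by
  rw [funext (sortedL1_eq_sup hlam)]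
  exact Continuous.finset_sup'_apply _ fun σ _ => by fun_prop

variable (h0 : ∀ i, 0 ≤ lam i)

include h0

theorem exists_slopeObjective_le (y : Fin p → ℝ) :
    ∃ x, ∀ z, slopeObjective lam y x ≤ slopeObjective lam y z := by
  have hcont : Continuous (slopeObjective lam y) := by
    have hquad : Continuous fun x : Fin p → ℝ => (1 / 2) * ∑ i, (y i - x i) ^ 2 := by fun_prop
    exact hquad.add (continuous_sortedL1 hlam)
  refine hcont.exists_forall_le' y ?_
  set C := sortedL1 lam y with hC
  have hC0 : 0 ≤ C := sortedL1_nonneg h0 y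
  have hcompact : IsCompact (Set.pi univ fun i => Icc (y i - (2 * C + 1)) (y i + (2 * C + 1))) :=
    isCompact_univ_pi fun _ => isCompact_Icc
  filter_upwards [hcompact.compl_mem_cocompact] with x hx
  obtain ⟨i, hi⟩ : ∃ i, x i ∉ Icc (y i - (2 * C + 1)) (y i + (2 * C + 1)) := by
    by_contra! hall
    exact hx fun i _ => hall i
  have hfar : 2 * C + 1 ≤ |y i - x i| := by
    by_contra! hlt
    exact hi ⟨by linarith [(abs_lt.1 hlt).2], by linarith [(abs_lt.1 hlt).1]⟩
  have hcoord : (y i - x i) ^ 2 ≤ ∑ i, (y i - x i) ^ 2 :=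
    Finset.single_le_sum (f := fun i => (y i - x i) ^ 2) (fun _ _ => sq_nonneg _)
      (Finset.mem_univ i)
  calc slopeObjective lam y y = C := by simp [slopeObjective_eq, hC]
    _ ≤ (1 / 2) * (2 * C + 1) ^ 2 := by nlinarith
    _ ≤ (1 / 2) * (y i - x i) ^ 2 := by
        rw [← sq_abs (y i - x i)]
        gcongr
    _ ≤ slopeObjective lam y x := by
        rw [slopeObjective_eq]
        linarith [sortedL1_nonneg h0 x]

theorem slopeObjective_slopeProx_le (y z : Fin p → ℝ) :
    slopeObjective lam y (slopeProx lam y) ≤ slopeObjective lam y z :=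
  Classical.epsilon_spec (exists_slopeObjective_le hlam h0 y) z

theorem sum_sq_slopeProx_le (y : Fin p → ℝ) :
    ∑ i, slopeProx lam y i ^ 2 ≤ 4 * ∑ i, y i ^ 2 := by
  have hzero : sortedL1 lam 0 = 0 := by simp [sortedL1, orderStat]
  have hmin := slopeObjective_slopeProx_le hlam h0 y 0
  simp only [slopeObjective_eq, hzero, Pi.zero_apply, sub_zero] at hmin
  have hpar : ∑ i, slopeProx lam y i ^ 2 ≤
      ∑ i, (2 * (y i - slopeProx lam y i) ^ 2 + 2 * y i ^ 2) :=
    Finset.sum_le_sum fun i _ => by nlinarith [sq_nonneg (2 * y i - slopeProx lam y i)]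
  rw [Finset.sum_add_distrib, ← Finset.mul_sum, ← Finset.mul_sum] at hpar
  linarith [sortedL1_nonneg h0 (slopeProx lam y)]

theorem sum_sq_slopeProx_sub_le (y z : Fin p → ℝ) :
    (1 / 2) * ∑ i, (slopeProx lam y i - z i) ^ 2 ≤
      (sortedL1 lam z - ∑ i, (y i - z i) * z i) +
        (∑ i, (y i - z i) * slopeProx lam y i - sortedL1 lam (slopeProx lam y)) := by
  have hmin := slopeObjective_slopeProx_le hlam h0 y z
  rw [slopeObjective_eq, slopeObjective_eq] at hmin
  have hexpand : ∑ i, (y i - slopeProx lam y i) ^ 2 = ∑ i, (y i - z i) ^ 2 +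
      2 * ∑ i, (y i - z i) * z i - 2 * ∑ i, (y i - z i) * slopeProx lam y i +
        ∑ i, (slopeProx lam y i - z i) ^ 2 := by
    rw [Finset.mul_sum, Finset.mul_sum, ← Finset.sum_add_distrib, ← Finset.sum_sub_distrib,
      ← Finset.sum_add_distrib]
    exact Finset.sum_congr rfl fun i _ => by ring
  linarith

end Prox

end OrderStat

/-! ### Comparison of the proximal point with a shrinkage -/

namespace IsShrinkage

variable {η : ℝ → ℝ}

theorem abs_apply (h : IsShrinkage η) (x : ℝ) : |η x| = η |x| := by
  rcases le_total 0 x with hx | hx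
  · rw [abs_of_nonneg hx, abs_of_nonneg (h.nonneg hx)]
  · have hneg := h.nonneg (neg_nonneg.2 hx)
    rw [abs_of_nonpos hx, h.odd] at *
    rw [abs_of_nonpos (by linarith)]

theorem abs_sub_apply (h : IsShrinkage η) (x : ℝ) : |x - η x| = |x| - η |x| := by
  rcases le_total 0 x with hx | hx
  · rw [abs_of_nonneg hx, abs_of_nonneg (sub_nonneg.2 (h.le_self hx))]
  · have hneg := h.le_self (neg_nonneg.2 hx)
    rw [h.odd] at hneg
    rw [abs_of_nonpos hx, h.odd, abs_of_nonpos (by linarith)]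
    ring

theorem sub_mul_apply (h : IsShrinkage η) (x : ℝ) : (x - η x) * η x = (|x| - η |x|) * η |x| := by
  rcases le_total 0 x with hx | hx
  · rw [abs_of_nonneg hx]
  · rw [abs_of_nonpos hx, h.odd]
    ring

variable {p : ℕ}

theorem sortedL1_comp (h : IsShrinkage η) (lam y : Fin p → ℝ) :
    sortedL1 lam (fun i => η (y i)) = ∑ i, lam i * η (orderStat (fun j => |y j|) i) := by
  simp only [sortedL1, h.abs_apply, orderStat_comp h.mono]

theorem sum_sub_mul_comp (h : IsShrinkage η) (y : Fin p → ℝ) :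
    ∑ i, (y i - η (y i)) * η (y i) = ∑ i, (orderStat (fun j => |y j|) i -
      η (orderStat (fun j => |y j|) i)) * η (orderStat (fun j => |y j|) i) := by
  simp only [h.sub_mul_apply (y _)]
  exact (sum_comp_orderStat (fun j => |y j|) fun t => (t - η t) * η t).symm

theorem sum_sub_mul_le (h : IsShrinkage η) (y x : Fin p → ℝ) :
    ∑ i, (y i - η (y i)) * x i ≤ ∑ i, (orderStat (fun j => |y j|) i -
      η (orderStat (fun j => |y j|) i)) * orderStat (fun j => |x j|) i :=
  calc ∑ i, (y i - η (y i)) * x i ≤ ∑ i, (|y i| - η |y i|) * |x i| :=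
        Finset.sum_le_sum fun i _ => by
          rw [← h.abs_sub_apply, ← abs_mul]
          exact le_abs_self _
    _ ≤ ∑ i, orderStat (fun j => |y j| - η |y j|) i * orderStat (fun j => |x j|) i :=
        sum_mul_le_sum_orderStat_mul _ _
    _ = _ := by simp only [orderStat_comp (φ := fun t => t - η t) h.monotone_sub]

theorem sum_sq_slopeProx_sub_comp_le (h : IsShrinkage η) {lam : Fin p → ℝ} (hlam : Monotone lam)
    (h0 : ∀ i, 0 ≤ lam i) (y : Fin p → ℝ) :
    ∑ i, (slopeProx lam y i - η (y i)) ^ 2 ≤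
      2 * ∑ i, (orderStat (fun j => |y j|) i - η (orderStat (fun j => |y j|) i) - lam i) *
        (orderStat (fun j => |slopeProx lam y j|) i - η (orderStat (fun j => |y j|) i)) := by
  have hbase := sum_sq_slopeProx_sub_le hlam h0 y fun i => η (y i)
  rw [h.sortedL1_comp, h.sum_sub_mul_comp] at hbase
  have hdual := h.sum_sub_mul_le y (slopeProx lam y)
  have hexpand : ∀ Y X : Fin p → ℝ, ∑ i, (Y i - η (Y i) - lam i) * (X i - η (Y i)) =
      ∑ i, lam i * η (Y i) - ∑ i, (Y i - η (Y i)) * η (Y i) +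
        (∑ i, (Y i - η (Y i)) * X i - ∑ i, lam i * X i) := fun Y X => by
    simp only [← Finset.sum_sub_distrib, ← Finset.sum_add_distrib]
    exact Finset.sum_congr rfl fun i _ => by ring
  rw [hexpand]
  rw [sortedL1] at hbase
  linarith

end IsShrinkage

/-- The quantile function of the empirical law of the absolute values of the coordinates, as a
step function. -/
noncomputable def absStepFun {p : ℕ} (y : Fin p → ℝ) : ℝ → ℝ :=
  stepFun (orderStat fun j => |y j|)

theorem memLp_absStepFun {p : ℕ} (y : Fin p → ℝ) : MemLp (absStepFun y) 2 unitMeasure :=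
  memLp_stepFun _

theorem integral_sq_absStepFun_slopeProx_le {p : ℕ} (hp : 0 < p) {lam : Fin p → ℝ}
    (hlam : Monotone lam) (h0 : ∀ i, 0 ≤ lam i) (y : Fin p → ℝ) :
    ∫ u, absStepFun (slopeProx lam y) u ^ 2 ∂unitMeasure ≤ 4 * ((∑ i, y i ^ 2) / p) := by
  rw [integral_eq_sum_of_stepFun hp
    (b := fun i => orderStat (fun j => |slopeProx lam y j|) i ^ 2)
    fun u hu => by rw [absStepFun, stepFun_apply hp _ hu], ← mul_div_assoc,
    sum_comp_orderStat (fun j => |slopeProx lam y j|) fun t => t ^ 2]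
  simp only [sq_abs]
  gcongr
  exact sum_sq_slopeProx_le hlam h0 y

theorem IsShrinkage.sum_sq_slopeProx_sub_comp_div_le {η : ℝ → ℝ} (hη : IsShrinkage η) {p : ℕ}
    (hp : 0 < p) {lam : Fin p → ℝ} (hlam : Monotone lam) (h0 : ∀ i, 0 ≤ lam i) (y : Fin p → ℝ) :
    (∑ i, (slopeProx lam y i - η (y i)) ^ 2) / p ≤
      2 * (∫ u, (absStepFun y u - η (absStepFun y u) - stepFun lam u) *
          absStepFun (slopeProx lam y) u ∂unitMeasure -
        ∫ u, (absStepFun y u - η (absStepFun y u) - stepFun lam u) *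
          η (absStepFun y u) ∂unitMeasure) := by
  have hres := hη.memLp_residual (memLp_absStepFun y) (memLp_stepFun lam)
  have hsum : ∫ u, (absStepFun y u - η (absStepFun y u) - stepFun lam u) *
      (absStepFun (slopeProx lam y) u - η (absStepFun y u)) ∂unitMeasure =
      (∑ i, (orderStat (fun j => |y j|) i - η (orderStat (fun j => |y j|) i) - lam i) *
        (orderStat (fun j => |slopeProx lam y j|) i - η (orderStat (fun j => |y j|) i))) / p :=
    integral_eq_sum_of_stepFun hp fun u hu => by simp only [absStepFun, stepFun_apply hp _ hu]
  rw [← integral_mul_sub hres (memLp_absStepFun _) (hη.memLp_comp (memLp_absStepFun y)), hsum,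
    ← mul_div_assoc]
  exact div_le_div_of_nonneg_right (hη.sum_sq_slopeProx_sub_comp_le hlam h0 y)
    (Nat.cast_nonneg p)

theorem IsOptimalShrinkage.sum_sq_slopeProx_sub_comp_div_le {ν μl : Measure ℝ}
    [IsProbabilityMeasure ν] [IsProbabilityMeasure μl] {η : ℝ → ℝ}
    (hη : IsOptimalShrinkage ν μl η) (hy : MemLp id 2 ν) (hl : MemLp id 2 μl) {p : ℕ}
    (hp : 0 < p) {lam : Fin p → ℝ} (hlam : Monotone lam) (h0 : ∀ i, 0 ≤ lam i)
    (y : Fin p → ℝ) :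
    (∑ i, (slopeProx lam y i - η (y i)) ^ 2) / p ≤
      2 * (√(∫ u, (absStepFun y u - η (absStepFun y u) - stepFun lam u -
          (quantile ν u - η (quantile ν u) - quantile μl u)) ^ 2 ∂unitMeasure) *
        √(4 * ((∑ i, y i ^ 2) / p)) -
      ∫ u, (absStepFun y u - η (absStepFun y u) - stepFun lam u) *
        η (absStepFun y u) ∂unitMeasure) := by
  have hres' := hη.memLp_residual (memLp_quantile hy) (memLp_quantile hl)
  have hopt : ∫ u, (quantile ν u - η (quantile ν u) - quantile μl u) *
      absStepFun (slopeProx lam y) u ∂unitMeasure ≤ 0 :=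
    integral_mul_stepFun_nonpos hp (hres'.integrable one_le_two) hη.tail (monotone_orderStat _)
      (orderStat_abs_nonneg _)
  have hcs := integral_mul_le_integral_mul_add
    (hη.memLp_residual (memLp_absStepFun y) (memLp_stepFun lam)) hres'
    (memLp_absStepFun (slopeProx lam y))
  have hsqrt := mul_le_mul_of_nonneg_left
    (Real.sqrt_le_sqrt (integral_sq_absStepFun_slopeProx_le hp hlam h0 y))
    (Real.sqrt_nonneg (∫ u, (absStepFun y u - η (absStepFun y u) - stepFun lam u -
      (quantile ν u - η (quantile ν u) - quantile μl u)) ^ 2 ∂unitMeasure))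
  linarith [hη.toIsShrinkage.sum_sq_slopeProx_sub_comp_div_le hp hlam h0 y]

/-! ### Converging sequences -/

theorem absLaw_Iio_zero {μ : Measure ℝ} : absLaw μ (Iio 0) = 0 := by
  rw [absLaw, Measure.map_apply continuous_abs.measurable measurableSet_Iio]
  exact measure_mono_null (fun y hy => (abs_nonneg y).not_gt hy) measure_empty

theorem memLp_id_absLaw {μ : Measure ℝ} (h : MemLp id 2 μ) : MemLp id 2 (absLaw μ) :=
  (memLp_map_measure_iff aestronglyMeasurable_id continuous_abs.aemeasurable).2 h.abs

theorem memLp_id_two_iff {μ : Measure ℝ} : MemLp id 2 μ ↔ Integrable (fun t : ℝ => t ^ 2) μ :=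
  memLp_two_iff_integrable_sq aestronglyMeasurable_id

section Converging

variable {μ : Measure ℝ}

theorem IsConvergingSequence.memLp_id {a : (p : ℕ) → Fin p → ℝ} (h : IsConvergingSequence a μ) :
    MemLp id 2 μ :=
  memLp_id_two_iff.2 h.integrable_sq

theorem IsConvergingSequence.orderStat_abs {y : (p : ℕ) → Fin p → ℝ}
    (h : IsConvergingSequence y μ) :
    IsConvergingSequence (fun p => orderStat fun j => |y p j|) (absLaw μ) where
  weak φ := by
    rw [absLaw, integral_map continuous_abs.aemeasurable φ.continuous.aestronglyMeasurable]
    simp only [sum_comp_orderStat _ φ]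
    exact h.weak (φ.compContinuous ⟨fun t => |t|, continuous_abs⟩)
  integrable_sq := memLp_id_two_iff.1 (memLp_id_absLaw h.memLp_id)
  secondMoment := by
    rw [absLaw, integral_map (f := fun t : ℝ => t ^ 2) continuous_abs.aemeasurable
      (measurable_id.pow_const 2).aestronglyMeasurable]
    simp only [sum_comp_orderStat _ fun t => t ^ 2, sq_abs]
    exact h.secondMoment

instance isProbabilityMeasure_absLaw [IsProbabilityMeasure μ] : IsProbabilityMeasure (absLaw μ) :=
  Measure.isProbabilityMeasure_map continuous_abs.aemeasurable

theorem IsConvergingSequence.tendsto_stepFun [IsProbabilityMeasure μ] {a : (p : ℕ) → Fin p → ℝ}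
    (h : IsConvergingSequence a μ) (hm : ∀ p, Monotone (a p)) :
    Tendsto (fun p => ∫ u, (stepFun (a p) u - quantile μ u) ^ 2 ∂unitMeasure) atTop (𝓝 0) := by
  have hcomp : ∀ φ : ℝ → ℝ, ∀ᶠ p : ℕ in atTop,
      (∑ i, φ (a p i)) / (p : ℝ) = ∫ u, φ (stepFun (a p) u) ∂unitMeasure := fun φ => by
    filter_upwards [eventually_gt_atTop 0] with p hp
    exact (integral_eq_sum_of_stepFun hp fun u hu => by rw [stepFun_apply hp (a p) hu]).symm
  exact tendsto_integral_sq_sub_quantile (fun p => monotoneOn_stepFun (hm p))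
    (fun φ => (h.weak φ).congr' (hcomp φ)) h.memLp_id (fun p => memLp_stepFun (a p))
    (h.secondMoment.congr' (hcomp fun t => t ^ 2))

end Converging

theorem IsOptimalShrinkage.tendsto_slopeProx {μy μl : Measure ℝ} [IsProbabilityMeasure μy]
    [IsProbabilityMeasure μl] {η : ℝ → ℝ} (hη : IsOptimalShrinkage (absLaw μy) μl η)
    {y lam : (p : ℕ) → Fin p → ℝ} (hy : IsConvergingSequence y μy)
    (hl : IsConvergingSequence lam μl) (hmono : ∀ p, Monotone (lam p)) (h0 : ∀ p i, 0 ≤ lam p i) :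
    Tendsto (fun p : ℕ => (∑ i, (slopeProx (lam p) (y p) i - η (y p i)) ^ 2) / (p : ℝ))
      atTop (𝓝 0) := by
  have hs := hη.toIsShrinkage
  have hyabs : MemLp id 2 (absLaw μy) := memLp_id_absLaw hy.memLp_id
  have hq : MemLp (quantile (absLaw μy)) 2 unitMeasure := memLp_quantile hyabs
  have hql : MemLp (quantile μl) 2 unitMeasure := memLp_quantile hl.memLp_id
  have hYm : ∀ p, MemLp (absStepFun (y p)) 2 unitMeasure := fun p => memLp_absStepFun _
  have hlm : ∀ p, MemLp (stepFun (lam p)) 2 unitMeasure := fun p => memLp_stepFun _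
  have hY : Tendsto (fun p => ∫ u, (absStepFun (y p) u - quantile (absLaw μy) u) ^ 2 ∂unitMeasure)
      atTop (𝓝 0) := hy.orderStat_abs.tendsto_stepFun fun p => monotone_orderStat _
  have hres := tendsto_integral_sq_residual (fun _ => hs) hs (fun _ => tendsto_const_nhds) hYm hq
    hlm hql hY (hl.tendsto_stepFun hmono)
  have hslack := tendsto_integral_mul (fun p => hs.memLp_residual (hYm p) (hlm p))
    (fun p => hs.memLp_comp (hYm p)) (hs.memLp_residual hq hql) (hs.memLp_comp hq) hres
    (tendsto_integral_sq_shrinkage (fun _ => hs) hs (fun _ => tendsto_const_nhds) hYm hq hY)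
  have hbound := (((hres.sqrt.mul (hy.secondMoment.const_mul 4).sqrt).sub hslack).const_mul 2)
  rw [hη.slack, Real.sqrt_zero, zero_mul, sub_zero, mul_zero] at hbound
  refine squeeze_zero' (.of_forall fun p => by positivity) ?_ hbound
  filter_upwards [eventually_gt_atTop 0] with p hp
  exact hη.sum_sq_slopeProx_sub_comp_div_le hyabs hl.memLp_id hp (hmono p) (h0 p) (y p)

/-! ### Outputs of the procedure -/

theorem IsPoolOutput.unique {μy μl : Measure ℝ} {η η' : ℝ → ℝ}
    (hη : IsPoolOutput μy μl η) (hη' : IsPoolOutput μy μl η') : η = η' := by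
  obtain ⟨G, hr, hm, rfl⟩ := hη
  obtain ⟨G', hr', hm', rfl⟩ := hη'
  rw [poolOutput_unique absLaw_Iio_zero hr hm hr' hm']

section PoolOutput

variable {μy μl : Measure ℝ} [IsProbabilityMeasure μy] [IsProbabilityMeasure μl]
  (hy : MemLp id 2 μy) (hl : MemLp id 2 μl) (hl0 : μl (Iio 0) = 0)

include hy hl hl0

theorem IsPoolOutput.isOptimalShrinkage {η : ℝ → ℝ} (hη : IsPoolOutput μy μl η) :
    IsOptimalShrinkage (absLaw μy) μl η := by
  obtain ⟨G, hr, hm, rfl⟩ := hη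
  exact isOptimalShrinkage_scalarOfG absLaw_Iio_zero (memLp_id_absLaw hy) hl hl0 hr hm

theorem exists_isPoolOutput (hfin : HasFinitelyManyMDIs (absLaw μy) (initialG (absLaw μy) μl)) :
    ∃ η, IsPoolOutput μy μl η := by
  obtain ⟨G, hr, hm⟩ := exists_poolOutput absLaw_Iio_zero
    (isPoolStart_initialG absLaw_Iio_zero (memLp_id_absLaw hy) hl hl0) hfin
  exact ⟨_, G, hr, hm, rfl⟩

theorem exists_isOptimalShrinkage_forall_isPoolOutput_eq :
    ∃ η, IsOptimalShrinkage (absLaw μy) μl η ∧ ∀ η', IsPoolOutput μy μl η' → η' = η := by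
  by_cases hex : ∃ η, IsPoolOutput μy μl η
  · obtain ⟨η, hη⟩ := hex
    exact ⟨η, hη.isOptimalShrinkage hy hl hl0, fun η' hη' => hη'.unique hη⟩
  · obtain ⟨η, hη⟩ :=
      exists_isOptimalShrinkage absLaw_Iio_zero (memLp_id_absLaw hy) hl hl0
    exact ⟨η, hη, fun η' hη' => absurd ⟨η', hη'⟩ hex⟩

end PoolOutput

theorem proposition1 (μy μl : Measure ℝ) [IsProbabilityMeasure μy] [IsProbabilityMeasure μl]
    (hy : Integrable (fun t : ℝ => t ^ 2) μy) (hl : Integrable (fun t : ℝ => t ^ 2) μl)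
    (hl_nonneg : μl (Iio 0) = 0) :
    ∃ η : ℝ → ℝ,
      (∀ t, η (-t) = -η t) ∧ Monotone η ∧ LipschitzWith 1 η ∧
      (∀ η' : ℝ → ℝ, IsPoolOutput μy μl η' → η' = η) ∧
      (HasFinitelyManyMDIs (absLaw μy) (initialG (absLaw μy) μl) → IsPoolOutput μy μl η) ∧
      ∀ y lam : (p : ℕ) → Fin p → ℝ,
        IsConvergingSequence y μy → IsConvergingSequence lam μl →
        (∀ p, Monotone (lam p)) → (∀ p i, 0 ≤ lam p i) →
        Tendsto (fun p : ℕ => (∑ i, (slopeProx (lam p) (y p) i - η (y p i)) ^ 2) / (p : ℝ))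
          atTop (𝓝 0) := by
  obtain ⟨η, hη, huniq⟩ := exists_isOptimalShrinkage_forall_isPoolOutput_eq
    (memLp_id_two_iff.2 hy) (memLp_id_two_iff.2 hl) hl_nonneg
  refine ⟨η, hη.odd, hη.mono, hη.lipschitz, huniq, fun hfin => ?_,
    fun y lam hyconv hlamconv hmono h0 => hη.tendsto_slopeProx hyconv hlamconv hmono h0⟩
  obtain ⟨η', hη'⟩ := exists_isPoolOutput (memLp_id_two_iff.2 hy) (memLp_id_two_iff.2 hl)
    hl_nonneg hfin
  exact huniq η' hη' ▸ hη'
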